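/- Let $G$ and $H$ be second-countable locally compact Hausdorff groupoids with Haar systems $\lambda_G=\{\lambda_G^u\}_{u\in G^{0}}$ and $\lambda_H=\{\lambda_H^v\}_{v\in H^{0}}$, and let $Z$ be a $G$–$H$ equivalence: a locally compact Hausdorff space that is a free and proper left $G$-space and a free and proper right $H$-space with continuous open fibre maps $r:Z\to G^0$ and $s:Z\to H^0$, such that the actions commute and $r$, $s$ induce homeomorphisms $Z/H\cong G^0$ and $G\backslash Z\cong H^0$. For $s(z)=s(w)$ let $[z,w]_G$ be the element of $G$ with $[z,w]_G\cdot w=z$; for $r(z)=r(w)$ let $[z,w]_H$ be the element of $H$ with $z\cdot[z,w]_H=w$. Let $\mathscr B\to G$ and $\mathscr C\to H$ be upper semicontinuous Fell bundles (saturated: every fibre over $x$ is an imprimitivity bimodule over the $C^*$-algebras that are the fibres at $r(x)$ and $s(x)$, with inner products $ab^*$ and $a^*b$; product and involution are continuous), and let $q:\mathscr E\to Z$ be a $\mathscr B$–$\mathscr C$ equivalence: an upper semicontinuous Banach bundle over $Z$ with commuting continuous bilinear left and right actions of $\mathscr B$ and $\mathscr C$, which cover the actions of $G$ and $H$ on $Z$,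 are associative and satisfy $\|b\cdot e\|\le\|b\|\|e\|$, $\|e\cdot c\|\le\|e\|\|c\|$, and with continuous sesquilinear maps ${}_{\mathscr B}\langle e,f\rangle$ (for $s(q(e))=s(q(f))$) and $\langle e,f\rangle_{\mathscr C}$ (for $r(q(e))=r(q(f))$), with values over $[q(e),q(f)]_G$ and $[q(e),q(f)]_H$ respectively, such that ${}_{\mathscr B}\langle e,f\rangle^*={}_{\mathscr B}\langle f,e\rangle$, $\langle e,f\rangle_{\mathscr C}^*=\langle f,e\rangle_{\mathscr C}$, $b\,{}_{\mathscr B}\langle e,f\rangle={}_{\mathscr B}\langle b\cdot e,f\rangle$, $\langle e,f\rangle_{\mathscr C}\,c=\langle e,f\cdot c\rangle_{\mathscr C}$ and ${}_{\mathscr B}\langle e,f\rangle\cdot g=e\cdot\langle f,g\rangle_{\mathscr C}$ whenever these make sense, and such that with these operations every fibre $\mathscr E_z$ is an imprimitivity bimodule over the fibre of $\mathscr B$ at $r(z)$ and the fibre of $\mathscr C$ at $s(z)$. Let $L=G\sqcup Z\sqcup Z^{\mathrm{op}}\sqcup H$ be the linking groupoid, where $Z^{\mathrm{op}}=\{\bar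 z: z\in Z\}$ is a copy of $Z$: its unit space is $G^0\sqcup H^0$, the range and source of $\bar z$ are $s(z)$ and $r(z)$, $z^{-1}=\bar z$, the products extend those of $G$ and $H$ and the actions on $Z$, $\bar z\,g=\overline{g^{-1}\cdot z}$, $h\,\bar z=\overline{z\cdot h^{-1}}$, $z\,\bar w=[z,w]_G$ and $\bar z\,w=[z,w]_H$. Give $L$ the Haar system $\lambda_L$ with $$\int F\,d\lambda_L^w=\int_G F(g)\,d\lambda_G^w(g)+\int_H F(z\cdot h)\,d\lambda_H^{s(z)}(h)\qquad(w\in G^0,\ r(z)=w),$$ $$\int F\,d\lambda_L^w=\int_G F(\bar y\,g)\,d\lambda_G^{r(y)}(g)+\int_H F(h)\,d\lambda_H^{w}(h)\qquad(w\in H^0,\ s(y)=w).$$ Let $\mathscr L=\mathscr B\sqcup\mathscr E\sqcup\mathscr E^{\mathrm{op}}\sqcup\mathscr C\to L$ be the linking bundle, where $\mathscr E^{\mathrm{op}}=\{\bar e: e\in\mathscr E\}$ carries the conjugate Banach space structure on each fibre: its product and involution extend those of $\mathscr B$ and $\mathscr C$ and the actions on $\mathscr E$, and $\bar e\, b=\overline{b^*\cdot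 e}$, $c\,\bar e=\overline{e\cdot c^*}$, $e\bar f={}_{\mathscr B}\langle e,f\rangle$, $\bar e f=\langle e,f\rangle_{\mathscr C}$, $e^*=\bar e$, $\bar e^*=e$. Let $C^*(L;\mathscr L)$ be the completion of the convolution $*$-algebra $\Gamma_c(L;\mathscr L)$ of continuous compactly supported sections in the universal norm, the supremum of the norms in all $I$-norm decreasing $*$-representations on Hilbert spaces. Then there are unique multipliers $P_G$ and $P_H$ of $C^*(L;\mathscr L)$ such that, for all $\varphi\in\Gamma_c(L;\mathscr L)$ and $\zeta\in L$, $$(P_G\varphi)(\zeta)=\chi_{G^0}(r(\zeta))\varphi(\zeta),\qquad(\varphi P_G)(\zeta)=\chi_{G^0}(s(\zeta))\varphi(\zeta),$$ $$(P_H\varphi)(\zeta)=\chi_{H^0}(r(\zeta))\varphi(\zeta),\qquad(\varphi P_H)(\zeta)=\chi_{H^0}(s(\zeta))\varphi(\zeta)$$ (the right-hand sides being again in $\Gamma_c(L;\mathscr L)$); $P_G$ and $P_H$ are self-adjoint projections, and they are full: $C^*(L;\mathscr L)\,P\,C^*(L;\mathscr L)$ spans a dense subspace of $C^*(L;\mathscr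 L)$ for $P=P_G$ and for $P=P_H$. -/

import Mathlib

open MeasureTheory Topology
open scoped ENNReal MultiplierAlgebra

universe u v

noncomputable section

/-! ## Locally compact groupoids and Haar systems -/

/-- The operations of a groupoid, given on the set `G` of its arrows; the unit space is the subset
`units` of `G`. The product `mul x y` is meaningful only if `s x = r y`. -/
structure GroupoidOps (G : Type u) where
  r : G → G
  s : G → G
  inv : G → G
  mul : G → G → G

/-- The unit space `G⁰ ⊆ G`. -/
def GroupoidOps.units {G : Type u} (Γ : GroupoidOps G) : Set G := {x | Γ.r x = x}

/-- The axioms of a topological groupoid. -/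
structure GroupoidOps.IsTopologicalGroupoid {G : Type u} [TopologicalSpace G]
    (Γ : GroupoidOps G) : Prop where
  r_r : ∀ x, Γ.r (Γ.r x) = Γ.r x
  s_r : ∀ x, Γ.s (Γ.r x) = Γ.r x
  r_s : ∀ x, Γ.r (Γ.s x) = Γ.s x
  s_s : ∀ x, Γ.s (Γ.s x) = Γ.s x
  r_mul : ∀ x y, Γ.s x = Γ.r y → Γ.r (Γ.mul x y) = Γ.r x
  s_mul : ∀ x y, Γ.s x = Γ.r y → Γ.s (Γ.mul x y) = Γ.s y
  mul_assoc : ∀ x y z, Γ.s x = Γ.r y → Γ.s y = Γ.r z →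
    Γ.mul (Γ.mul x y) z = Γ.mul x (Γ.mul y z)
  r_mul_self : ∀ x, Γ.mul (Γ.r x) x = x
  mul_s_self : ∀ x, Γ.mul x (Γ.s x) = x
  r_inv : ∀ x, Γ.r (Γ.inv x) = Γ.s x
  s_inv : ∀ x, Γ.s (Γ.inv x) = Γ.r x
  mul_inv : ∀ x, Γ.mul x (Γ.inv x) = Γ.r x
  inv_mul : ∀ x, Γ.mul (Γ.inv x) x = Γ.s x
  continuous_inv : Continuous Γ.inv
  continuousOn_mul : ContinuousOn (fun p : G × G => Γ.mul p.1 p.2) {p | Γ.s p.1 = Γ.r p.2}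

/-- A (left) Haar system `(λᵘ)`, `u ∈ G⁰`: Radon measures on `G` with `supp λᵘ = r⁻¹(u)`, depending
continuously on `u` and left invariant. The values of `lam` outside `G⁰` are irrelevant. -/
structure GroupoidOps.IsHaarSystem {G : Type u} [TopologicalSpace G] [MeasurableSpace G]
    (Γ : GroupoidOps G) (lam : G → Measure G) : Prop where
  regular : ∀ u ∈ Γ.units, (lam u).Regular
  null_compl : ∀ u ∈ Γ.units, lam u {x | Γ.r x ≠ u} = 0
  pos_of_mem : ∀ u ∈ Γ.units, ∀ U : Set G, IsOpen U → (∃ x ∈ U, Γ.r x = u) → 0 < lam u U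
  continuousOn : ∀ f : G → ℝ, Continuous f → HasCompactSupport f →
    ContinuousOn (fun u => ∫ x, f x ∂(lam u)) Γ.units
  left_invariant : ∀ f : G → ℝ, Continuous f → HasCompactSupport f → ∀ x : G,
    ∫ y, f (Γ.mul x y) ∂(lam (Γ.s x)) = ∫ y, f y ∂(lam (Γ.r x))

/-! ## Equivalences of groupoids -/

/-- The operations of a `G`-`H` equivalence `Z`: fibre maps `r : Z → G⁰`, `s : Z → H⁰` and actions
`g · z` (meaningful if `s g = r z`) and `z · h` (meaningful if `s z = r h`). -/
structure EquivalenceOps (G H Z : Type u) where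
  r : Z → G
  s : Z → H
  lact : G → Z → Z
  ract : Z → H → Z

/-- `Z` is a `G`-`H` equivalence: a free and proper left `G`-space and a free and proper right
`H`-space, the fibre maps being continuous and open, such that the actions commute and `r`, `s`
induce homeomorphisms `Z/H ≅ G⁰` and `G\Z ≅ H⁰` (as `r` and `s` are continuous and open, this means
that they are surjective and that their fibres are the orbits). -/
structure EquivalenceOps.IsEquivalence {G H Z : Type u} [TopologicalSpace G] [TopologicalSpace H]
    [TopologicalSpace Z] (X : EquivalenceOps G H Z) (ΓG : GroupoidOps G) (ΓH : GroupoidOps H) :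
    Prop where
  r_mem : ∀ z, X.r z ∈ ΓG.units
  s_mem : ∀ z, X.s z ∈ ΓH.units
  continuous_r : Continuous X.r
  continuous_s : Continuous X.s
  isOpenMap_r : IsOpenMap (fun z => (⟨X.r z, r_mem z⟩ : ΓG.units))
  isOpenMap_s : IsOpenMap (fun z => (⟨X.s z, s_mem z⟩ : ΓH.units))
  -- left action
  r_lact : ∀ g z, ΓG.s g = X.r z → X.r (X.lact g z) = ΓG.r g
  unit_lact : ∀ z, X.lact (X.r z) z = z
  mul_lact : ∀ g g' z, ΓG.s g = ΓG.r g' → ΓG.s g' = X.r z →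
    X.lact (ΓG.mul g g') z = X.lact g (X.lact g' z)
  continuousOn_lact :
    ContinuousOn (fun p : G × Z => X.lact p.1 p.2) {p | ΓG.s p.1 = X.r p.2}
  free_lact : ∀ g z, ΓG.s g = X.r z → X.lact g z = z → g ∈ ΓG.units
  proper_lact : IsProperMap
    (fun p : {p : G × Z // ΓG.s p.1 = X.r p.2} => (X.lact p.1.1 p.1.2, p.1.2))
  -- right action
  s_ract : ∀ z h, X.s z = ΓH.r h → X.s (X.ract z h) = ΓH.s h
  unit_ract : ∀ z, X.ract z (X.s z) = z
  mul_ract : ∀ z h h', X.s z = ΓH.r h → ΓH.s h = ΓH.r h' →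
    X.ract z (ΓH.mul h h') = X.ract (X.ract z h) h'
  continuousOn_ract :
    ContinuousOn (fun p : Z × H => X.ract p.1 p.2) {p | X.s p.1 = ΓH.r p.2}
  free_ract : ∀ z h, X.s z = ΓH.r h → X.ract z h = z → h ∈ ΓH.units
  proper_ract : IsProperMap
    (fun p : {p : Z × H // X.s p.1 = ΓH.r p.2} => (X.ract p.1.1 p.1.2, p.1.1))
  -- the actions commute
  r_ract : ∀ z h, X.s z = ΓH.r h → X.r (X.ract z h) = X.r z
  s_lact : ∀ g z, ΓG.s g = X.r z → X.s (X.lact g z) = X.s z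
  lact_ract : ∀ g z h, ΓG.s g = X.r z → X.s z = ΓH.r h →
    X.ract (X.lact g z) h = X.lact g (X.ract z h)
  -- `Z/H ≅ G⁰` and `G\Z ≅ H⁰`
  surj_r : ∀ u ∈ ΓG.units, ∃ z, X.r z = u
  surj_s : ∀ v ∈ ΓH.units, ∃ z, X.s z = v
  orbit_r : ∀ z w, X.r z = X.r w → ∃ h, X.s z = ΓH.r h ∧ X.ract z h = w
  orbit_s : ∀ z w, X.s z = X.s w → ∃ g, ΓG.s g = X.r w ∧ X.lact g w = z

open Classical in
/-- `[z, w]_G` for `s z = s w`: the unique `g` with `g · w = z`. -/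
def EquivalenceOps.brG {G H Z : Type u} (X : EquivalenceOps G H Z) (ΓG : GroupoidOps G)
    (z w : Z) : G :=
  if h : ∃ g, ΓG.s g = X.r w ∧ X.lact g w = z then h.choose else X.r z

open Classical in
/-- `[z, w]_H` for `r z = r w`: the unique `h` with `z · h = w`. -/
def EquivalenceOps.brH {G H Z : Type u} (X : EquivalenceOps G H Z) (ΓH : GroupoidOps H)
    (z w : Z) : H :=
  if h : ∃ k, X.s z = ΓH.r k ∧ X.ract z k = w then h.choose else X.s z

/-! ## The linking groupoid -/

/-- The disjoint union `L = G ⊔ Z ⊔ Zᵒᵖ ⊔ H`; `zop z` is `z̄`. -/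
inductive Link (G Z H : Type u) : Type u where
  | ofG : G → Link G Z H
  | ofZ : Z → Link G Z H
  | zop : Z → Link G Z H
  | ofH : H → Link G Z H

/-- The disjoint union topology. -/
instance {G Z H : Type u} [tG : TopologicalSpace G] [tZ : TopologicalSpace Z]
    [tH : TopologicalSpace H] : TopologicalSpace (Link G Z H) :=
  tG.coinduced Link.ofG ⊔ tZ.coinduced Link.ofZ ⊔ tZ.coinduced Link.zop ⊔ tH.coinduced Link.ofH

instance {G Z H : Type u} [TopologicalSpace G] [TopologicalSpace Z] [TopologicalSpace H] :
    MeasurableSpace (Link G Z H) := borel _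

instance {G Z H : Type u} [TopologicalSpace G] [TopologicalSpace Z] [TopologicalSpace H] :
    BorelSpace (Link G Z H) := ⟨rfl⟩

/-- The linking groupoid of the equivalence `Z`. The last clause of `mul` concerns only pairs that
are not composable. -/
def EquivalenceOps.link {G H Z : Type u} (X : EquivalenceOps G H Z) (ΓG : GroupoidOps G)
    (ΓH : GroupoidOps H) : GroupoidOps (Link G Z H) where
  r
    | .ofG g => .ofG (ΓG.r g)
    | .ofZ z => .ofG (X.r z)
    | .zop z => .ofH (X.s z)
    | .ofH h => .ofH (ΓH.r h)
  s
    | .ofG g => .ofG (ΓG.s g)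
    | .ofZ z => .ofH (X.s z)
    | .zop z => .ofG (X.r z)
    | .ofH h => .ofH (ΓH.s h)
  inv
    | .ofG g => .ofG (ΓG.inv g)
    | .ofZ z => .zop z
    | .zop z => .ofZ z
    | .ofH h => .ofH (ΓH.inv h)
  mul
    | .ofG g, .ofG g' => .ofG (ΓG.mul g g')
    | .ofG g, .ofZ z => .ofZ (X.lact g z)
    | .ofZ z, .ofH h => .ofZ (X.ract z h)
    | .ofZ z, .zop w => .ofG (X.brG ΓG z w)
    | .zop z, .ofG g => .zop (X.lact (ΓG.inv g) z)
    | .zop z, .ofZ w => .ofH (X.brH ΓH z w)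
    | .ofH h, .zop z => .zop (X.ract z (ΓH.inv h))
    | .ofH h, .ofH h' => .ofH (ΓH.mul h h')
    | x, _ => x

open Classical in
/-- The Haar system on the linking groupoid. For `w ∈ G⁰` it is
`F ↦ ∫_G F(g) dλ_Gʷ(g) + ∫_H F(z · h) dλ_H^{s(z)}(h)`, where `r(z) = w`; for `w ∈ H⁰` it is
`F ↦ ∫_G F(ȳ · g) dλ_G^{s(ȳ)}(g) + ∫_H F(h) dλ_Hʷ(h)`, where `r(ȳ) = w`. By left invariance the
choice of `z` and `y` does not matter. -/
def EquivalenceOps.linkHaar {G H Z : Type u} [TopologicalSpace G] [TopologicalSpace H]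
    [TopologicalSpace Z] [MeasurableSpace G] [MeasurableSpace H]
    (X : EquivalenceOps G H Z) (ΓG : GroupoidOps G)
    (lamG : G → Measure G) (lamH : H → Measure H) : Link G Z H → Measure (Link G Z H)
  | .ofG w => (lamG w).map Link.ofG +
      (if hw : ∃ z, X.r z = w then
        (lamH (X.s hw.choose)).map (fun h => Link.ofZ (X.ract hw.choose h)) else 0)
  | .ofH w =>
      (if hw : ∃ y, X.s y = w then
        (lamG (X.r hw.choose)).map (fun g => Link.zop (X.lact (ΓG.inv g) hw.choose)) else 0) +
      (lamH w).map Link.ofH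
  | .ofZ _ => 0
  | .zop _ => 0

/-! ## Upper semicontinuous Banach bundles -/

/-- The total space of a family `B` of fibres. -/
structure Tot {X : Type u} (B : X → Type v) : Type (max u v) where
  base : X
  vec : B base

open Classical in
/-- The vector of an element of the total space that is known to lie in the fibre over `x`
(and `0` if it does not lie there). -/
def toFibre {X : Type u} {B : X → Type v} [∀ x, Zero (B x)] (x : X) (e : Tot B) : B x :=
  if h : e.base = x then h ▸ e.vec else 0

/-- Given a topology on the total space, the Banach spaces `B x` form an upper semicontinuous
Banach bundle over `X`. -/
structure IsUSCBanachBundle {X : Type u} [TopologicalSpace X] (B : X → Type v)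
    [∀ x, NormedAddCommGroup (B x)] [∀ x, NormedSpace ℂ (B x)] [TopologicalSpace (Tot B)] :
    Prop where
  complete : ∀ x, CompleteSpace (B x)
  continuous_base : Continuous (Tot.base : Tot B → X)
  isOpenMap_base : IsOpenMap (Tot.base : Tot B → X)
  usc_norm : UpperSemicontinuous (fun b : Tot B => ‖b.vec‖)
  continuousOn_add : ContinuousOn
    (fun p : Tot B × Tot B => (⟨p.1.base, p.1.vec + toFibre p.1.base p.2⟩ : Tot B))
    {p | p.1.base = p.2.base}
  continuous_smul : ∀ c : ℂ, Continuous (fun b : Tot B => (⟨b.base, c • b.vec⟩ : Tot B))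
  tendsto_zero : ∀ x : X,
    Filter.comap Tot.base (𝓝 x) ⊓ Filter.comap (fun b : Tot B => ‖b.vec‖) (𝓝 0)
      ≤ 𝓝 (⟨x, 0⟩ : Tot B)

/-! ## Fell bundles -/

/-- The operations of a Fell bundle over `G`: `mul` maps `B x × B y` to `B (x y)`, and is meaningful
only if `s x = r y`; `star` maps `B x` to `B x⁻¹`. -/
structure FellOps {G : Type u} (Γ : GroupoidOps G) (B : G → Type v) where
  mul : ∀ {x y : G}, B x → B y → B (Γ.mul x y)
  star : ∀ {x : G}, B x → B (Γ.inv x)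

namespace FellOps

variable {G : Type u} {Γ : GroupoidOps G} {B : G → Type v}

/-- The product on the total space. -/
def mulT (ℬ : FellOps Γ B) (a b : Tot B) : Tot B := ⟨_, ℬ.mul a.vec b.vec⟩

/-- The involution on the total space. -/
def starT (ℬ : FellOps Γ B) (a : Tot B) : Tot B := ⟨_, ℬ.star a.vec⟩

/-- `p` is a positive element of the C⋆-algebra which is the fibre over the unit `u`:
it is of the form `c* c` there. -/
def IsPositive (ℬ : FellOps Γ B) (u : G) (p : Tot B) : Prop :=
  ∃ c : B u, p = ℬ.mulT (ℬ.starT ⟨u, c⟩) ⟨u, c⟩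

/-- The axioms of a (saturated, upper semicontinuous) Fell bundle. For a unit `x` the clauses
`norm_mul_le` and `norm_star_mul` say that `B x` is a C⋆-algebra. For every `x` the last six clauses
say that `B x` is an imprimitivity bimodule over the fibres at `r x` and `s x`, with
inner products `a b*` and `a* b` (the algebraic identities are contained in the other clauses; for
units these six clauses hold in every C⋆-algebra). -/
structure IsFellBundle [TopologicalSpace G] [∀ x, NormedAddCommGroup (B x)]
    [∀ x, NormedSpace ℂ (B x)] [TopologicalSpace (Tot B)] (ℬ : FellOps Γ B) : Prop
    extends IsUSCBanachBundle B where
  continuousOn_mul : ContinuousOn (fun p : Tot B × Tot B => ℬ.mulT p.1 p.2)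
    {p | Γ.s p.1.base = Γ.r p.2.base}
  continuous_star : Continuous ℬ.starT
  add_mul : ∀ x y, Γ.s x = Γ.r y → ∀ (a a' : B x) (b : B y),
    ℬ.mul (a + a') b = ℬ.mul a b + ℬ.mul a' b
  mul_add : ∀ x y, Γ.s x = Γ.r y → ∀ (a : B x) (b b' : B y),
    ℬ.mul a (b + b') = ℬ.mul a b + ℬ.mul a b'
  smul_mul : ∀ x y, Γ.s x = Γ.r y → ∀ (c : ℂ) (a : B x) (b : B y),
    ℬ.mul (c • a) b = c • ℬ.mul a b
  mul_smul : ∀ x y, Γ.s x = Γ.r y → ∀ (c : ℂ) (a : B x) (b : B y),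
    ℬ.mul a (c • b) = c • ℬ.mul a b
  mul_assoc : ∀ a b c : Tot B, Γ.s a.base = Γ.r b.base → Γ.s b.base = Γ.r c.base →
    ℬ.mulT (ℬ.mulT a b) c = ℬ.mulT a (ℬ.mulT b c)
  star_mul : ∀ a b : Tot B, Γ.s a.base = Γ.r b.base →
    ℬ.starT (ℬ.mulT a b) = ℬ.mulT (ℬ.starT b) (ℬ.starT a)
  star_star : ∀ a : Tot B, ℬ.starT (ℬ.starT a) = a
  star_add : ∀ x (a b : B x), ℬ.star (a + b) = ℬ.star a + ℬ.star b
  star_smul : ∀ x (c : ℂ) (a : B x), ℬ.star (c • a) = (starRingEnd ℂ c) • ℬ.star a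
  norm_mul_le : ∀ u ∈ Γ.units, ∀ a b : B u, ‖ℬ.mul a b‖ ≤ ‖a‖ * ‖b‖
  norm_star_mul : ∀ x (a : B x), ‖ℬ.mul (ℬ.star a) a‖ = ‖a‖ ^ 2
  norm_mul_star : ∀ x (a : B x), ‖ℬ.mul a (ℬ.star a)‖ = ‖a‖ ^ 2
  star_mul_pos : ∀ a : Tot B, ℬ.IsPositive (Γ.s a.base) (ℬ.mulT (ℬ.starT a) a)
  mul_star_pos : ∀ a : Tot B, ℬ.IsPositive (Γ.r a.base) (ℬ.mulT a (ℬ.starT a))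
  full_right : ∀ x, Dense (Submodule.span ℂ
    {d : B (Γ.s x) | ∃ a b : B x, d = toFibre (Γ.s x) ⟨_, ℬ.mul (ℬ.star a) b⟩} :
      Set (B (Γ.s x)))
  full_left : ∀ x, Dense (Submodule.span ℂ
    {d : B (Γ.r x) | ∃ a b : B x, d = toFibre (Γ.r x) ⟨_, ℬ.mul a (ℬ.star b)⟩} :
      Set (B (Γ.r x)))

end FellOps

/-! ## The C⋆-algebra of a Fell bundle -/

/-- `Γ_c(X; B)`: the continuous compactly supported sections. -/
structure CcSection {X : Type u} [TopologicalSpace X] (B : X → Type v) [∀ x, Zero (B x)]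
    [TopologicalSpace (Tot B)] : Type (max u v) where
  toFun : ∀ x, B x
  continuous_toFun : Continuous (fun x => (⟨x, toFun x⟩ : Tot B))
  compact_support : ∃ K : Set X, IsCompact K ∧ ∀ x, x ∉ K → toFun x = 0

namespace FellOps

variable {G : Type u} {Γ : GroupoidOps G} {B : G → Type v}
  [∀ x, NormedAddCommGroup (B x)] [∀ x, NormedSpace ℂ (B x)]

/-- The convolution `(f * g)(x) = ∫ f(y) g(y⁻¹ x) dλ^{r(x)}(y)` of sections. -/
def conv [MeasurableSpace G] (ℬ : FellOps Γ B) (lam : G → Measure G) (f g : ∀ x, B x) (x : G) :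
    B x :=
  ∫ y, toFibre x ⟨_, ℬ.mul (f y) (g (Γ.mul (Γ.inv y) x))⟩ ∂(lam (Γ.r x))

/-- The adjoint `f*(x) = f(x⁻¹)*` of a section. -/
def starSec (ℬ : FellOps Γ B) (f : ∀ x, B x) (x : G) : B x :=
  toFibre x ⟨_, ℬ.star (f (Γ.inv x))⟩

/-- The `I`-norm `max (sup_u ∫ ‖f(x)‖ dλᵘ(x)) (sup_u ∫ ‖f(x⁻¹)‖ dλᵘ(x))`; it is finite on
`Γ_c(G; B)`. -/
def iNorm [MeasurableSpace G] (_ℬ : FellOps Γ B) (lam : G → Measure G) (f : ∀ x, B x) : ℝ :=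
  (max (⨆ u ∈ Γ.units, ∫⁻ x, ‖f x‖ₑ ∂(lam u))
    (⨆ u ∈ Γ.units, ∫⁻ x, ‖f (Γ.inv x)‖ₑ ∂(lam u))).toReal

variable [TopologicalSpace G] [MeasurableSpace G] [TopologicalSpace (Tot B)]

/-- The (nondegenerate) `I`-norm decreasing ⋆-representations of the ⋆-algebra `Γ_c(G; B)` on
Hilbert spaces. The operations of `Γ_c(G; B)` are pointwise addition and scalar multiplication,
convolution and the adjoint. The universe of the Hilbert spaces is that of `Γ_c(G; B)`, which is
large enough for all cyclic representations. -/
structure Rep (ℬ : FellOps Γ B) (lam : G → Measure G) : Type (max u v + 1) where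
  space : Type (max u v)
  [instNormed : NormedAddCommGroup space]
  [instInner : InnerProductSpace ℂ space]
  [instComplete : CompleteSpace space]
  π : CcSection B → (space →L[ℂ] space)
  map_add : ∀ f g h : CcSection B, (∀ x, h.toFun x = f.toFun x + g.toFun x) → π h = π f + π g
  map_smul : ∀ (c : ℂ) (f h : CcSection B), (∀ x, h.toFun x = c • f.toFun x) → π h = c • π f
  map_conv : ∀ f g h : CcSection B, (∀ x, h.toFun x = ℬ.conv lam f.toFun g.toFun x) →
    π h = π f * π g
  map_star : ∀ f h : CcSection B, (∀ x, h.toFun x = ℬ.starSec f.toFun x) → π h = Star.star (π f)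
  norm_le : ∀ f, ‖π f‖ ≤ ℬ.iNorm lam f.toFun
  nondegenerate : Dense (Submodule.span ℂ {ξ : space | ∃ f η, ξ = π f η} : Set space)

attribute [instance] Rep.instNormed Rep.instInner Rep.instComplete

/-- The C⋆-algebra `∏ B(H_ρ)` of bounded families of operators, indexed by the representations
`ρ` of `Γ_c(G; B)`. -/
abbrev Ambient (ℬ : FellOps Γ B) (lam : G → Measure G) : Type (max u v + 1) :=
  lp (fun ρ : Rep ℬ lam => (ρ.space →L[ℂ] ρ.space)) ∞

/-- The universal representation `f ↦ (ρ(f))_ρ`; the norm of `ι f` is the universal norm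
`sup_ρ ‖ρ(f)‖`. -/
def ι₀ (ℬ : FellOps Γ B) (lam : G → Measure G) (f : CcSection B) : Ambient ℬ lam :=
  ⟨fun ρ => ρ.π f, memℓp_infty ⟨ℬ.iNorm lam f.toFun, by rintro _ ⟨ρ, rfl⟩; exact ρ.norm_le f⟩⟩

/-- The closed ⋆-subalgebra generated by the image of `Γ_c(G; B)` under the universal
representation. As this image is a ⋆-subalgebra (`Γ_c(G; B)` being closed under convolution), this
is its closure. -/
def cstarSub (ℬ : FellOps Γ B) (lam : G → Measure G) :
    NonUnitalStarSubalgebra ℂ (Ambient ℬ lam) :=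
  (NonUnitalStarAlgebra.adjoin ℂ (Set.range (ℬ.ι₀ lam))).topologicalClosure

/-- `C*(G; B)`: the completion of `Γ_c(G; B)` in the universal norm, i.e. the supremum of the norms
in all `I`-norm decreasing representations. -/
def CStar (ℬ : FellOps Γ B) (lam : G → Measure G) : Type (max u v + 1) :=
  ℬ.cstarSub lam

instance (ℬ : FellOps Γ B) (lam : G → Measure G) : NonUnitalCStarAlgebra (ℬ.CStar lam) :=
  haveI : IsClosed (ℬ.cstarSub lam : Set (Ambient ℬ lam)) :=
    NonUnitalStarSubalgebra.isClosed_topologicalClosure _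
  inferInstanceAs (NonUnitalCStarAlgebra (ℬ.cstarSub lam))

/-- The canonical map `Γ_c(G; B) → C*(G; B)`. -/
def ι (ℬ : FellOps Γ B) (lam : G → Measure G) (f : CcSection B) : ℬ.CStar lam :=
  ⟨ℬ.ι₀ lam f, NonUnitalStarSubalgebra.le_topologicalClosure _
    (NonUnitalStarAlgebra.subset_adjoin ℂ _ ⟨f, rfl⟩)⟩

open Classical in
/-- `p` is the multiplier of `C*(G; B)` given by the characteristic function of `S ⊆ G⁰`: for
`f ∈ Γ_c(G; B)` the sections `x ↦ χ_S(r(x)) f(x)` and `x ↦ χ_S(s(x)) f(x)` belong to `Γ_c(G; B)`,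
and they are `p f` and `f p`. -/
def IsCutdown (ℬ : FellOps Γ B) (lam : G → Measure G) (S : Set G) (p : 𝓜(ℂ, ℬ.CStar lam)) :
    Prop :=
  ∀ f : CcSection B,
    (∃ g : CcSection B, (∀ x, g.toFun x = if Γ.r x ∈ S then f.toFun x else 0) ∧
      (p * (ℬ.ι lam f : 𝓜(ℂ, ℬ.CStar lam))) = (ℬ.ι lam g : 𝓜(ℂ, ℬ.CStar lam))) ∧
    (∃ g : CcSection B, (∀ x, g.toFun x = if Γ.s x ∈ S then f.toFun x else 0) ∧
      ((ℬ.ι lam f : 𝓜(ℂ, ℬ.CStar lam)) * p) = (ℬ.ι lam g : 𝓜(ℂ, ℬ.CStar lam)))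

end FellOps

/-- A multiplier `p` of `A` is full if `A p A` spans a dense subspace of `A`. -/
def IsFullMultiplier {A : Type*} [NonUnitalCStarAlgebra A] (p : 𝓜(ℂ, A)) : Prop :=
  Dense (Submodule.span ℂ {c : A | ∃ a b : A, (c : 𝓜(ℂ, A)) = (a : 𝓜(ℂ, A)) * p * (b : 𝓜(ℂ, A))} :
    Set A)

/-! ## Equivalences of Fell bundles -/

/-- The operations of an equivalence of Fell bundles on a bundle `E` over `Z`: the actions `b · e`
and `e · c`, and the inner products `⟨e, f⟩_B` (meaningful over the same `s`) and `⟨e, f⟩_C`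
(meaningful over the same `r`), with values over `[q(e), q(f)]_G` and `[q(e), q(f)]_H`. -/
structure BundleEquivalenceOps {G H Z : Type u} (X : EquivalenceOps G H Z) (ΓG : GroupoidOps G)
    (ΓH : GroupoidOps H) (B : G → Type v) (C : H → Type v) (E : Z → Type v) where
  lact : ∀ {g : G} {z : Z}, B g → E z → E (X.lact g z)
  ract : ∀ {z : Z} {h : H}, E z → C h → E (X.ract z h)
  lip : ∀ {z w : Z}, E z → E w → B (X.brG ΓG z w)
  rip : ∀ {z w : Z}, E z → E w → C (X.brH ΓH z w)

namespace BundleEquivalenceOps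

variable {G H Z : Type u} {X : EquivalenceOps G H Z} {ΓG : GroupoidOps G} {ΓH : GroupoidOps H}
  {B : G → Type v} {C : H → Type v} {E : Z → Type v}

/-- The left action on total spaces. -/
def lactT (ℰ : BundleEquivalenceOps X ΓG ΓH B C E) (b : Tot B) (e : Tot E) : Tot E :=
  ⟨_, ℰ.lact b.vec e.vec⟩

/-- The right action on total spaces. -/
def ractT (ℰ : BundleEquivalenceOps X ΓG ΓH B C E) (e : Tot E) (c : Tot C) : Tot E :=
  ⟨_, ℰ.ract e.vec c.vec⟩

/-- The left inner product on total spaces. -/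
def lipT (ℰ : BundleEquivalenceOps X ΓG ΓH B C E) (e f : Tot E) : Tot B :=
  ⟨_, ℰ.lip e.vec f.vec⟩

/-- The right inner product on total spaces. -/
def ripT (ℰ : BundleEquivalenceOps X ΓG ΓH B C E) (e f : Tot E) : Tot C :=
  ⟨_, ℰ.rip e.vec f.vec⟩

/-- `E` is an equivalence between the Fell bundles `ℬ` and `𝒞`. -/
structure IsBundleEquivalence [TopologicalSpace G] [TopologicalSpace H] [TopologicalSpace Z]
    [∀ x, NormedAddCommGroup (B x)] [∀ x, NormedSpace ℂ (B x)] [TopologicalSpace (Tot B)]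
    [∀ x, NormedAddCommGroup (C x)] [∀ x, NormedSpace ℂ (C x)] [TopologicalSpace (Tot C)]
    [∀ x, NormedAddCommGroup (E x)] [∀ x, NormedSpace ℂ (E x)] [TopologicalSpace (Tot E)]
    (ℰ : BundleEquivalenceOps X ΓG ΓH B C E) (ℬ : FellOps ΓG B) (𝒞 : FellOps ΓH C) : Prop
    extends IsUSCBanachBundle E where
  -- left action
  continuousOn_lact : ContinuousOn (fun p : Tot B × Tot E => ℰ.lactT p.1 p.2)
    {p | ΓG.s p.1.base = X.r p.2.base}
  add_lact : ∀ g z, ΓG.s g = X.r z → ∀ (b b' : B g) (e : E z),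
    ℰ.lact (b + b') e = ℰ.lact b e + ℰ.lact b' e
  lact_add : ∀ g z, ΓG.s g = X.r z → ∀ (b : B g) (e e' : E z),
    ℰ.lact b (e + e') = ℰ.lact b e + ℰ.lact b e'
  smul_lact : ∀ g z, ΓG.s g = X.r z → ∀ (c : ℂ) (b : B g) (e : E z),
    ℰ.lact (c • b) e = c • ℰ.lact b e
  lact_smul : ∀ g z, ΓG.s g = X.r z → ∀ (c : ℂ) (b : B g) (e : E z),
    ℰ.lact b (c • e) = c • ℰ.lact b e
  mul_lact : ∀ (a b : Tot B) (e : Tot E), ΓG.s a.base = ΓG.r b.base → ΓG.s b.base = X.r e.base →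
    ℰ.lactT (ℬ.mulT a b) e = ℰ.lactT a (ℰ.lactT b e)
  norm_lact_le : ∀ g z, ΓG.s g = X.r z → ∀ (b : B g) (e : E z), ‖ℰ.lact b e‖ ≤ ‖b‖ * ‖e‖
  -- right action
  continuousOn_ract : ContinuousOn (fun p : Tot E × Tot C => ℰ.ractT p.1 p.2)
    {p | X.s p.1.base = ΓH.r p.2.base}
  add_ract : ∀ z h, X.s z = ΓH.r h → ∀ (e e' : E z) (c : C h),
    ℰ.ract (e + e') c = ℰ.ract e c + ℰ.ract e' c
  ract_add : ∀ z h, X.s z = ΓH.r h → ∀ (e : E z) (c c' : C h),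
    ℰ.ract e (c + c') = ℰ.ract e c + ℰ.ract e c'
  smul_ract : ∀ z h, X.s z = ΓH.r h → ∀ (k : ℂ) (e : E z) (c : C h),
    ℰ.ract (k • e) c = k • ℰ.ract e c
  ract_smul : ∀ z h, X.s z = ΓH.r h → ∀ (k : ℂ) (e : E z) (c : C h),
    ℰ.ract e (k • c) = k • ℰ.ract e c
  ract_mul : ∀ (e : Tot E) (c d : Tot C), X.s e.base = ΓH.r c.base → ΓH.s c.base = ΓH.r d.base →
    ℰ.ractT e (𝒞.mulT c d) = ℰ.ractT (ℰ.ractT e c) d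
  norm_ract_le : ∀ z h, X.s z = ΓH.r h → ∀ (e : E z) (c : C h), ‖ℰ.ract e c‖ ≤ ‖e‖ * ‖c‖
  -- the actions commute
  lact_ract : ∀ (b : Tot B) (e : Tot E) (c : Tot C), ΓG.s b.base = X.r e.base →
    X.s e.base = ΓH.r c.base → ℰ.ractT (ℰ.lactT b e) c = ℰ.lactT b (ℰ.ractT e c)
  -- sesquilinear inner products
  continuousOn_lip : ContinuousOn (fun p : Tot E × Tot E => ℰ.lipT p.1 p.2)
    {p | X.s p.1.base = X.s p.2.base}
  continuousOn_rip : ContinuousOn (fun p : Tot E × Tot E => ℰ.ripT p.1 p.2)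
    {p | X.r p.1.base = X.r p.2.base}
  add_lip : ∀ z w, X.s z = X.s w → ∀ (e e' : E z) (f : E w),
    ℰ.lip (e + e') f = ℰ.lip e f + ℰ.lip e' f
  smul_lip : ∀ z w, X.s z = X.s w → ∀ (k : ℂ) (e : E z) (f : E w),
    ℰ.lip (k • e) f = k • ℰ.lip e f
  rip_add : ∀ z w, X.r z = X.r w → ∀ (e : E z) (f f' : E w),
    ℰ.rip e (f + f') = ℰ.rip e f + ℰ.rip e f'
  rip_smul : ∀ z w, X.r z = X.r w → ∀ (k : ℂ) (e : E z) (f : E w),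
    ℰ.rip e (k • f) = k • ℰ.rip e f
  lip_add : ∀ z w, X.s z = X.s w → ∀ (e : E z) (f f' : E w),
    ℰ.lip e (f + f') = ℰ.lip e f + ℰ.lip e f'
  lip_smul : ∀ z w, X.s z = X.s w → ∀ (k : ℂ) (e : E z) (f : E w),
    ℰ.lip e (k • f) = (starRingEnd ℂ k) • ℰ.lip e f
  add_rip : ∀ z w, X.r z = X.r w → ∀ (e e' : E z) (f : E w),
    ℰ.rip (e + e') f = ℰ.rip e f + ℰ.rip e' f
  smul_rip : ∀ z w, X.r z = X.r w → ∀ (k : ℂ) (e : E z) (f : E w),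
    ℰ.rip (k • e) f = (starRingEnd ℂ k) • ℰ.rip e f
  star_lip : ∀ e f : Tot E, X.s e.base = X.s f.base → ℬ.starT (ℰ.lipT e f) = ℰ.lipT f e
  star_rip : ∀ e f : Tot E, X.r e.base = X.r f.base → 𝒞.starT (ℰ.ripT e f) = ℰ.ripT f e
  mul_lip : ∀ (b : Tot B) (e f : Tot E), ΓG.s b.base = X.r e.base → X.s e.base = X.s f.base →
    ℬ.mulT b (ℰ.lipT e f) = ℰ.lipT (ℰ.lactT b e) f
  rip_mul : ∀ (e f : Tot E) (c : Tot C), X.r e.base = X.r f.base → X.s f.base = ΓH.r c.base →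
    𝒞.mulT (ℰ.ripT e f) c = ℰ.ripT e (ℰ.ractT f c)
  lip_lact : ∀ e f g : Tot E, X.s e.base = X.s f.base → X.r f.base = X.r g.base →
    ℰ.lactT (ℰ.lipT e f) g = ℰ.ractT e (ℰ.ripT f g)
  -- each `E z` is an imprimitivity bimodule over the fibres at `r z` and `s z`
  rip_lact : ∀ z (a : B (X.r z)) (e f : E z),
    ℰ.ripT (ℰ.lactT ⟨_, a⟩ ⟨z, e⟩) ⟨z, f⟩ = ℰ.ripT ⟨z, e⟩ (ℰ.lactT (ℬ.starT ⟨_, a⟩) ⟨z, f⟩)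
  lip_ract : ∀ z (d : C (X.s z)) (e f : E z),
    ℰ.lipT (ℰ.ractT ⟨z, e⟩ ⟨_, d⟩) ⟨z, f⟩ = ℰ.lipT ⟨z, e⟩ (ℰ.ractT ⟨z, f⟩ (𝒞.starT ⟨_, d⟩))
  norm_lip_self : ∀ z (e : E z), ‖ℰ.lip e e‖ = ‖e‖ ^ 2
  norm_rip_self : ∀ z (e : E z), ‖ℰ.rip e e‖ = ‖e‖ ^ 2
  lip_self_pos : ∀ e : Tot E, ℬ.IsPositive (X.r e.base) (ℰ.lipT e e)
  rip_self_pos : ∀ e : Tot E, 𝒞.IsPositive (X.s e.base) (ℰ.ripT e e)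
  full_lip : ∀ z, Dense (Submodule.span ℂ
    {a : B (X.r z) | ∃ e f : E z, a = toFibre (X.r z) ⟨_, ℰ.lip e f⟩} : Set (B (X.r z)))
  full_rip : ∀ z, Dense (Submodule.span ℂ
    {d : C (X.s z) | ∃ e f : E z, d = toFibre (X.s z) ⟨_, ℰ.rip e f⟩} : Set (C (X.s z)))

end BundleEquivalenceOps

/-! ## The linking bundle -/

/-- The conjugate `ē` vectors of a complex normed space. -/
def Conj (V : Type v) : Type v := V

namespace Conj

variable {V : Type v}

/-- The map `e ↦ ē`. -/
def bar (e : V) : Conj V := e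

/-- The map `ē ↦ e`. -/
def unbar (e : Conj V) : V := e

instance [NormedAddCommGroup V] : NormedAddCommGroup (Conj V) :=
  inferInstanceAs (NormedAddCommGroup V)

/-- Scalars act on the conjugate space by `c • ē = bar (c̄ • e)`. -/
instance [NormedAddCommGroup V] [NormedSpace ℂ V] : NormedSpace ℂ (Conj V) where
  smul c e := bar ((starRingEnd ℂ c) • unbar e)
  one_smul e := by
    change (starRingEnd ℂ 1) • unbar e = e
    rw [map_one, one_smul]; rfl
  mul_smul c d e := by
    change (starRingEnd ℂ (c * d)) • unbar e =
      (starRingEnd ℂ c) • ((starRingEnd ℂ d) • unbar e)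
    rw [map_mul, SemigroupAction.mul_smul]
  smul_zero c := smul_zero (A := V) (starRingEnd ℂ c)
  smul_add c e f := smul_add (A := V) (starRingEnd ℂ c) e f
  add_smul c d e := by
    change (starRingEnd ℂ (c + d)) • unbar e =
      (starRingEnd ℂ c) • unbar e + (starRingEnd ℂ d) • unbar e
    rw [map_add, add_smul]
  zero_smul e := by
    change (starRingEnd ℂ 0) • unbar e = (0 : V)
    rw [map_zero, zero_smul]
  norm_smul_le c e := by
    change ‖(starRingEnd ℂ c) • unbar e‖ ≤ ‖c‖ * ‖unbar e‖
    rw [norm_smul, RCLike.norm_conj]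

end Conj

section LinkingBundle

variable {G H Z : Type u}

/-- The fibres of the linking bundle `B ⊔ E ⊔ Eᵒᵖ ⊔ C` over the linking groupoid. -/
def LinkFibre (B : G → Type v) (E : Z → Type v) (C : H → Type v) : Link G Z H → Type v
  | .ofG g => B g
  | .ofZ z => E z
  | .zop z => Conj (E z)
  | .ofH h => C h

variable {B : G → Type v} {E : Z → Type v} {C : H → Type v}

instance [∀ x, NormedAddCommGroup (B x)] [∀ x, NormedAddCommGroup (E x)]
    [∀ x, NormedAddCommGroup (C x)] : ∀ x, NormedAddCommGroup (LinkFibre B E C x)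
  | .ofG g => inferInstanceAs (NormedAddCommGroup (B g))
  | .ofZ z => inferInstanceAs (NormedAddCommGroup (E z))
  | .zop z => inferInstanceAs (NormedAddCommGroup (Conj (E z)))
  | .ofH h => inferInstanceAs (NormedAddCommGroup (C h))

instance [∀ x, NormedAddCommGroup (B x)] [∀ x, NormedAddCommGroup (E x)]
    [∀ x, NormedAddCommGroup (C x)] [∀ x, NormedSpace ℂ (B x)] [∀ x, NormedSpace ℂ (E x)]
    [∀ x, NormedSpace ℂ (C x)] : ∀ x, NormedSpace ℂ (LinkFibre B E C x)
  | .ofG g => inferInstanceAs (NormedSpace ℂ (B g))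
  | .ofZ z => inferInstanceAs (NormedSpace ℂ (E z))
  | .zop z => inferInstanceAs (NormedSpace ℂ (Conj (E z)))
  | .ofH h => inferInstanceAs (NormedSpace ℂ (C h))

/-- The inclusions of `B`, `E`, `Eᵒᵖ` (as the copy `ē` of `E`) and `C` into the linking bundle. -/
def LinkFibre.inB (b : Tot B) : Tot (LinkFibre B E C) := ⟨.ofG b.base, b.vec⟩

/-- See `LinkFibre.inB`. -/
def LinkFibre.inE (e : Tot E) : Tot (LinkFibre B E C) := ⟨.ofZ e.base, e.vec⟩

/-- See `LinkFibre.inB`. -/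
def LinkFibre.inEop (e : Tot E) : Tot (LinkFibre B E C) := ⟨.zop e.base, Conj.bar e.vec⟩

/-- See `LinkFibre.inB`. -/
def LinkFibre.inC (c : Tot C) : Tot (LinkFibre B E C) := ⟨.ofH c.base, c.vec⟩

/-- The disjoint union topology on the linking bundle. -/
instance [tB : TopologicalSpace (Tot B)] [tE : TopologicalSpace (Tot E)]
    [tC : TopologicalSpace (Tot C)] : TopologicalSpace (Tot (LinkFibre B E C)) :=
  tB.coinduced LinkFibre.inB ⊔ tE.coinduced LinkFibre.inE ⊔ tE.coinduced LinkFibre.inEop ⊔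
    tC.coinduced LinkFibre.inC

/-- The product and the involution of the linking bundle: those of `ℬ` and `𝒞`, the actions on `E`,
the actions `ē · b = bar (b* · e)` and `c · ē = bar (e · c*)` on `Eᵒᵖ`, the products
`e f̄ = ⟨e, f⟩_B` and `ē f = ⟨e, f⟩_C`, and `e* = ē`, `ē* = e`. The last clause of `mul` concerns
only pairs that are not composable. -/
def BundleEquivalenceOps.link [∀ x, NormedAddCommGroup (B x)] [∀ x, NormedAddCommGroup (E x)]
    [∀ x, NormedAddCommGroup (C x)] {X : EquivalenceOps G H Z} {ΓG : GroupoidOps G}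
    {ΓH : GroupoidOps H} (ℰ : BundleEquivalenceOps X ΓG ΓH B C E) (ℬ : FellOps ΓG B)
    (𝒞 : FellOps ΓH C) : FellOps (X.link ΓG ΓH) (LinkFibre B E C) where
  mul {x y} := match x, y with
    | .ofG g, .ofG g' => fun (a : B g) (b : B g') => (ℬ.mul a b : B (ΓG.mul g g'))
    | .ofG g, .ofZ z => fun (b : B g) (e : E z) => (ℰ.lact b e : E (X.lact g z))
    | .ofZ z, .ofH h => fun (e : E z) (c : C h) => (ℰ.ract e c : E (X.ract z h))
    | .ofZ z, .zop w => fun (e : E z) (f : Conj (E w)) =>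
        (ℰ.lip e (Conj.unbar f) : B (X.brG ΓG z w))
    | .zop z, .ofG g => fun (e : Conj (E z)) (b : B g) =>
        (Conj.bar (ℰ.lact (ℬ.star b) (Conj.unbar e)) : Conj (E (X.lact (ΓG.inv g) z)))
    | .zop z, .ofZ w => fun (e : Conj (E z)) (f : E w) =>
        (ℰ.rip (Conj.unbar e) f : C (X.brH ΓH z w))
    | .ofH h, .zop z => fun (c : C h) (e : Conj (E z)) =>
        (Conj.bar (ℰ.ract (Conj.unbar e) (𝒞.star c)) : Conj (E (X.ract z (ΓH.inv h))))
    | .ofH h, .ofH h' => fun (c : C h) (d : C h') => (𝒞.mul c d : C (ΓH.mul h h'))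
    | _, _ => fun _ _ => 0
  star {x} := match x with
    | .ofG g => fun (b : B g) => (ℬ.star b : B (ΓG.inv g))
    | .ofZ z => fun (e : E z) => (Conj.bar e : Conj (E z))
    | .zop z => fun (e : Conj (E z)) => (Conj.unbar e : E z)
    | .ofH h => fun (c : C h) => (𝒞.star c : C (ΓH.inv h))

end LinkingBundle

end

/-!
Multiplication of sections by `χ_S ∘ r` or `χ_S ∘ s`, for a clopen part `S` of the unit space of a
groupoid, gives a full projection in the multiplier algebra of the C⋆-algebra of a saturated bundle
as soon as every range fibre meets `s⁻¹(S)`. This is proved for any bundle with the properties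
collected in `FellOps.IsConvolutionBundle`, and the linking bundle has these properties
(`isConvolutionBundle_link`).

*The multiplier.* If `τ` is a function on the unit space with values `±1`, then `(τ f)* * (τ f)` and
`f* * f` agree, so that multiplication by `τ` is isometric in the universal norm (`norm_ι_lsmul`).
For `τ = 2 χ_S - 1` this shows that multiplication by `χ_S` is contractive. It extends therefore to
the completion, on either side, and the two extensions form a multiplier `cutdown`. Uniqueness
(`existsUnique_isCutdown`) and the projection property (`isStarProjection_of_isCutdown`) hold because
the sections are dense (`denseRange_ι`).

*Fullness* (`isFullMultiplier_of_isCutdown`). Every section can be written as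
`f x = ∫ Φ y • f' x dλ^{r x}(y)`, where `Φ ∈ C_c` is supported in `s⁻¹(S)` (`exists_integral_eq`).
With `x = y w` the integrand is a continuous compactly supported family of vectors over the
composable pairs `(y, w)`. Since `B_y B_w` spans a dense subspace of `B_{y w}` and there are
continuous sections through a dense set of vectors of every fibre (`exists_ccSection_near`), such a
family is a uniform limit of sums of products `a y * b w`, in which the sections `a` are supported
in `s⁻¹(S)` (`exists_simple_approx`). The integral of such a sum is a sum of convolutions `a * b`
with `a p = a`, hence lies in `A p A`, and uniform approximation on a fixed compact set is
approximation in the `I`-norm (`exists_iNorm_bound`), which dominates the universal norm.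

*The linking bundle.* The summands of `λ_L` other than `λ_G` and `λ_H` are images of a Haar system
on the orbits of a proper action (`IsOrbitAction`). They depend on the orbit only, by left
invariance, and continuously, by properness. The bundle is a disjoint union of upper semicontinuous
bundles. For the density of `𝓛_y 𝓛_w` in `𝓛_{y w}` (`dense_span_link_mul`) one approximates a vector
by elements of `𝓛_{r y} 𝓛_{y w}`, with an approximate unit of the C⋆-algebra `𝓛_{r y}`
(`exists_norm_sub_act_lt`), uses that `𝓛_y 𝓛_y*` spans a dense subspace of `𝓛_{r y}`, and concludes
with `(a b*) c = a (b* c)`.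
-/

noncomputable section

set_option linter.unusedSectionVars false

open Filter

/-! ### Upper semicontinuous Banach bundles -/

section TotalSpace

variable {X : Type u} {B : X → Type v}

theorem toFibre_mk [∀ x, Zero (B x)] (x : X) (b : B x) : toFibre x (⟨x, b⟩ : Tot B) = b := by
  simp [toFibre]

theorem mk_toFibre [∀ x, Zero (B x)] {x : X} {e : Tot B} (h : e.base = x) :
    (⟨x, toFibre x e⟩ : Tot B) = e := by
  subst h; cases e; rw [toFibre_mk]

theorem toFibre_eq_iff [∀ x, Zero (B x)] {x : X} {e : Tot B} (h : e.base = x) {b : B x} :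
    toFibre x e = b ↔ e = ⟨x, b⟩ := by
  subst h; cases e; simp [toFibre_mk]

theorem norm_toFibre [∀ x, NormedAddCommGroup (B x)] {x : X} {e : Tot B} (h : e.base = x) :
    ‖toFibre x e‖ = ‖e.vec‖ := by
  subst h; cases e; rw [toFibre_mk]

theorem toFibre_mk_add [∀ x, NormedAddCommGroup (B x)] {x z : X} (a b : B z) :
    toFibre x (⟨z, a + b⟩ : Tot B) = toFibre x ⟨z, a⟩ + toFibre x ⟨z, b⟩ := by
  by_cases hz : z = x
  · subst hz; simp [toFibre_mk]
  · simp [toFibre, hz]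

theorem toFibre_mk_smul [∀ x, NormedAddCommGroup (B x)] [∀ x, NormedSpace ℂ (B x)] {x z : X}
    (c : ℂ) (b : B z) : toFibre x (⟨z, c • b⟩ : Tot B) = c • toFibre x ⟨z, b⟩ := by
  by_cases hz : z = x
  · subst hz; simp [toFibre_mk]
  · simp [toFibre, hz]

end TotalSpace

namespace IsUSCBanachBundle

variable {X : Type u} [TopologicalSpace X] {B : X → Type v} [∀ x, NormedAddCommGroup (B x)]
  [∀ x, NormedSpace ℂ (B x)] [TopologicalSpace (Tot B)]

section Tendsto

variable {α : Type*} {l : Filter α} {p : α → X} {x : X}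

theorem tendsto_base (hB : IsUSCBanachBundle B) {f : ∀ a, B (p a)} {b : B x}
    (hf : Tendsto (fun a => (⟨p a, f a⟩ : Tot B)) l (𝓝 ⟨x, b⟩)) : Tendsto p l (𝓝 x) :=
  (hB.continuous_base.tendsto _).comp hf

theorem tendsto_add (hB : IsUSCBanachBundle B) {f g : ∀ a, B (p a)} {b c : B x}
    (hf : Tendsto (fun a => (⟨p a, f a⟩ : Tot B)) l (𝓝 ⟨x, b⟩))
    (hg : Tendsto (fun a => (⟨p a, g a⟩ : Tot B)) l (𝓝 ⟨x, c⟩)) :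
    Tendsto (fun a => (⟨p a, f a + g a⟩ : Tot B)) l (𝓝 ⟨x, b + c⟩) := by
  have h := hB.continuousOn_add (⟨x, b⟩, ⟨x, c⟩) rfl
  have h2 := h.tendsto.comp
    (tendsto_nhdsWithin_iff.2 ⟨hf.prodMk_nhds hg, .of_forall fun a => rfl⟩)
  simpa [toFibre_mk, Function.comp_def] using h2

theorem tendsto_const_smul (hB : IsUSCBanachBundle B) {f : ∀ a, B (p a)} {b : B x} (c : ℂ)
    (hf : Tendsto (fun a => (⟨p a, f a⟩ : Tot B)) l (𝓝 ⟨x, b⟩)) :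
    Tendsto (fun a => (⟨p a, c • f a⟩ : Tot B)) l (𝓝 ⟨x, c • b⟩) :=
  ((hB.continuous_smul c).tendsto _).comp hf

theorem tendsto_neg (hB : IsUSCBanachBundle B) {f : ∀ a, B (p a)} {b : B x}
    (hf : Tendsto (fun a => (⟨p a, f a⟩ : Tot B)) l (𝓝 ⟨x, b⟩)) :
    Tendsto (fun a => (⟨p a, -f a⟩ : Tot B)) l (𝓝 ⟨x, -b⟩) := by
  simpa using hB.tendsto_const_smul (-1) hf

theorem tendsto_sub (hB : IsUSCBanachBundle B) {f g : ∀ a, B (p a)} {b c : B x}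
    (hf : Tendsto (fun a => (⟨p a, f a⟩ : Tot B)) l (𝓝 ⟨x, b⟩))
    (hg : Tendsto (fun a => (⟨p a, g a⟩ : Tot B)) l (𝓝 ⟨x, c⟩)) :
    Tendsto (fun a => (⟨p a, f a - g a⟩ : Tot B)) l (𝓝 ⟨x, b - c⟩) := by
  simpa [sub_eq_add_neg] using hB.tendsto_add hf (hB.tendsto_neg hg)

theorem tendsto_zero_of_norm (hB : IsUSCBanachBundle B) {f : ∀ a, B (p a)}
    (hp : Tendsto p l (𝓝 x)) (hf : Tendsto (fun a => ‖f a‖) l (𝓝 0)) :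
    Tendsto (fun a => (⟨p a, f a⟩ : Tot B)) l (𝓝 ⟨x, 0⟩) := by
  refine le_trans ?_ (hB.tendsto_zero x)
  exact le_inf (tendsto_comap_iff.2 hp) (tendsto_comap_iff.2 hf)

theorem eventually_norm_lt (hB : IsUSCBanachBundle B) {f : ∀ a, B (p a)} {b : B x} {r : ℝ}
    (hf : Tendsto (fun a => (⟨p a, f a⟩ : Tot B)) l (𝓝 ⟨x, b⟩)) (hr : ‖b‖ < r) :
    ∀ᶠ a in l, ‖f a‖ < r :=
  hf.eventually (hB.usc_norm ⟨x, b⟩ r hr)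

theorem tendsto_smul (hB : IsUSCBanachBundle B) {f : ∀ a, B (p a)} {b : B x} {c : α → ℂ} {k : ℂ}
    (hc : Tendsto c l (𝓝 k)) (hf : Tendsto (fun a => (⟨p a, f a⟩ : Tot B)) l (𝓝 ⟨x, b⟩)) :
    Tendsto (fun a => (⟨p a, c a • f a⟩ : Tot B)) l (𝓝 ⟨x, k • b⟩) := by
  have h0 : Tendsto (fun a => ‖(c a - k) • f a‖) l (𝓝 0) := by
    have h1 : Tendsto (fun a => ‖c a - k‖ * (‖b‖ + 1)) l (𝓝 0) := by
      have := (tendsto_sub_nhds_zero_iff.2 hc).norm.mul_const (‖b‖ + 1)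
      simpa using this
    refine squeeze_zero' (.of_forall fun a => norm_nonneg _) ?_ h1
    filter_upwards [hB.eventually_norm_lt hf (lt_add_one ‖b‖)] with a ha
    rw [norm_smul]
    gcongr
  have := hB.tendsto_add (hB.tendsto_const_smul k hf)
    (hB.tendsto_zero_of_norm (hB.tendsto_base hf) h0)
  simpa [← add_smul] using this

theorem tendsto_sum (hB : IsUSCBanachBundle B) {ι : Type*} (s : Finset ι) {f : ι → ∀ a, B (p a)}
    {b : ι → B x} (hp : Tendsto p l (𝓝 x))
    (hf : ∀ i ∈ s, Tendsto (fun a => (⟨p a, f i a⟩ : Tot B)) l (𝓝 ⟨x, b i⟩)) :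
    Tendsto (fun a => (⟨p a, ∑ i ∈ s, f i a⟩ : Tot B)) l (𝓝 ⟨x, ∑ i ∈ s, b i⟩) := by
  classical
  induction s using Finset.induction_on with
  | empty => simpa using hB.tendsto_zero_of_norm (f := fun a => 0) hp (by simp [tendsto_const_nhds])
  | insert i s hi ih =>
    simp only [Finset.sum_insert hi]
    exact hB.tendsto_add (hf i (by simp)) (ih fun j hj => hf j (by simp [hj]))

/-- The relative topology on a fibre is the norm topology. -/
theorem tendsto_fibre_iff (hB : IsUSCBanachBundle B) {f : α → B x} {b : B x} :
    Tendsto (fun a => (⟨x, f a⟩ : Tot B)) l (𝓝 ⟨x, b⟩) ↔ Tendsto f l (𝓝 b) := by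
  constructor
  · intro h
    have h1 := hB.tendsto_sub (p := fun _ => x) h (tendsto_const_nhds (x := (⟨x, b⟩ : Tot B)))
    rw [sub_self] at h1
    rw [tendsto_iff_norm_sub_tendsto_zero, Metric.tendsto_nhds]
    intro ε hε
    filter_upwards [hB.eventually_norm_lt (r := ε) h1 (by simpa using hε)] with a ha
    simpa using ha
  · intro h
    have h1 := hB.tendsto_zero_of_norm (p := fun _ => x) (f := fun a => f a - b)
      tendsto_const_nhds (tendsto_iff_norm_sub_tendsto_zero.1 h)
    simpa using hB.tendsto_add h1 (tendsto_const_nhds (x := (⟨x, b⟩ : Tot B)))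

end Tendsto

theorem continuous_fibre (hB : IsUSCBanachBundle B) (x : X) :
    Continuous (fun b : B x => (⟨x, b⟩ : Tot B)) :=
  continuous_iff_continuousAt.2 fun _ => hB.tendsto_fibre_iff.2 tendsto_id

/-- Every vector has a neighbourhood in the total space that meets each fibre in a set of diameter
less than `ε`. -/
theorem exists_thin_nhds (hB : IsUSCBanachBundle B) {x : X} {b c : B x} {ε : ℝ}
    (h : ‖b - c‖ < ε) :
    ∃ V ∈ 𝓝 (⟨x, b⟩ : Tot B), ∃ W ∈ 𝓝 (⟨x, c⟩ : Tot B), ∀ y (v w : B y),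
      (⟨y, v⟩ : Tot B) ∈ V → (⟨y, w⟩ : Tot B) ∈ W → ‖v - w‖ < ε := by
  let α := {q : Tot B × Tot B // q.1.base = q.2.base}
  let l : Filter α := comap Subtype.val (𝓝 ((⟨x, b⟩ : Tot B), (⟨x, c⟩ : Tot B)))
  have h1 : Tendsto (fun a : α => (⟨a.1.1.base, a.1.1.vec⟩ : Tot B)) l (𝓝 ⟨x, b⟩) :=
    (continuous_fst.tendsto ((⟨x, b⟩ : Tot B), (⟨x, c⟩ : Tot B))).comp tendsto_comap
  have h2 : Tendsto (fun a : α => (⟨a.1.1.base, toFibre a.1.1.base a.1.2⟩ : Tot B)) l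
      (𝓝 ⟨x, c⟩) := by
    have : Tendsto (fun a : α => a.1.2) l (𝓝 ⟨x, c⟩) :=
      (continuous_snd.tendsto ((⟨x, b⟩ : Tot B), (⟨x, c⟩ : Tot B))).comp tendsto_comap
    refine this.congr fun a => ?_
    exact (mk_toFibre a.2.symm).symm
  obtain ⟨s, hs, hs'⟩ := mem_comap.1 (hB.eventually_norm_lt (hB.tendsto_sub h1 h2) h)
  obtain ⟨V, hV, W, hW, hVW⟩ := mem_nhds_prod_iff.1 hs
  refine ⟨V, hV, W, hW, fun y v w hv hw => ?_⟩
  have := hs' (show (⟨(⟨y, v⟩, ⟨y, w⟩), rfl⟩ : α) ∈ Subtype.val ⁻¹' s from hVW ⟨hv, hw⟩)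
  simpa [toFibre_mk] using this

/-- Sums of elements near `b` and elements of small norm are near `b`. -/
theorem exists_nhds_add (hB : IsUSCBanachBundle B) {x : X} {b : B x} {W : Set (Tot B)}
    (hW : W ∈ 𝓝 (⟨x, b⟩ : Tot B)) :
    ∃ V ∈ 𝓝 (⟨x, b⟩ : Tot B), ∃ δ > 0, ∀ y (v w : B y),
      (⟨y, v⟩ : Tot B) ∈ V → ‖w - v‖ < δ → (⟨y, w⟩ : Tot B) ∈ W := by
  have h := hB.continuousOn_add (⟨x, b⟩, ⟨x, 0⟩) rfl
  simp only [ContinuousWithinAt, toFibre_mk, add_zero] at h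
  have h1 := h hW
  rw [mem_map, mem_nhdsWithin_iff_exists_mem_nhds_inter] at h1
  obtain ⟨u, hu, hu'⟩ := h1
  obtain ⟨V, hV, N, hN, hVN⟩ := mem_nhds_prod_iff.1 hu
  obtain ⟨s, hs, t, ht, rfl⟩ := mem_inf_iff.1 (hB.tendsto_zero x hN)
  obtain ⟨U, hU, hUs⟩ := mem_comap.1 hs
  obtain ⟨T, hT, hTt⟩ := mem_comap.1 ht
  obtain ⟨δ, hδ, hδT⟩ := Metric.mem_nhds_iff.1 hT
  refine ⟨V ∩ Tot.base ⁻¹' U, inter_mem hV (hB.continuous_base.continuousAt.preimage_mem_nhds hU),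
    δ, hδ, fun y v w hv hw => ?_⟩
  have h2 : (⟨y, w - v⟩ : Tot B) ∈ s ∩ t := ⟨hUs hv.2, hTt (hδT (by simpa using hw))⟩
  have h5 := hu' ⟨hVN (Set.mk_mem_prod hv.1 h2), rfl⟩
  simpa [toFibre_mk] using h5

/-! ### Existence of continuous sections -/

/-- The section `f` is continuous at `x` up to an error less than `ε`: near `x` its values are
within `ε` of every prescribed neighbourhood of `f x` in the total space. -/
def NearlyContinuousAt (f : ∀ x, B x) (x : X) (ε : ℝ) : Prop :=
  ∀ W ∈ 𝓝 (⟨x, f x⟩ : Tot B), ∀ᶠ y in 𝓝 x, ∃ w : B y, (⟨y, w⟩ : Tot B) ∈ W ∧ ‖f y - w‖ < ε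

/-- A section that is continuous at `x` up to every positive error is continuous at `x`. -/
theorem continuousAt_of_nearly (hB : IsUSCBanachBundle B) {f : ∀ x, B x} {x : X}
    (h : ∀ ε > 0, NearlyContinuousAt f x ε) :
    ContinuousAt (fun y => (⟨y, f y⟩ : Tot B)) x := by
  intro W hW
  obtain ⟨V, hV, δ, hδ, hVW⟩ := hB.exists_nhds_add hW
  rw [mem_map]
  filter_upwards [h δ hδ V hV] with y ⟨w, hw, hwf⟩
  exact hVW y w _ hw hwf

theorem nearlyContinuousAt_of_continuousAt {f : ∀ x, B x} {x : X}
    (h : ContinuousAt (fun y => (⟨y, f y⟩ : Tot B)) x) {ε : ℝ} (hε : 0 < ε) :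
    NearlyContinuousAt f x ε := by
  intro W hW
  filter_upwards [h hW] with y hy
  exact ⟨f y, hy, by simpa using hε⟩

theorem eventually_exists_mem (hB : IsUSCBanachBundle B) {x : X} {b : B x} {W : Set (Tot B)}
    (hW : W ∈ 𝓝 (⟨x, b⟩ : Tot B)) : ∀ᶠ y in 𝓝 x, ∃ w : B y, (⟨y, w⟩ : Tot B) ∈ W := by
  have := hB.isOpenMap_base.image_mem_nhds hW
  filter_upwards [this] with y hy
  obtain ⟨⟨y', w⟩, hw, rfl⟩ := hy
  exact ⟨w, hw⟩

/-- Approximate continuity is stable under uniform approximation. -/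
theorem NearlyContinuousAt.of_norm_sub_le (hB : IsUSCBanachBundle B) {f g : ∀ x, B x} {x : X}
    {ε δ η : ℝ} (hη : 0 < η) (hg : NearlyContinuousAt g x ε)
    (hfg : ∀ᶠ y in 𝓝 x, ‖f y - g y‖ ≤ δ) : NearlyContinuousAt f x (ε + 2 * δ + η) := by
  intro W hW
  have hx : ‖f x - g x‖ < δ + η := lt_of_le_of_lt hfg.self_of_nhds (by linarith)
  obtain ⟨V, hV, V', hV', hVV⟩ := hB.exists_thin_nhds hx
  filter_upwards [hg V' hV', hfg, hB.eventually_exists_mem (inter_mem hV hW)]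
    with y ⟨w, hw, hwg⟩ hy ⟨w', hw'V, hw'W⟩
  refine ⟨w', hw'W, ?_⟩
  have h1 := hVV y w' w hw'V hw
  calc ‖f y - w'‖ = ‖(f y - g y) + (g y - w) + (w - w')‖ := by congr 1; abel
    _ ≤ ‖f y - g y‖ + ‖g y - w‖ + ‖w - w'‖ := norm_add₃_le
    _ < _ := by rw [norm_sub_rev w w']; linarith

/-- A section that can be approximated by continuous sections, locally uniformly, is continuous. -/
theorem continuousAt_of_approx (hB : IsUSCBanachBundle B) {f : ∀ x, B x} {x : X}
    (h : ∀ ε > 0, ∃ g : ∀ x, B x, ContinuousAt (fun y => (⟨y, g y⟩ : Tot B)) x ∧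
      ∀ᶠ y in 𝓝 x, ‖f y - g y‖ ≤ ε) :
    ContinuousAt (fun y => (⟨y, f y⟩ : Tot B)) x := by
  refine hB.continuousAt_of_nearly fun ε hε => ?_
  obtain ⟨g, hg, hfg⟩ := h (ε / 4) (by positivity)
  have := NearlyContinuousAt.of_norm_sub_le hB (η := ε / 4) (by positivity)
    (nearlyContinuousAt_of_continuousAt hg (ε := ε / 4) (by positivity)) hfg
  have h2 : ε / 4 + 2 * (ε / 4) + ε / 4 = ε := by ring
  rwa [h2] at this

end IsUSCBanachBundle

/-- Partitions of unity on a compact set. -/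
theorem exists_partition_of_compact {X : Type*} [TopologicalSpace X] [LocallyCompactSpace X]
    [T2Space X] {ι : Type*} [Fintype ι] {K : Set X} (hK : IsCompact K) (V : ι → Set X)
    (hV : ∀ i, IsOpen (V i)) (hKV : K ⊆ ⋃ i, V i) :
    ∃ φ : ι → C(X, ℝ), (∀ i, tsupport (φ i) ⊆ V i) ∧ (∀ i, HasCompactSupport (φ i)) ∧
      (∀ i x, 0 ≤ φ i x) ∧ (∀ x, ∑ i, φ i x ≤ 1) ∧ ∀ x ∈ K, ∑ i, φ i x = 1 := by
  obtain ⟨f, hfV, hf⟩ := PartitionOfUnity.exists_isSubordinate_of_locallyFinite_t2space hK V hV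
    (locallyFinite_of_finite _) hKV
  refine ⟨f, hfV, hf, fun i x => f.nonneg i x, fun x => ?_, fun x hx => ?_⟩
  · rw [← finsum_eq_sum_of_fintype]; exact f.sum_le_one x
  · rw [← finsum_eq_sum_of_fintype]; exact f.sum_eq_one hx

namespace IsUSCBanachBundle

variable {X : Type u} [TopologicalSpace X] {B : X → Type v} [∀ x, NormedAddCommGroup (B x)]
  [∀ x, NormedSpace ℂ (B x)] [TopologicalSpace (Tot B)]

theorem NearlyContinuousAt.mono {f : ∀ x, B x} {x : X} {ε δ : ℝ}
    (hf : NearlyContinuousAt f x ε) (h : ε ≤ δ) : NearlyContinuousAt f x δ := fun W hW => by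
  filter_upwards [hf W hW] with y ⟨w, hw, hwf⟩ using ⟨w, hw, hwf.trans_le h⟩

theorem NearlyContinuousAt.add (hB : IsUSCBanachBundle B) {f g : ∀ x, B x} {x : X} {ε δ : ℝ}
    (hf : NearlyContinuousAt f x ε) (hg : NearlyContinuousAt g x δ) :
    NearlyContinuousAt (fun y => f y + g y) x (ε + δ) := by
  intro W hW
  have h := hB.continuousOn_add (⟨x, f x⟩, ⟨x, g x⟩) rfl
  simp only [ContinuousWithinAt, toFibre_mk] at h
  have h1 := h hW
  rw [mem_map, mem_nhdsWithin_iff_exists_mem_nhds_inter] at h1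
  obtain ⟨u, hu, hu'⟩ := h1
  obtain ⟨V, hV, V', hV', hVV⟩ := mem_nhds_prod_iff.1 hu
  filter_upwards [hf V hV, hg V' hV'] with y ⟨v, hv, hvf⟩ ⟨w, hw, hwg⟩
  refine ⟨v + w, ?_, ?_⟩
  · have := hu' ⟨hVV (Set.mk_mem_prod hv hw), rfl⟩
    simpa [toFibre_mk] using this
  · rw [add_sub_add_comm]
    exact (norm_add_le _ _).trans_lt (add_lt_add hvf hwg)

theorem NearlyContinuousAt.smul (hB : IsUSCBanachBundle B) {f : ∀ x, B x} {x : X} {ε η : ℝ}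
    (hf : NearlyContinuousAt f x ε) {φ : X → ℂ} (hφ : ContinuousAt φ x) (hη : 0 < η) :
    NearlyContinuousAt (fun y => φ y • f y) x (‖φ x‖ * ε + η) := by
  intro W hW
  have h := hB.tendsto_smul (l := 𝓝 (⟨x, f x⟩ : Tot B)) (p := Tot.base) (f := Tot.vec)
    (c := fun e => φ e.base)
    (hφ.tendsto.comp (hB.continuous_base.tendsto (⟨x, f x⟩ : Tot B))) tendsto_id
  have h2 : ∀ᶠ y in 𝓝 x, ‖φ y‖ * ε < ‖φ x‖ * ε + η :=
    (hφ.norm.mul_const ε).eventually_lt_const (by linarith)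
  filter_upwards [hf _ (h hW), h2] with y ⟨w, hw, hwf⟩ hy
  refine ⟨φ y • w, hw, ?_⟩
  rw [← smul_sub, norm_smul]
  exact lt_of_le_of_lt (by gcongr) hy

theorem nearlyContinuousAt_zero (hB : IsUSCBanachBundle B) {f : ∀ x, B x} {x : X} {η : ℝ}
    (hη : 0 < η) (hf : ∀ᶠ y in 𝓝 x, f y = 0) : NearlyContinuousAt f x η := by
  refine nearlyContinuousAt_of_continuousAt ?_ hη
  have h0 : f x = 0 := hf.self_of_nhds
  rw [ContinuousAt, h0]
  refine hB.tendsto_zero_of_norm tendsto_id ?_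
  refine tendsto_const_nhds.congr' ?_
  filter_upwards [hf] with y hy
  simp [hy]

/-- Convex combinations do not increase the error of approximate continuity. -/
theorem nearlyContinuousAt_sum (hB : IsUSCBanachBundle B) {ι : Type*} (s : Finset ι)
    {f : ι → ∀ x, B x} {φ : ι → C(X, ℝ)} {x : X} {ε : ℝ} (hε : 0 ≤ ε) (hφ : ∀ i, 0 ≤ φ i x)
    (hf : ∀ i ∈ s, x ∈ tsupport (φ i) → NearlyContinuousAt (f i) x ε) {η : ℝ} (hη : 0 < η) :
    NearlyContinuousAt (fun y => ∑ i ∈ s, (φ i y : ℂ) • f i y) x ((∑ i ∈ s, φ i x) * ε + η) := by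
  classical
  induction s using Finset.induction_on generalizing η with
  | empty => simpa using hB.nearlyContinuousAt_zero hη (by simp)
  | insert i s hi ih =>
    simp only [Finset.sum_insert hi]
    have h1 : NearlyContinuousAt (fun y => (φ i y : ℂ) • f i y) x (φ i x * ε + η / 2) := by
      by_cases hx : x ∈ tsupport (φ i)
      · have := (hf i (by simp) hx).smul hB (φ := fun y => (φ i y : ℂ))
          (Complex.continuous_ofReal.comp (φ i).continuous).continuousAt (half_pos hη)
        simpa [abs_of_nonneg (hφ i)] using this
      · refine (hB.nearlyContinuousAt_zero (half_pos hη) ?_).mono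
          (le_add_of_nonneg_left (mul_nonneg (hφ i) hε))
        filter_upwards [(isClosed_tsupport (φ i)).isOpen_compl.mem_nhds hx] with y hy
        simp [image_eq_zero_of_notMem_tsupport hy]
    refine (h1.add hB (ih (fun j hj => hf j (by simp [hj])) (half_pos hη))).mono (le_of_eq ?_)
    ring

/-- A section with values in a set of the total space that is `ε`-thin is continuous up to `ε`. -/
theorem nearlyContinuousAt_of_thin (hB : IsUSCBanachBundle B) {f : ∀ x, B x} {W : Set (Tot B)}
    (hW : IsOpen W) {ε : ℝ}
    (hthin : ∀ y (v w : B y), (⟨y, v⟩ : Tot B) ∈ W → (⟨y, w⟩ : Tot B) ∈ W → ‖v - w‖ < ε)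
    {x : X} (hf : ∀ᶠ y in 𝓝 x, (⟨y, f y⟩ : Tot B) ∈ W) : NearlyContinuousAt f x ε := by
  intro W' hW'
  filter_upwards [hf, hB.eventually_exists_mem (inter_mem hW' (hW.mem_nhds hf.self_of_nhds))]
    with y hy ⟨w, hw', hw⟩
  exact ⟨w, hw', hthin y _ _ hy hw⟩

theorem exists_open_thin (hB : IsUSCBanachBundle B) {x : X} (b : B x) {ε : ℝ} (hε : 0 < ε) :
    ∃ W : Set (Tot B), IsOpen W ∧ (⟨x, b⟩ : Tot B) ∈ W ∧
      ∀ y (v w : B y), (⟨y, v⟩ : Tot B) ∈ W → (⟨y, w⟩ : Tot B) ∈ W → ‖v - w‖ < ε := by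
  obtain ⟨V, hV, V', hV', h⟩ := hB.exists_thin_nhds (b := b) (c := b) (ε := ε) (by simpa using hε)
  refine ⟨interior (V ∩ V'), isOpen_interior, mem_interior_iff_mem_nhds.2 (inter_mem hV hV'),
    fun y v w hv hw => h y v w (interior_subset hv).1 (interior_subset hw).2⟩

/-- The inductive step in the construction of continuous sections: patch sections with values in
thin sets by a partition of unity. -/
theorem exists_refine_nearly [LocallyCompactSpace X] [T2Space X] (hB : IsUSCBanachBundle B)
    {K : Set X} (hK : IsCompact K) {f : ∀ x, B x} {ε δ : ℝ} (hδ : 0 < δ)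
    (hf : ∀ x ∈ K, NearlyContinuousAt f x ε) :
    ∃ g : ∀ x, B x, (∀ x ∈ K, NearlyContinuousAt g x δ) ∧ ∀ x ∈ K, ‖f x - g x‖ ≤ ε := by
  classical
  have hloc : ∀ x : K, ∃ V : Set X, IsOpen V ∧ (x : X) ∈ V ∧ ∃ g : ∀ x, B x,
      (∀ y ∈ V, ‖f y - g y‖ < ε) ∧ ∀ y ∈ V, NearlyContinuousAt g y (δ / 2) := by
    intro x
    obtain ⟨W, hW, hxW, hthin⟩ := hB.exists_open_thin (f x) (half_pos hδ)
    obtain ⟨V, hVx, hV, hxV⟩ := eventually_nhds_iff.1 (hf x x.2 W (hW.mem_nhds hxW))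
    refine ⟨V, hV, hxV, fun y => if h : y ∈ V then (hVx y h).choose else 0, fun y hy => ?_,
      fun y hy => hB.nearlyContinuousAt_of_thin hW hthin ?_⟩
    · simpa [hy] using (hVx y hy).choose_spec.2
    · filter_upwards [hV.mem_nhds hy] with z hz
      simpa [hz] using (hVx z hz).choose_spec.1
  choose V hV hxV g hgf hg using hloc
  obtain ⟨t, ht⟩ := hK.elim_finite_subcover V hV fun x hx => Set.mem_iUnion.2 ⟨⟨x, hx⟩, hxV ⟨x, hx⟩⟩
  obtain ⟨φ, hφV, -, hφ0, hφ1, hφK⟩ := exists_partition_of_compact hK (fun i : t => V i)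
    (fun i => hV i) (by rwa [Set.iUnion_subtype])
  refine ⟨fun y => ∑ i, (φ i y : ℂ) • g i y, fun x hx => ?_, fun x hx => ?_⟩
  · refine (hB.nearlyContinuousAt_sum Finset.univ (ε := δ / 2) (by positivity)
      (fun i => hφ0 i x) (fun i _ hi => hg i x (hφV i hi)) (half_pos hδ)).mono ?_
    rw [hφK x hx]; linarith
  · have h1 : f x - ∑ i, (φ i x : ℂ) • g i x = ∑ i, (φ i x : ℂ) • (f x - g i x) := by
      simp only [smul_sub, Finset.sum_sub_distrib]
      rw [← Finset.sum_smul, ← Complex.ofReal_sum, hφK x hx]; simp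
    rw [h1]
    calc _ ≤ ∑ i, φ i x * ε := by
          refine norm_sum_le_of_le _ fun i _ => ?_
          rw [norm_smul, Complex.norm_real, Real.norm_of_nonneg (hφ0 i x)]
          by_cases hi : x ∈ tsupport (φ i)
          · exact mul_le_mul_of_nonneg_left (hgf i x (hφV i hi)).le (hφ0 i x)
          · simp [image_eq_zero_of_notMem_tsupport hi]
      _ = ε := by rw [← Finset.sum_mul, hφK x hx, one_mul]

theorem exists_continuousAt_of_nearly [LocallyCompactSpace X] [T2Space X]
    (hB : IsUSCBanachBundle B) {K : Set X} (hK : IsCompact K) {f : ∀ x, B x} {ε : ℝ} (hε : 0 < ε)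
    (hf : ∀ x ∈ K, NearlyContinuousAt f x ε) :
    ∃ g : ∀ x, B x, (∀ x ∈ interior K, ContinuousAt (fun y => (⟨y, g y⟩ : Tot B)) x) ∧
      ∀ x ∈ K, ‖f x - g x‖ ≤ 2 * ε := by
  classical
  let S (n : ℕ) := {f : ∀ x, B x // ∀ x ∈ K, NearlyContinuousAt f x (ε / 2 ^ n)}
  have hstep : ∀ n (f : S n), ∃ g : S (n + 1), ∀ x ∈ K, ‖f.1 x - g.1 x‖ ≤ ε / 2 ^ n := by
    intro n f
    obtain ⟨g, hg, hfg⟩ := hB.exists_refine_nearly hK (δ := ε / 2 ^ (n + 1)) (by positivity) f.2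
    exact ⟨⟨g, hg⟩, hfg⟩
  choose next hnext using hstep
  let F : ∀ n, S n := fun n => Nat.rec ⟨f, by simpa using hf⟩ next n
  have hF0 : (F 0).1 = f := rfl
  have hdist : ∀ x ∈ K, ∀ n, dist ((F n).1 x) ((F (n + 1)).1 x) ≤ 2 * ε / 2 / 2 ^ n := by
    intro x hx n
    rw [dist_eq_norm, mul_div_cancel_left₀ _ two_ne_zero]
    exact hnext n (F n) x hx
  have hlim : ∀ x ∈ K, ∃ b : B x, Tendsto (fun n => (F n).1 x) atTop (𝓝 b) := by
    intro x hx
    have := hB.complete x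
    exact cauchySeq_tendsto_of_complete (cauchySeq_of_le_geometric_two (hdist x hx))
  choose! g hg using hlim
  have hle : ∀ x ∈ K, ∀ n, ‖g x - (F n).1 x‖ ≤ 2 * ε / 2 ^ n := by
    intro x hx n
    rw [← dist_eq_norm, dist_comm]
    exact dist_le_of_le_geometric_two_of_tendsto (hdist x hx) (hg x hx) n
  refine ⟨g, fun x hx => hB.continuousAt_of_nearly fun η hη => ?_, fun x hx => ?_⟩
  · have ht : Tendsto (fun n : ℕ => ε / 2 ^ n) atTop (𝓝 0) := by
      have := (tendsto_pow_atTop_nhds_zero_of_lt_one (r := (1 / 2 : ℝ)) (by norm_num)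
        (by norm_num)).const_mul ε
      simpa [div_eq_mul_inv] using this
    obtain ⟨n, hn⟩ := (ht.eventually_lt_const (show (0 : ℝ) < η / 10 by positivity)).exists
    have := NearlyContinuousAt.of_norm_sub_le hB (f := g) (δ := 2 * ε / 2 ^ n)
      (show 0 < η / 10 by positivity) ((F n).2 x (interior_subset hx)) (by
        filter_upwards [isOpen_interior.mem_nhds hx] with y hy
        exact hle y (interior_subset hy) n)
    refine this.mono ?_
    rw [mul_div_assoc]; linarith
  · have := hle x hx 0
    rw [hF0] at this
    rw [norm_sub_rev]; simpa using this

end IsUSCBanachBundle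

section

variable {X : Type u} [TopologicalSpace X] {B : X → Type v} [∀ x, NormedAddCommGroup (B x)]
  [∀ x, NormedSpace ℂ (B x)] [TopologicalSpace (Tot B)]

namespace IsUSCBanachBundle

theorem continuous_smul_of_tsupport (hB : IsUSCBanachBundle B) {φ : C(X, ℝ)} {f : ∀ x, B x}
    (hf : ∀ x ∈ tsupport φ, ContinuousAt (fun y => (⟨y, f y⟩ : Tot B)) x) :
    Continuous (fun x => (⟨x, (φ x : ℂ) • f x⟩ : Tot B)) := by
  refine continuous_iff_continuousAt.2 fun x => ?_
  by_cases hx : x ∈ tsupport φ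
  · exact hB.tendsto_smul (Complex.continuous_ofReal.comp φ.continuous).continuousAt.tendsto
      (hf x hx)
  · refine hB.continuousAt_of_nearly fun ε hε => hB.nearlyContinuousAt_zero hε ?_
    filter_upwards [(isClosed_tsupport φ).isOpen_compl.mem_nhds hx] with y hy
    simp [image_eq_zero_of_notMem_tsupport hy]

/-- An upper semicontinuous Banach bundle over a locally compact Hausdorff space has enough
continuous sections: their values are dense in every fibre. -/
theorem exists_ccSection_near [LocallyCompactSpace X] [T2Space X] (hB : IsUSCBanachBundle B)
    {x : X} (b : B x) {ε : ℝ} (hε : 0 < ε) : ∃ f : CcSection B, ‖b - f.toFun x‖ < ε := by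
  classical
  obtain ⟨W, hW, hxW, hthin⟩ := hB.exists_open_thin b (ε := ε / 4) (by positivity)
  have hev : ∀ᶠ y in 𝓝 x, ∃ w : B y, (⟨y, w⟩ : Tot B) ∈ W :=
    hB.eventually_exists_mem (hW.mem_nhds hxW)
  obtain ⟨V, hVx, hV, hxV⟩ := eventually_nhds_iff.1 hev
  obtain ⟨K, hK, hxK, hKV⟩ := exists_compact_subset hV hxV
  let f₀ : ∀ x, B x := fun y => if h : y ∈ V then (hVx y h).choose else 0
  have hf₀ : ∀ y ∈ V, (⟨y, f₀ y⟩ : Tot B) ∈ W := fun y hy => by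
    simpa [f₀, hy] using (hVx y hy).choose_spec
  obtain ⟨g, hg, hfg⟩ := hB.exists_continuousAt_of_nearly hK (f := f₀) (ε := ε / 4)
    (by positivity) fun y hy => hB.nearlyContinuousAt_of_thin hW hthin (by
      filter_upwards [hV.mem_nhds (hKV hy)] with z hz using hf₀ z hz)
  obtain ⟨φ, hφV, hφc, -, -, hφ1⟩ := exists_partition_of_compact (isCompact_singleton (x := x))
    (fun _ : Unit => interior K) (fun _ => isOpen_interior) (by simpa using hxK)
  refine ⟨⟨fun y => (φ () y : ℂ) • g y,
    hB.continuous_smul_of_tsupport fun y hy => hg y (hφV () hy), tsupport (φ ()), hφc (),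
    fun y hy => by simp [image_eq_zero_of_notMem_tsupport hy]⟩, ?_⟩
  have h1 : φ () x = 1 := by simpa using hφ1 x rfl
  have h2 := hthin x b (f₀ x) hxW (hf₀ x hxV)
  have h3 := hfg x (interior_subset hxK)
  simp only [h1, Complex.ofReal_one, one_smul]
  calc ‖b - g x‖ ≤ ‖b - f₀ x‖ + ‖f₀ x - g x‖ := norm_sub_le_norm_sub_add_norm_sub _ _ _
    _ < ε := by linarith

end IsUSCBanachBundle

end

/-! ### Continuity of parametrised integrals -/

/-- Enlarge a compact set to an open set on which a bump function is `1`. -/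
theorem exists_open_bump {Y : Type*} [TopologicalSpace Y] [LocallyCompactSpace Y] [T2Space Y]
    {K U : Set Y} (hK : IsCompact K) (hU : IsOpen U) (hKU : K ⊆ U) :
    ∃ O : Set Y, IsOpen O ∧ K ⊆ O ∧ O ⊆ U ∧ ∃ χ : C(Y, ℝ), HasCompactSupport χ ∧
      tsupport χ ⊆ U ∧ (∀ y, 0 ≤ χ y) ∧ ∀ y ∈ O, χ y = 1 := by
  obtain ⟨K', hK', hKK', hK'U⟩ := exists_compact_between hK hU hKU
  obtain ⟨φ, hφV, hφc, hφ0, -, hφ1⟩ := exists_partition_of_compact hK'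
    (fun _ : Unit => U) (fun _ => hU) (fun y hy => Set.mem_iUnion.2 ⟨(), hK'U hy⟩)
  exact ⟨interior K', isOpen_interior, hKK', interior_subset.trans hK'U, φ (), hφc (), hφV (),
    hφ0 (), fun y hy => by simpa using hφ1 y (interior_subset hy)⟩

theorem integrable_of_continuousOn {Y : Type*} [TopologicalSpace Y] [T2Space Y]
    [MeasurableSpace Y] [BorelSpace Y] {E : Type*} [NormedAddCommGroup E]
    {μ : Measure Y} [IsFiniteMeasureOnCompacts μ] {S K : Set Y} (hS : IsClosed S)
    (hμS : μ Sᶜ = 0) (hK : IsCompact K) {f : Y → E} (hf : ContinuousOn f S)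
    (hfK : ∀ y ∈ S, y ∉ K → f y = 0) : Integrable f μ := by
  have hKS : IsCompact (K ∩ S) := hK.inter_right hS
  have h1 : IntegrableOn f (K ∩ S) μ := (hf.mono Set.inter_subset_right).integrableOn_compact hKS
  rw [← integrable_indicator_iff hKS.measurableSet] at h1
  refine h1.congr ?_
  have hae : ∀ᵐ y ∂μ, y ∈ S := hμS
  filter_upwards [hae] with y hy
  by_cases hyK : y ∈ K
  · simp [hy, hyK]
  · simp [hyK, hfK y hy hyK]

namespace IsUSCBanachBundle

variable {X : Type u} [TopologicalSpace X] {B : X → Type v} [∀ x, NormedAddCommGroup (B x)]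
  [∀ x, NormedSpace ℂ (B x)] [TopologicalSpace (Tot B)]

/-- Integrating a continuous family of vectors, given over the closed set `D` of a product and
with locally uniformly compact support, against a continuous family of measures gives a continuous
section. -/
theorem continuousAt_integral [LocallyCompactSpace X] [T2Space X] (hB : IsUSCBanachBundle B)
    {Y : Type*} [TopologicalSpace Y] [LocallyCompactSpace Y] [T2Space Y] [MeasurableSpace Y]
    [BorelSpace Y] {lam : X → Measure Y} {D : Set (X × Y)} (hD : IsClosed D)
    (hfin : ∀ x, IsFiniteMeasureOnCompacts (lam x)) (hnull : ∀ x, lam x {y | (x, y) ∉ D} = 0)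
    (hcont : ∀ φ : Y → ℝ, Continuous φ → HasCompactSupport φ →
      Continuous fun x => ∫ y, φ y ∂(lam x))
    {F : ∀ x, Y → B x} (hF : ContinuousOn (fun p : X × Y => (⟨p.1, F p.1 p.2⟩ : Tot B)) D)
    {x₀ : X} {K : Set Y} (hK : IsCompact K)
    (hFK : ∀ᶠ x in 𝓝 x₀, ∀ y, (x, y) ∈ D → y ∉ K → F x y = 0) :
    ContinuousAt (fun x => (⟨x, ∫ y, F x y ∂(lam x)⟩ : Tot B)) x₀ := by
  classical
  refine hB.continuousAt_of_approx fun ε hε => ?_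
  obtain ⟨O, hO, hKO, -, χ, hχc, -, hχ0, hχ1⟩ := exists_open_bump hK isOpen_univ (Set.subset_univ K)
  set M : ℝ := ∫ y, χ y ∂(lam x₀) + 1 with hM
  have hM0 : 0 < M := by
    have : 0 ≤ ∫ y, χ y ∂(lam x₀) := integral_nonneg hχ0
    linarith
  have hMx : ∀ᶠ x in 𝓝 x₀, ∫ y, χ y ∂(lam x) < M :=
    (hcont χ χ.continuous hχc).continuousAt.eventually_lt_const (lt_add_one _)
  have hε' : 0 < ε / M := by positivity
  -- near each point of the support, `F` is close to a continuous section of the bundle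
  have hloc : ∀ y₀ : Y, ∃ β : CcSection B, ∃ N ∈ 𝓝 x₀, ∃ V, IsOpen V ∧ y₀ ∈ V ∧
      ∀ x ∈ N, ∀ y ∈ V, (x, y) ∈ D → ‖F x y - β.toFun x‖ < ε / M := by
    intro y₀
    obtain ⟨β, hβ⟩ := hB.exists_ccSection_near (F x₀ y₀) hε'
    have hev : ∀ᶠ p in 𝓝 (x₀, y₀), p ∈ D → ‖F p.1 p.2 - β.toFun p.1‖ < ε / M := by
      by_cases hy : (x₀, y₀) ∈ D
      · rw [← eventually_nhdsWithin_iff]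
        have h1 : Tendsto (fun p : X × Y => (⟨p.1, F p.1 p.2⟩ : Tot B)) (𝓝[D] (x₀, y₀))
            (𝓝 ⟨x₀, F x₀ y₀⟩) := hF _ hy
        have h2 : Tendsto (fun p : X × Y => (⟨p.1, β.toFun p.1⟩ : Tot B)) (𝓝[D] (x₀, y₀))
            (𝓝 ⟨x₀, β.toFun x₀⟩) :=
          ((β.continuous_toFun.comp continuous_fst).tendsto (x₀, y₀)).mono_left nhdsWithin_le_nhds
        exact hB.eventually_norm_lt (hB.tendsto_sub h1 h2) hβ
      · filter_upwards [hD.isOpen_compl.mem_nhds hy] with p hp hp'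
        exact absurd hp' hp
    obtain ⟨N, hN, V, hV, hNV⟩ := mem_nhds_prod_iff.1 hev
    exact ⟨β, N, hN, interior V, isOpen_interior, mem_interior_iff_mem_nhds.2 hV,
      fun x hx y hy => hNV (Set.mk_mem_prod hx (interior_subset hy))⟩
  choose β N hN V hV hyV hβ using hloc
  obtain ⟨t, -, ht⟩ := hK.elim_nhds_subcover V fun y _ => (hV y).mem_nhds (hyV y)
  obtain ⟨φ, hφV, hφc, hφ0, hφ1, hφK⟩ := exists_partition_of_compact hK
    (fun i : t => V i ∩ O) (fun i => (hV i).inter hO) (fun y hy => by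
      obtain ⟨i, hi, hyi⟩ := Set.mem_iUnion₂.1 (ht hy)
      exact Set.mem_iUnion.2 ⟨⟨i, hi⟩, hyi, hKO hy⟩)
  have hφχ : ∀ y, ∑ i, φ i y ≤ χ y := by
    intro y
    by_cases hy : y ∈ O
    · rw [hχ1 y hy]; exact hφ1 y
    · rw [Finset.sum_eq_zero fun i _ => image_eq_zero_of_notMem_tsupport fun h => hy (hφV i h).2]
      exact hχ0 y
  refine ⟨fun x => ∑ i : t, ((∫ y, φ i y ∂(lam x) : ℝ) : ℂ) • (β i).toFun x, ?_, ?_⟩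
  · refine hB.tendsto_sum _ tendsto_id fun i _ => ?_
    exact hB.tendsto_smul ((Complex.continuous_ofReal.comp
      (hcont _ (φ i).continuous (hφc i))).tendsto x₀) ((β i).continuous_toFun.tendsto x₀)
  · have hNall : ∀ᶠ x in 𝓝 x₀, ∀ i : t, x ∈ N i := eventually_all.2 fun i => hN i
    filter_upwards [hMx, hFK, hNall] with x hxM hxK hxN
    have := hfin x
    have hDx : IsClosed {y | (x, y) ∈ D} := hD.preimage (Continuous.prodMk_right x)
    have hFx : ContinuousOn (F x) {y | (x, y) ∈ D} := fun y hy => by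
      refine hB.tendsto_fibre_iff.1 ?_
      exact (hF (x, y) hy).tendsto.comp (tendsto_nhdsWithin_iff.2
        ⟨((Continuous.prodMk_right x).tendsto y).mono_left nhdsWithin_le_nhds,
          self_mem_nhdsWithin⟩)
    have hFint : Integrable (F x) (lam x) :=
      integrable_of_continuousOn hDx (hnull x) hK hFx hxK
    have hφint : ∀ i : t, Integrable (fun y => (φ i y : ℂ) • (β i).toFun x) (lam x) := fun i =>
      (((φ i).continuous.integrable_of_hasCompactSupport (hφc i)).ofReal).smul_const _
    have h1 : ∫ y, F x y ∂(lam x) - ∑ i : t, ((∫ y, φ i y ∂(lam x) : ℝ) : ℂ) • (β i).toFun x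
        = ∫ y, (F x y - ∑ i : t, (φ i y : ℂ) • (β i).toFun x) ∂(lam x) := by
      rw [integral_sub hFint (integrable_finsetSum _ fun i _ => hφint i),
        integral_finsetSum _ fun i _ => hφint i]
      congr 1
      refine Finset.sum_congr rfl fun i _ => ?_
      have := hB.complete x
      rw [integral_smul_const, integral_complex_ofReal]
    rw [h1]
    have h2 : ∀ᵐ y ∂(lam x), ‖F x y - ∑ i : t, (φ i y : ℂ) • (β i).toFun x‖ ≤ ε / M * χ y := by
      have hae : ∀ᵐ y ∂(lam x), (x, y) ∈ D := hnull x
      filter_upwards [hae] with y hy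
      have h3 : F x y = ∑ i : t, (φ i y : ℂ) • F x y := by
        rw [← Finset.sum_smul, ← Complex.ofReal_sum]
        by_cases hyK : y ∈ K
        · rw [hφK y hyK]; simp
        · simp [hxK y hy hyK]
      have h4 : F x y - ∑ i : t, (φ i y : ℂ) • (β i).toFun x =
          ∑ i : t, (φ i y : ℂ) • (F x y - (β i).toFun x) := by
        simp only [smul_sub, Finset.sum_sub_distrib]
        rw [← h3]
      rw [h4]
      calc _ ≤ ∑ i : t, φ i y * (ε / M) := by
            refine norm_sum_le_of_le _ fun i _ => ?_
            rw [norm_smul, Complex.norm_real, Real.norm_of_nonneg (hφ0 i y)]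
            by_cases hi : y ∈ tsupport (φ i)
            · exact mul_le_mul_of_nonneg_left (hβ i x (hxN i) y (hφV i hi).1 hy).le (hφ0 i y)
            · simp [image_eq_zero_of_notMem_tsupport hi]
        _ ≤ ε / M * χ y := by
            rw [← Finset.sum_mul, mul_comm]
            exact mul_le_mul_of_nonneg_left (hφχ y) hε'.le
    calc _ ≤ ∫ y, ε / M * χ y ∂(lam x) := norm_integral_le_of_norm_le
          ((χ.continuous.integrable_of_hasCompactSupport hχc).const_mul _) h2
      _ = ε / M * ∫ y, χ y ∂(lam x) := integral_const_mul _ _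
      _ ≤ ε / M * M := by gcongr
      _ = ε := by field_simp

end IsUSCBanachBundle

/-! ### The trivial line bundle -/

section Trivial

variable {X : Type u} [TopologicalSpace X]

/-- The product topology on the total space of the trivial line bundle. -/
@[reducible] def trivialTopology (X : Type u) [TopologicalSpace X] :
    TopologicalSpace (Tot fun _ : X => ℂ) :=
  TopologicalSpace.induced (fun e => (e.base, e.vec)) inferInstance

attribute [local instance] trivialTopology

theorem isInducing_trivial :
    IsInducing (fun e : Tot fun _ : X => ℂ => (e.base, e.vec)) := ⟨rfl⟩

theorem isUSCBanachBundle_trivial : IsUSCBanachBundle (fun _ : X => ℂ) where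
  complete _ := inferInstance
  continuous_base := continuous_fst.comp isInducing_trivial.continuous
  isOpenMap_base := by
    let e : (Tot fun _ : X => ℂ) ≃ X × ℂ :=
      ⟨fun e => (e.base, e.vec), fun p => ⟨p.1, p.2⟩, fun _ => rfl, fun _ => rfl⟩
    exact isOpenMap_fst.comp (e.toHomeomorphOfIsInducing isInducing_trivial).isOpenMap
  usc_norm := (continuous_snd.comp isInducing_trivial.continuous).norm.upperSemicontinuous
  continuousOn_add := by
    have hv := (continuous_snd.comp (isInducing_trivial (X := X)).continuous)
    have hb := (continuous_fst.comp (isInducing_trivial (X := X)).continuous)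
    rw [isInducing_trivial.continuousOn_iff]
    have : ContinuousOn (fun p : (Tot fun _ : X => ℂ) × (Tot fun _ : X => ℂ) =>
        (p.1.base, p.1.vec + p.2.vec)) {p | p.1.base = p.2.base} :=
      ((hb.comp continuous_fst).prodMk ((hv.comp continuous_fst).add
        (hv.comp continuous_snd))).continuousOn
    refine this.congr fun p hp => ?_
    obtain ⟨⟨x, a⟩, ⟨y, b⟩⟩ := p
    obtain rfl : x = y := hp
    simp [toFibre_mk]
  continuous_smul c := by
    rw [isInducing_trivial.continuous_iff]
    exact (continuous_fst.comp isInducing_trivial.continuous).prodMk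
      ((continuous_snd.comp isInducing_trivial.continuous).const_smul c)
  tendsto_zero x := by
    rw [isInducing_trivial.nhds_eq_comap, nhds_prod_eq, prod_eq_inf, comap_inf, comap_comap,
      comap_comap]
    refine inf_le_inf le_rfl (le_of_eq ?_)
    change _ = comap (fun b : Tot fun _ : X => ℂ => b.vec) (𝓝 0)
    rw [← comap_norm_nhds_zero (E := ℂ), comap_comap]
    rfl

/-- The scalar case of `IsUSCBanachBundle.continuousAt_integral`. -/
theorem continuousAt_integral_scalar [LocallyCompactSpace X] [T2Space X]
    {Y : Type*} [TopologicalSpace Y] [LocallyCompactSpace Y] [T2Space Y] [MeasurableSpace Y]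
    [BorelSpace Y] {lam : X → Measure Y} {D : Set (X × Y)} (hD : IsClosed D)
    (hfin : ∀ x, IsFiniteMeasureOnCompacts (lam x)) (hnull : ∀ x, lam x {y | (x, y) ∉ D} = 0)
    (hcont : ∀ φ : Y → ℝ, Continuous φ → HasCompactSupport φ →
      Continuous fun x => ∫ y, φ y ∂(lam x))
    {F : X → Y → ℝ} (hF : ContinuousOn (fun p : X × Y => F p.1 p.2) D)
    {x₀ : X} {K : Set Y} (hK : IsCompact K)
    (hFK : ∀ᶠ x in 𝓝 x₀, ∀ y, (x, y) ∈ D → y ∉ K → F x y = 0) :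
    ContinuousAt (fun x => ∫ y, F x y ∂(lam x)) x₀ := by
  have h := isUSCBanachBundle_trivial.continuousAt_integral (F := fun x y => (F x y : ℂ)) hD hfin
    hnull hcont (x₀ := x₀) (by
      rw [isInducing_trivial.continuousOn_iff]
      exact continuous_fst.continuousOn.prodMk (Complex.continuous_ofReal.comp_continuousOn hF)) hK
    (by filter_upwards [hFK] with x hx y hy hyK; simp [hx y hy hyK])
  have h2 := (Complex.continuous_re.comp
    (continuous_snd.comp isInducing_trivial.continuous)).continuousAt.comp h
  refine h2.congr (.of_forall fun x => ?_)
  simp only [Function.comp_apply]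
  rw [integral_complex_ofReal, Complex.ofReal_re]

end Trivial

/-! ### Continuous compactly supported sections -/

section Sections

variable {X : Type u} [TopologicalSpace X] {B : X → Type v} [∀ x, NormedAddCommGroup (B x)]
  [∀ x, NormedSpace ℂ (B x)] [TopologicalSpace (Tot B)]

theorem CcSection.ext {f g : CcSection B} (h : ∀ x, f.toFun x = g.toFun x) : f = g := by
  cases f; cases g; simp only [CcSection.mk.injEq]; exact funext h

namespace IsUSCBanachBundle

/-- The space `Γ_c(X; B)` as a linear subspace of the product of the fibres. -/
def ccSections (hB : IsUSCBanachBundle B) : Submodule ℂ (∀ x, B x) where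
  carrier := {f | Continuous (fun x => (⟨x, f x⟩ : Tot B)) ∧
    ∃ K : Set X, IsCompact K ∧ ∀ x, x ∉ K → f x = 0}
  add_mem' := by
    rintro f g ⟨hf, K, hK, hfK⟩ ⟨hg, K', hK', hgK⟩
    refine ⟨continuous_iff_continuousAt.2 fun x => hB.tendsto_add (hf.tendsto x) (hg.tendsto x),
      K ∪ K', hK.union hK', fun x hx => ?_⟩
    rw [Set.mem_union, not_or] at hx
    simp [hfK x hx.1, hgK x hx.2]
  zero_mem' := ⟨continuous_iff_continuousAt.2 fun x =>
      hB.tendsto_zero_of_norm (f := fun _ => 0) tendsto_id (by simp),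
    ∅, isCompact_empty, fun _ _ => rfl⟩
  smul_mem' := by
    rintro c f ⟨hf, K, hK, hfK⟩
    exact ⟨continuous_iff_continuousAt.2 fun x => hB.tendsto_const_smul c (hf.tendsto x),
      K, hK, fun x hx => by simp [hfK x hx]⟩

/-- An element of `ccSections` as a section. -/
def toCc (hB : IsUSCBanachBundle B) (f : hB.ccSections) : CcSection B :=
  ⟨f.1, f.2.1, f.2.2⟩

theorem mem_ccSections (hB : IsUSCBanachBundle B) (f : CcSection B) : f.toFun ∈ hB.ccSections :=
  ⟨f.continuous_toFun, f.compact_support⟩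

/-- The product of a section and a continuous function. -/
def mulSection (hB : IsUSCBanachBundle B) (φ : X → ℂ) (hφ : Continuous φ) (f : CcSection B) :
    CcSection B :=
  ⟨fun x => φ x • f.toFun x, continuous_iff_continuousAt.2 fun x =>
      hB.tendsto_smul (hφ.tendsto x) (f.continuous_toFun.tendsto x), by
    obtain ⟨K, hK, hfK⟩ := f.compact_support
    exact ⟨K, hK, fun x hx => by simp [hfK x hx]⟩⟩

end IsUSCBanachBundle

end Sections

/-! ### Groupoid bundles with convolution -/

namespace FellOps

variable {G : Type u} {Γ : GroupoidOps G} {B : G → Type v}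
  [∀ x, NormedAddCommGroup (B x)] [∀ x, NormedSpace ℂ (B x)]
  [TopologicalSpace G] [MeasurableSpace G] [TopologicalSpace (Tot B)]

/-- The properties of a saturated Fell bundle over a groupoid with Haar system on which the
construction and the fullness of the multipliers given by subsets of the unit space depend. The
product of the bundle need not be associative or additive for this, nor need the measures be
invariant. -/
structure IsConvolutionBundle (ℬ : FellOps Γ B) (lam : G → Measure G) : Prop where
  bundle : IsUSCBanachBundle B
  r_r : ∀ x, Γ.r (Γ.r x) = Γ.r x
  r_mul : ∀ x y, Γ.s x = Γ.r y → Γ.r (Γ.mul x y) = Γ.r x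
  r_inv : ∀ x, Γ.r (Γ.inv x) = Γ.s x
  s_inv : ∀ x, Γ.s (Γ.inv x) = Γ.r x
  inv_inv : ∀ x, Γ.inv (Γ.inv x) = x
  inv_mul_cancel_left : ∀ x y, Γ.s x = Γ.r y → Γ.mul (Γ.inv x) (Γ.mul x y) = y
  continuous_r : Continuous Γ.r
  continuous_inv : Continuous Γ.inv
  continuousOn_mul : ContinuousOn (fun p : G × G => Γ.mul p.1 p.2) {p | Γ.s p.1 = Γ.r p.2}
  continuousOn_mulT : ContinuousOn (fun p : Tot B × Tot B => ℬ.mulT p.1 p.2)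
    {p | Γ.s p.1.base = Γ.r p.2.base}
  continuous_starT : Continuous ℬ.starT
  smul_mul : ∀ x y, Γ.s x = Γ.r y → ∀ (c : ℂ) (a : B x) (b : B y),
    ℬ.mul (c • a) b = c • ℬ.mul a b
  mul_smul : ∀ x y, Γ.s x = Γ.r y → ∀ (c : ℂ) (a : B x) (b : B y),
    ℬ.mul a (c • b) = c • ℬ.mul a b
  star_smul : ∀ x (c : ℂ) (a : B x), ℬ.star (c • a) = (starRingEnd ℂ c) • ℬ.star a
  dense_mul : ∀ x y, Γ.s x = Γ.r y → Dense (Submodule.span ℂ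
    {c : B (Γ.mul x y) | ∃ (a : B x) (b : B y), c = ℬ.mul a b} : Set (B (Γ.mul x y)))
  finite : ∀ u ∈ Γ.units, IsFiniteMeasureOnCompacts (lam u)
  null_compl : ∀ u ∈ Γ.units, lam u {x | Γ.r x ≠ u} = 0
  pos_of_mem : ∀ u ∈ Γ.units, ∀ U : Set G, IsOpen U → (∃ x ∈ U, Γ.r x = u) → 0 < lam u U
  continuousOn_haar : ∀ f : G → ℝ, Continuous f → HasCompactSupport f →
    ContinuousOn (fun u => ∫ x, f x ∂(lam u)) Γ.units

namespace IsConvolutionBundle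

variable {ℬ : FellOps Γ B} {lam : G → Measure G}

section Basic

variable (h : ℬ.IsConvolutionBundle lam)

include h

theorem continuous_s : Continuous Γ.s :=
  (h.continuous_r.comp h.continuous_inv).congr h.r_inv

theorem zero_mul {x y : G} (hxy : Γ.s x = Γ.r y) (b : B y) : ℬ.mul (0 : B x) b = 0 := by
  simpa using h.smul_mul x y hxy 0 0 b

theorem mul_zero {x y : G} (hxy : Γ.s x = Γ.r y) (a : B x) : ℬ.mul a (0 : B y) = 0 := by
  simpa using h.mul_smul x y hxy 0 a 0

theorem star_zero (x : G) : ℬ.star (0 : B x) = 0 := by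
  simpa using h.star_smul x 0 0

theorem mul_inv_cancel_left (x y : G) (hxy : Γ.r x = Γ.r y) :
    Γ.mul x (Γ.mul (Γ.inv x) y) = y := by
  have := h.inv_mul_cancel_left (Γ.inv x) y ((h.s_inv x).trans hxy)
  rwa [h.inv_inv] at this

theorem r_mem_units (x : G) : Γ.r x ∈ Γ.units := h.r_r x

theorem inv_mul_composable {x y : G} (hxy : Γ.r x = Γ.r y) :
    Γ.s x = Γ.r (Γ.mul (Γ.inv x) y) := by
  rw [h.r_mul _ _ (by rw [h.s_inv, hxy]), h.r_inv]

theorem ae_r_eq {u : G} (hu : u ∈ Γ.units) : ∀ᵐ y ∂(lam u), Γ.r y = u := h.null_compl u hu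

theorem isCompact_mul [T2Space G] {K K' : Set G} (hK : IsCompact K) (hK' : IsCompact K') :
    IsCompact ((fun p : G × G => Γ.mul p.1 p.2) '' ((K ×ˢ K') ∩ {p | Γ.s p.1 = Γ.r p.2})) := by
  refine ((hK.prod hK').inter_right ?_).image_of_continuousOn
    (h.continuousOn_mul.mono Set.inter_subset_right)
  exact isClosed_eq (h.continuous_s.comp continuous_fst) (h.continuous_r.comp continuous_snd)

end Basic

variable [T2Space G] [LocallyCompactSpace G] [BorelSpace G]

section Integral

variable (h : ℬ.IsConvolutionBundle lam)

include h

theorem continuous_haar {φ : G → ℝ} (hφ : Continuous φ) (hφc : HasCompactSupport φ) :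
    Continuous fun x => ∫ y, φ y ∂(lam (Γ.r x)) := by
  have := h.continuousOn_haar φ hφ hφc
  exact this.comp_continuous h.continuous_r h.r_mem_units

/-- A family `P` of vectors over the composable pairs, in the variables `y` and `y⁻¹ x`. -/
theorem continuousOn_toFibre {P : ∀ p : G × G, B (Γ.mul p.1 p.2)}
    (hP : ContinuousOn (fun p : G × G => (⟨Γ.mul p.1 p.2, P p⟩ : Tot B))
      {p | Γ.s p.1 = Γ.r p.2}) :
    ContinuousOn (fun p : G × G =>
      (⟨p.1, toFibre p.1 ⟨_, P (p.2, Γ.mul (Γ.inv p.2) p.1)⟩⟩ : Tot B))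
      {p | Γ.r p.1 = Γ.r p.2} := by
  have h1 : ContinuousOn (fun p : G × G => (p.2, Γ.mul (Γ.inv p.2) p.1))
      {p | Γ.r p.1 = Γ.r p.2} := by
    refine continuousOn_snd.prodMk ?_
    refine h.continuousOn_mul.comp (f := fun p : G × G => (Γ.inv p.2, p.1))
      (((h.continuous_inv.comp continuous_snd).prodMk continuous_fst).continuousOn) ?_
    intro p hp
    simpa [h.s_inv] using hp.symm
  refine (hP.comp h1 fun p hp => h.inv_mul_composable hp.symm).congr fun p hp => ?_
  exact mk_toFibre (h.mul_inv_cancel_left _ _ hp.symm)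

theorem continuousOn_mul_sections (f g : CcSection B) :
    ContinuousOn (fun p : G × G => (⟨Γ.mul p.1 p.2, ℬ.mul (f.toFun p.1) (g.toFun p.2)⟩ : Tot B))
      {p | Γ.s p.1 = Γ.r p.2} :=
  h.continuousOn_mulT.comp (f := fun p : G × G =>
      ((⟨p.1, f.toFun p.1⟩ : Tot B), (⟨p.2, g.toFun p.2⟩ : Tot B)))
    ((f.continuous_toFun.comp continuous_fst).prodMk
      (g.continuous_toFun.comp continuous_snd)).continuousOn fun _ hp => hp

theorem toFibre_eq_zero {x z : G} {b : B z} (hb : b = 0) : toFibre x (⟨z, b⟩ : Tot B) = 0 := by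
  unfold toFibre
  split_ifs with hz
  · dsimp at hz; subst hz; exact hb
  · rfl

theorem continuous_integral {F : ∀ x, G → B x}
    (hF : ContinuousOn (fun p : G × G => (⟨p.1, F p.1 p.2⟩ : Tot B)) {p | Γ.r p.1 = Γ.r p.2})
    {K : Set G} (hK : IsCompact K) (hFK : ∀ x y, Γ.r x = Γ.r y → y ∉ K → F x y = 0) :
    Continuous (fun x => (⟨x, ∫ y, F x y ∂(lam (Γ.r x))⟩ : Tot B)) := by
  refine continuous_iff_continuousAt.2 fun x₀ => ?_
  refine h.bundle.continuousAt_integral (lam := fun x => lam (Γ.r x))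
    (D := {p | Γ.r p.1 = Γ.r p.2}) ?_ (fun x => h.finite _ (h.r_mem_units x)) (fun x => ?_)
    (fun φ hφ hφc => h.continuous_haar hφ hφc) hF hK (.of_forall fun x y hy => hFK x y hy)
  · exact isClosed_eq (h.continuous_r.comp continuous_fst) (h.continuous_r.comp continuous_snd)
  · have := h.null_compl _ (h.r_mem_units x)
    simpa [eq_comm] using this

theorem integrable_section {F : ∀ x, G → B x}
    (hF : ContinuousOn (fun p : G × G => (⟨p.1, F p.1 p.2⟩ : Tot B)) {p | Γ.r p.1 = Γ.r p.2})
    {K : Set G} (hK : IsCompact K) (hFK : ∀ x y, Γ.r x = Γ.r y → y ∉ K → F x y = 0) (x : G) :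
    Integrable (F x) (lam (Γ.r x)) := by
  have := h.finite _ (h.r_mem_units x)
  refine integrable_of_continuousOn (S := {y | Γ.r x = Γ.r y})
    (isClosed_eq continuous_const h.continuous_r) ?_ hK ?_ (hFK x)
  · have := h.null_compl _ (h.r_mem_units x)
    simpa [eq_comm, Set.compl_ofPred] using this
  · intro y hy
    refine h.bundle.tendsto_fibre_iff.1 ?_
    exact (hF (x, y) hy).tendsto.comp (tendsto_nhdsWithin_iff.2
      ⟨((Continuous.prodMk_right x).tendsto y).mono_left nhdsWithin_le_nhds, self_mem_nhdsWithin⟩)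

/-- `Γ_c(G; B)` is closed under convolution. -/
theorem exists_conv (f g : CcSection B) :
    ∃ k : CcSection B, ∀ x, k.toFun x = ℬ.conv lam f.toFun g.toFun x := by
  obtain ⟨K, hK, hfK⟩ := f.compact_support
  obtain ⟨K', hK', hgK⟩ := g.compact_support
  have hF := h.continuousOn_toFibre (h.continuousOn_mul_sections f g)
  refine ⟨⟨ℬ.conv lam f.toFun g.toFun, h.continuous_integral hF hK fun x y hxy hy => ?_, _,
    h.isCompact_mul hK hK', fun x hx => ?_⟩, fun x => rfl⟩
  · exact h.toFibre_eq_zero (by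
      simp [hfK y hy, h.zero_mul (h.inv_mul_composable hxy.symm)])
  · refine integral_eq_zero_of_ae ?_
    filter_upwards [h.ae_r_eq (h.r_mem_units x)] with y hy
    refine h.toFibre_eq_zero ?_
    have hc := h.inv_mul_composable hy
    by_cases hyK : y ∈ K
    · have hw : Γ.mul (Γ.inv y) x ∉ K' := fun hw =>
        hx ⟨(y, Γ.mul (Γ.inv y) x), ⟨⟨hyK, hw⟩, hc⟩, h.mul_inv_cancel_left y x hy⟩
      rw [hgK _ hw, h.mul_zero hc]
    · rw [hfK _ hyK, h.zero_mul hc]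

omit [T2Space G] [LocallyCompactSpace G] [BorelSpace G] in
/-- `Γ_c(G; B)` is closed under the involution. -/
theorem exists_star (f : CcSection B) :
    ∃ k : CcSection B, ∀ x, k.toFun x = ℬ.starSec f.toFun x := by
  obtain ⟨K, hK, hfK⟩ := f.compact_support
  refine ⟨⟨ℬ.starSec f.toFun, ?_, Γ.inv '' K, hK.image h.continuous_inv, fun x hx => ?_⟩,
    fun x => rfl⟩
  · refine (h.continuous_starT.comp (f.continuous_toFun.comp h.continuous_inv)).congr fun x => ?_
    exact (mk_toFibre (h.inv_inv x)).symm
  · refine toFibre_eq_iff (e := (⟨_, ℬ.star (f.toFun (Γ.inv x))⟩ : Tot B)) (h.inv_inv x) |>.2 ?_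
    have : Γ.inv x ∉ K := fun hx' => hx ⟨_, hx', h.inv_inv x⟩
    rw [hfK _ this, h.star_zero, h.inv_inv]

end Integral

end IsConvolutionBundle

/-! ### The canonical map into the C⋆-algebra -/

section Iota

variable {ℬ : FellOps Γ B} {lam : G → Measure G}

theorem CStar.ext {a b : ℬ.CStar lam} (hab : ∀ ρ : Rep ℬ lam, a.1.1 ρ = b.1.1 ρ) : a = b :=
  Subtype.ext (Subtype.ext (funext hab))

theorem ι_add {f g k : CcSection B} (hk : ∀ x, k.toFun x = f.toFun x + g.toFun x) :
    ℬ.ι lam k = ℬ.ι lam f + ℬ.ι lam g :=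
  CStar.ext fun ρ => ρ.map_add f g k hk

theorem ι_smul {f k : CcSection B} (c : ℂ) (hk : ∀ x, k.toFun x = c • f.toFun x) :
    ℬ.ι lam k = c • ℬ.ι lam f :=
  CStar.ext fun ρ => ρ.map_smul c f k hk

theorem ι_mul {f g k : CcSection B} (hk : ∀ x, k.toFun x = ℬ.conv lam f.toFun g.toFun x) :
    ℬ.ι lam k = ℬ.ι lam f * ℬ.ι lam g :=
  CStar.ext fun ρ => ρ.map_conv f g k hk

theorem ι_star {f k : CcSection B} (hk : ∀ x, k.toFun x = ℬ.starSec f.toFun x) :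
    ℬ.ι lam k = Star.star (ℬ.ι lam f) :=
  CStar.ext fun ρ => ρ.map_star f k hk

theorem norm_ι_le (f : CcSection B) : ‖ℬ.ι lam f‖ ≤ ℬ.iNorm lam f.toFun :=
  lp.norm_le_of_forall_le ENNReal.toReal_nonneg fun ρ => ρ.norm_le f

end Iota

namespace IsConvolutionBundle

variable {ℬ : FellOps Γ B} {lam : G → Measure G}
variable [T2Space G] [LocallyCompactSpace G] [BorelSpace G]

/-- The canonical map `Γ_c(G; B) → C*(G; B)` as a linear map. -/
def ιLin (h : ℬ.IsConvolutionBundle lam) : h.bundle.ccSections →ₗ[ℂ] ℬ.CStar lam where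
  toFun f := ℬ.ι lam (h.bundle.toCc f)
  map_add' _ _ := ι_add fun _ => rfl
  map_smul' c _ := ι_smul c fun _ => rfl

/-- The image of `Γ_c(G; B)` is dense in `C*(G; B)`. -/
theorem denseRange_ι (h : ℬ.IsConvolutionBundle lam) : DenseRange (ℬ.ι lam) := by
  have hrange : (NonUnitalStarAlgebra.adjoin ℂ (Set.range (ℬ.ι₀ lam)) : Set (Ambient ℬ lam)) ⊆
      Set.range (ℬ.ι₀ lam) := by
    intro a ha
    induction ha using NonUnitalStarAlgebra.adjoin_induction with
    | mem a ha => exact ha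
    | add a b _ _ ha hb =>
      obtain ⟨f, rfl⟩ := ha
      obtain ⟨g, rfl⟩ := hb
      exact ⟨h.bundle.toCc (⟨_, h.bundle.mem_ccSections f⟩ + ⟨_, h.bundle.mem_ccSections g⟩),
        congrArg Subtype.val (ι_add (ℬ := ℬ) (lam := lam) (f := f) (g := g) fun _ => rfl)⟩
    | zero => exact ⟨h.bundle.toCc 0, congrArg Subtype.val h.ιLin.map_zero⟩
    | mul a b _ _ ha hb =>
      obtain ⟨f, rfl⟩ := ha
      obtain ⟨g, rfl⟩ := hb
      obtain ⟨k, hk⟩ := h.exists_conv f g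
      exact ⟨k, congrArg Subtype.val (ι_mul (ℬ := ℬ) (lam := lam) hk)⟩
    | smul c a _ ha =>
      obtain ⟨f, rfl⟩ := ha
      exact ⟨h.bundle.toCc (c • ⟨_, h.bundle.mem_ccSections f⟩),
        congrArg Subtype.val (ι_smul (ℬ := ℬ) (lam := lam) (f := f) c fun _ => rfl)⟩
    | star a _ ha =>
      obtain ⟨f, rfl⟩ := ha
      obtain ⟨k, hk⟩ := h.exists_star f
      exact ⟨k, congrArg Subtype.val (ι_star (ℬ := ℬ) (lam := lam) hk)⟩
  intro a
  refine (closure_subtype (X := Ambient ℬ lam)).2 (closure_mono ?_ a.2)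
  refine hrange.trans ?_
  rintro _ ⟨f, rfl⟩
  exact ⟨_, ⟨f, rfl⟩, rfl⟩

theorem denseRange_ιLin (h : ℬ.IsConvolutionBundle lam) : DenseRange h.ιLin :=
  h.denseRange_ι.mono (by
    rintro _ ⟨f, rfl⟩
    exact ⟨⟨_, h.bundle.mem_ccSections f⟩, rfl⟩)

end IsConvolutionBundle

end FellOps

/-! ### Multipliers -/

namespace DoubleCentralizer

variable {A : Type*} [NonUnitalCStarAlgebra A]

theorem eq_of_fst_eq {p q : 𝓜(ℂ, A)} (hpq : p.fst = q.fst) : p = q := by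
  rw [← sub_eq_zero, ← norm_eq_zero, ← norm_fst, sub_fst, hpq, sub_self, norm_zero]

theorem eq_of_snd_eq {p q : 𝓜(ℂ, A)} (hpq : p.snd = q.snd) : p = q := by
  rw [← sub_eq_zero, ← norm_eq_zero, ← norm_snd, sub_snd, hpq, sub_self, norm_zero]

theorem mul_coe (p : 𝓜(ℂ, A)) (a : A) : p * (a : 𝓜(ℂ, A)) = (p.fst a : 𝓜(ℂ, A)) := by
  refine eq_of_snd_eq (ContinuousLinearMap.ext fun x => ?_)
  simp [p.central]

theorem coe_mul' (p : 𝓜(ℂ, A)) (a : A) : (a : 𝓜(ℂ, A)) * p = (p.snd a : 𝓜(ℂ, A)) := by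
  refine eq_of_fst_eq (ContinuousLinearMap.ext fun x => ?_)
  simp [p.central]

theorem coe_inj {a b : A} (hab : (a : 𝓜(ℂ, A)) = (b : 𝓜(ℂ, A))) : a = b := by
  have h1 := congrArg (fun p : 𝓜(ℂ, A) => p.fst (star (a - b))) hab
  simp only [coe_fst, ContinuousLinearMap.mul_apply'] at h1
  rw [← sub_eq_zero, ← sub_mul, CStarRing.mul_star_self_eq_zero_iff, sub_eq_zero] at h1
  exact h1

theorem coe_mul_coe (a b : A) : (a : 𝓜(ℂ, A)) * (b : 𝓜(ℂ, A)) = ((a * b : A) : 𝓜(ℂ, A)) := by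
  rw [mul_coe]; simp

end DoubleCentralizer

namespace FellOps.IsConvolutionBundle

variable {G : Type u} {Γ : GroupoidOps G} {B : G → Type v}
  [∀ x, NormedAddCommGroup (B x)] [∀ x, NormedSpace ℂ (B x)]
  [TopologicalSpace G] [MeasurableSpace G] [TopologicalSpace (Tot B)]
  {ℬ : FellOps Γ B} {lam : G → Measure G}

/-! ### Sections multiplied by functions on the unit space -/

section UnitFunctions

variable (h : ℬ.IsConvolutionBundle lam) {τ : G → ℝ} (hτ : Continuous fun x => τ (Γ.r x))

include h hτ in
theorem continuous_comp_s : Continuous fun x => τ (Γ.s x) :=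
  (hτ.comp h.continuous_inv).congr fun x => by simp [h.r_inv]

/-- The section `x ↦ τ (r x) • f x`, for a function `τ` on the unit space. -/
def lsmul (f : CcSection B) : CcSection B :=
  h.bundle.mulSection (fun x => (τ (Γ.r x) : ℂ)) (Complex.continuous_ofReal.comp hτ) f

/-- The section `x ↦ τ (s x) • f x`, for a function `τ` on the unit space. -/
def rsmul (f : CcSection B) : CcSection B :=
  h.bundle.mulSection (fun x => (τ (Γ.s x) : ℂ))
    (Complex.continuous_ofReal.comp (h.continuous_comp_s hτ)) f

theorem conv_rsmul (f g : CcSection B) (x : G) :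
    ℬ.conv lam (h.rsmul hτ f).toFun g.toFun x = ℬ.conv lam f.toFun (h.lsmul hτ g).toFun x := by
  refine integral_congr_ae ?_
  filter_upwards [h.ae_r_eq (h.r_mem_units x)] with y hy
  have hc := h.inv_mul_composable hy
  change toFibre x ⟨_, ℬ.mul ((τ (Γ.s y) : ℂ) • f.toFun y) _⟩ =
    toFibre x ⟨_, ℬ.mul _ ((τ (Γ.r (Γ.mul (Γ.inv y) x)) : ℂ) • g.toFun (Γ.mul (Γ.inv y) x))⟩
  rw [h.smul_mul _ _ hc, h.mul_smul _ _ hc, hc]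

theorem starSec_lsmul (f : CcSection B) (x : G) :
    ℬ.starSec (h.lsmul hτ f).toFun x = (τ (Γ.s x) : ℂ) • ℬ.starSec f.toFun x := by
  change toFibre x ⟨_, ℬ.star ((τ (Γ.r (Γ.inv x)) : ℂ) • f.toFun (Γ.inv x))⟩ =
    (τ (Γ.s x) : ℂ) • toFibre x ⟨_, ℬ.star (f.toFun (Γ.inv x))⟩
  rw [h.star_smul, Complex.conj_ofReal, h.r_inv]
  generalize ℬ.star (f.toFun (Γ.inv x)) = b
  revert b
  rw [h.inv_inv x]
  intro b
  rw [toFibre_mk, toFibre_mk]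

theorem starSec_rsmul (f : CcSection B) (x : G) :
    ℬ.starSec (h.rsmul hτ f).toFun x = (τ (Γ.r x) : ℂ) • ℬ.starSec f.toFun x := by
  change toFibre x ⟨_, ℬ.star ((τ (Γ.s (Γ.inv x)) : ℂ) • f.toFun (Γ.inv x))⟩ =
    (τ (Γ.r x) : ℂ) • toFibre x ⟨_, ℬ.star (f.toFun (Γ.inv x))⟩
  rw [h.star_smul, Complex.conj_ofReal, h.s_inv]
  generalize ℬ.star (f.toFun (Γ.inv x)) = b
  revert b
  rw [h.inv_inv x]
  intro b
  rw [toFibre_mk, toFibre_mk]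

variable [T2Space G] [LocallyCompactSpace G] [BorelSpace G]

theorem ι_rsmul_mul (f g : CcSection B) :
    ℬ.ι lam (h.rsmul hτ f) * ℬ.ι lam g = ℬ.ι lam f * ℬ.ι lam (h.lsmul hτ g) := by
  obtain ⟨k, hk⟩ := h.exists_conv (h.rsmul hτ f) g
  rw [← ι_mul hk, ← ι_mul fun x => (hk x).trans (h.conv_rsmul hτ f g x)]

omit [T2Space G] [LocallyCompactSpace G] [BorelSpace G] in
theorem star_ι_lsmul {f k : CcSection B} (hk : ∀ x, k.toFun x = ℬ.starSec f.toFun x) :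
    Star.star (ℬ.ι lam (h.lsmul hτ f)) = ℬ.ι lam (h.rsmul hτ k) :=
  (ι_star fun x => ((congrArg _ (hk x)).trans (h.starSec_lsmul hτ f x).symm)).symm

omit [T2Space G] [LocallyCompactSpace G] [BorelSpace G] in
theorem star_ι_rsmul {f k : CcSection B} (hk : ∀ x, k.toFun x = ℬ.starSec f.toFun x) :
    Star.star (ℬ.ι lam (h.rsmul hτ f)) = ℬ.ι lam (h.lsmul hτ k) :=
  (ι_star fun x => ((congrArg _ (hk x)).trans (h.starSec_rsmul hτ f x).symm)).symm

omit [T2Space G] [LocallyCompactSpace G] [BorelSpace G] in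
theorem lsmul_lsmul_self (hτ1 : ∀ u, τ u * τ u = 1) (f : CcSection B) :
    h.lsmul hτ (h.lsmul hτ f) = f := by
  refine CcSection.ext fun x => ?_
  change (τ (Γ.r x) : ℂ) • (τ (Γ.r x) : ℂ) • f.toFun x = f.toFun x
  rw [smul_smul, ← Complex.ofReal_mul, hτ1, Complex.ofReal_one, one_smul]

/-- Multiplication by a function with values `±1` on the unit space is isometric, because it does
not change `f* * f`. -/
theorem norm_ι_lsmul (hτ1 : ∀ u, τ u * τ u = 1) (f : CcSection B) :
    ‖ℬ.ι lam (h.lsmul hτ f)‖ = ‖ℬ.ι lam f‖ := by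
  obtain ⟨k, hk⟩ := h.exists_star f
  have h1 : Star.star (ℬ.ι lam (h.lsmul hτ f)) * ℬ.ι lam (h.lsmul hτ f) =
      Star.star (ℬ.ι lam f) * ℬ.ι lam f := by
    rw [h.star_ι_lsmul hτ hk, h.ι_rsmul_mul, h.lsmul_lsmul_self hτ hτ1, ι_star hk]
  have h2 := congrArg norm h1
  rw [CStarRing.norm_star_mul_self, CStarRing.norm_star_mul_self] at h2
  exact (mul_self_inj (norm_nonneg _) (norm_nonneg _)).1 h2

theorem norm_ι_rsmul (hτ1 : ∀ u, τ u * τ u = 1) (f : CcSection B) :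
    ‖ℬ.ι lam (h.rsmul hτ f)‖ = ‖ℬ.ι lam f‖ := by
  obtain ⟨k, hk⟩ := h.exists_star f
  have h1 : ℬ.ι lam (h.rsmul hτ f) * Star.star (ℬ.ι lam (h.rsmul hτ f)) =
      ℬ.ι lam f * Star.star (ℬ.ι lam f) := by
    rw [h.star_ι_rsmul hτ hk, h.ι_rsmul_mul, h.lsmul_lsmul_self hτ hτ1, ι_star hk]
  have h2 := congrArg norm h1
  rw [CStarRing.norm_self_mul_star, CStarRing.norm_self_mul_star] at h2
  exact (mul_self_inj (norm_nonneg _) (norm_nonneg _)).1 h2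

end UnitFunctions

/-! ### The multiplier of a clopen part of the unit space -/

section Cutdown

variable {S : Set G}

open Classical in
/-- The characteristic function of `S`. -/
def charFun (S : Set G) (u : G) : ℝ := if u ∈ S then 1 else 0

theorem continuous_charFun (hS : IsClopen {x | Γ.r x ∈ S}) :
    Continuous fun x => charFun S (Γ.r x) := by
  classical
  refine Continuous.if (fun x hx => ?_) continuous_const continuous_const
  have : frontier {x | Γ.r x ∈ S} = ∅ := hS.frontier_eq
  rw [this] at hx
  exact hx.elim

variable (h : ℬ.IsConvolutionBundle lam) (hS : IsClopen {x | Γ.r x ∈ S})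

/-- Multiplication by `χ_S ∘ r`. -/
def lcut (f : CcSection B) : CcSection B := h.lsmul (continuous_charFun hS) f

/-- Multiplication by `χ_S ∘ s`. -/
def rcut (f : CcSection B) : CcSection B := h.rsmul (continuous_charFun hS) f

open Classical in
theorem lcut_apply (f : CcSection B) (x : G) :
    (h.lcut hS f).toFun x = if Γ.r x ∈ S then f.toFun x else 0 := by
  change ((charFun S (Γ.r x) : ℝ) : ℂ) • f.toFun x = _
  unfold charFun
  split_ifs <;> simp

open Classical in
theorem rcut_apply (f : CcSection B) (x : G) :
    (h.rcut hS f).toFun x = if Γ.s x ∈ S then f.toFun x else 0 := by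
  change ((charFun S (Γ.s x) : ℝ) : ℂ) • f.toFun x = _
  unfold charFun
  split_ifs <;> simp

variable [T2Space G] [LocallyCompactSpace G] [BorelSpace G]

/-- The function `2 χ_S - 1`. -/
def signFun (S : Set G) (u : G) : ℝ := 2 * charFun S u - 1

theorem signFun_mul_self (u : G) : signFun S u * signFun S u = 1 := by
  unfold signFun charFun; split_ifs <;> norm_num

omit [T2Space G] [LocallyCompactSpace G] [BorelSpace G] in
theorem continuous_signFun (hS : IsClopen {x | Γ.r x ∈ S}) :
    Continuous fun x => signFun S (Γ.r x) :=
  ((continuous_charFun hS).const_mul 2).sub continuous_const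

/-- Multiplication by `χ_S = (1 + (2 χ_S - 1)) / 2` is the mean of two isometric operations. -/
theorem norm_ι_lcut_le (f : CcSection B) : ‖ℬ.ι lam (h.lcut hS f)‖ ≤ 1 * ‖ℬ.ι lam f‖ := by
  have h1 : ℬ.ι lam (h.lsmul (continuous_signFun hS) f) + ℬ.ι lam f =
      (2 : ℂ) • ℬ.ι lam (h.lcut hS f) := by
    rw [← ι_smul (k := h.bundle.toCc ((2 : ℂ) • ⟨_, h.bundle.mem_ccSections (h.lcut hS f)⟩)) 2
      fun _ => rfl]
    refine (ι_add fun x => ?_).symm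
    change (2 : ℂ) • ((charFun S (Γ.r x) : ℝ) : ℂ) • f.toFun x =
      ((2 * charFun S (Γ.r x) - 1 : ℝ) : ℂ) • f.toFun x + f.toFun x
    push_cast
    rw [sub_smul, one_smul, sub_add_cancel, SemigroupAction.mul_smul]
  have h2 := norm_add_le (ℬ.ι lam (h.lsmul (continuous_signFun hS) f)) (ℬ.ι lam f)
  rw [h1, norm_smul, h.norm_ι_lsmul _ signFun_mul_self] at h2
  norm_num at h2
  linarith

theorem norm_ι_rcut_le (f : CcSection B) : ‖ℬ.ι lam (h.rcut hS f)‖ ≤ 1 * ‖ℬ.ι lam f‖ := by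
  have h1 : ℬ.ι lam (h.rsmul (continuous_signFun hS) f) + ℬ.ι lam f =
      (2 : ℂ) • ℬ.ι lam (h.rcut hS f) := by
    rw [← ι_smul (k := h.bundle.toCc ((2 : ℂ) • ⟨_, h.bundle.mem_ccSections (h.rcut hS f)⟩)) 2
      fun _ => rfl]
    refine (ι_add fun x => ?_).symm
    change (2 : ℂ) • ((charFun S (Γ.s x) : ℝ) : ℂ) • f.toFun x =
      ((2 * charFun S (Γ.s x) - 1 : ℝ) : ℂ) • f.toFun x + f.toFun x
    push_cast
    rw [sub_smul, one_smul, sub_add_cancel, SemigroupAction.mul_smul]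
  have h2 := norm_add_le (ℬ.ι lam (h.rsmul (continuous_signFun hS) f)) (ℬ.ι lam f)
  rw [h1, norm_smul, h.norm_ι_rsmul _ signFun_mul_self] at h2
  norm_num at h2
  linarith

/-- `lcut` as a linear map into the C⋆-algebra. -/
def lcutLin : h.bundle.ccSections →ₗ[ℂ] ℬ.CStar lam where
  toFun f := ℬ.ι lam (h.lcut hS (h.bundle.toCc f))
  map_add' f g := ι_add fun x => smul_add _ (f.1 x) (g.1 x)
  map_smul' c f := ι_smul c fun x => smul_comm _ c (f.1 x)

/-- `rcut` as a linear map into the C⋆-algebra. -/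
def rcutLin : h.bundle.ccSections →ₗ[ℂ] ℬ.CStar lam where
  toFun f := ℬ.ι lam (h.rcut hS (h.bundle.toCc f))
  map_add' f g := ι_add fun x => smul_add _ (f.1 x) (g.1 x)
  map_smul' c f := ι_smul c fun x => smul_comm _ c (f.1 x)

/-- The bounded extension of `lcut` to the C⋆-algebra. -/
def lcutExt : ℬ.CStar lam →L[ℂ] ℬ.CStar lam := (h.lcutLin hS).extendOfNorm h.ιLin

/-- The bounded extension of `rcut` to the C⋆-algebra. -/
def rcutExt : ℬ.CStar lam →L[ℂ] ℬ.CStar lam := (h.rcutLin hS).extendOfNorm h.ιLin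

theorem lcutExt_ι (f : CcSection B) : h.lcutExt hS (ℬ.ι lam f) = ℬ.ι lam (h.lcut hS f) :=
  LinearMap.extendOfNorm_eq h.denseRange_ιLin
    ⟨1, fun f => h.norm_ι_lcut_le hS (h.bundle.toCc f)⟩ ⟨_, h.bundle.mem_ccSections f⟩

theorem rcutExt_ι (f : CcSection B) : h.rcutExt hS (ℬ.ι lam f) = ℬ.ι lam (h.rcut hS f) :=
  LinearMap.extendOfNorm_eq h.denseRange_ιLin
    ⟨1, fun f => h.norm_ι_rcut_le hS (h.bundle.toCc f)⟩ ⟨_, h.bundle.mem_ccSections f⟩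

/-- The multiplier given by a clopen part `S` of the unit space. -/
def cutdown : 𝓜(ℂ, ℬ.CStar lam) where
  toProd := (h.lcutExt hS, h.rcutExt hS)
  central x y := by
    refine h.denseRange_ι.induction_on₂ (isClosed_eq (by fun_prop) (by fun_prop)) (fun f g => ?_)
      x y
    change h.rcutExt hS (ℬ.ι lam f) * ℬ.ι lam g = ℬ.ι lam f * h.lcutExt hS (ℬ.ι lam g)
    rw [lcutExt_ι, rcutExt_ι]
    exact h.ι_rsmul_mul _ f g

theorem isCutdown_cutdown : ℬ.IsCutdown lam S (h.cutdown hS) := by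
  intro f
  refine ⟨⟨_, h.lcut_apply hS f, ?_⟩, ⟨_, h.rcut_apply hS f, ?_⟩⟩
  · rw [DoubleCentralizer.mul_coe]
    exact congrArg _ (h.lcutExt_ι hS f)
  · rw [DoubleCentralizer.coe_mul']
    exact congrArg _ (h.rcutExt_ι hS f)

variable {p : 𝓜(ℂ, ℬ.CStar lam)}

theorem fst_ι (hp : ℬ.IsCutdown lam S p) (f : CcSection B) :
    p.fst (ℬ.ι lam f) = ℬ.ι lam (h.lcut hS f) := by
  obtain ⟨⟨g, hg, hpg⟩, -⟩ := hp f
  rw [DoubleCentralizer.mul_coe] at hpg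
  rw [DoubleCentralizer.coe_inj hpg]
  exact congrArg _ (CcSection.ext fun x => (hg x).trans (h.lcut_apply hS f x).symm)

theorem snd_ι (hp : ℬ.IsCutdown lam S p) (f : CcSection B) :
    p.snd (ℬ.ι lam f) = ℬ.ι lam (h.rcut hS f) := by
  obtain ⟨-, ⟨g, hg, hpg⟩⟩ := hp f
  rw [DoubleCentralizer.coe_mul'] at hpg
  rw [DoubleCentralizer.coe_inj hpg]
  exact congrArg _ (CcSection.ext fun x => (hg x).trans (h.rcut_apply hS f x).symm)

include h in
theorem ext_of_ι {p q : 𝓜(ℂ, ℬ.CStar lam)}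
    (hpq : ∀ f, p.fst (ℬ.ι lam f) = q.fst (ℬ.ι lam f)) : p = q := by
  refine DoubleCentralizer.eq_of_fst_eq (DFunLike.coe_injective ?_)
  exact h.denseRange_ι.equalizer p.fst.continuous q.fst.continuous (funext hpq)

include h hS in
theorem existsUnique_isCutdown : ∃! p, ℬ.IsCutdown lam S p :=
  ⟨h.cutdown hS, h.isCutdown_cutdown hS, fun q hq => h.ext_of_ι fun f => by
    rw [h.fst_ι hS hq, h.fst_ι hS (h.isCutdown_cutdown hS)]⟩

include h hS in
theorem isStarProjection_of_isCutdown (hp : ℬ.IsCutdown lam S p) : IsStarProjection p where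
  isIdempotentElem := h.ext_of_ι fun f => by
    rw [DoubleCentralizer.mul_fst, mul_apply_eq_comp, h.fst_ι hS hp, h.fst_ι hS hp]
    refine congrArg _ (CcSection.ext fun x => ?_)
    rw [lcut_apply, lcut_apply]
    split_ifs <;> rfl
  isSelfAdjoint := h.ext_of_ι fun f => by
    obtain ⟨k, hk⟩ := h.exists_star f
    rw [DoubleCentralizer.star_fst, ← ι_star hk, h.snd_ι hS hp, h.fst_ι hS hp, rcut,
      ← h.star_ι_lsmul _ hk, star_star]
    rfl

end Cutdown

end FellOps.IsConvolutionBundle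

/-- Approximation by a weighted sum with weights from a partition of unity. -/
theorem norm_sub_sum_smul_le {ι E : Type*} [Fintype ι] [NormedAddCommGroup E] [NormedSpace ℂ E]
    {t : ι → ℝ} (ht0 : ∀ i, 0 ≤ t i) (ht1 : ∑ i, t i ≤ 1) {k : E} {c : ι → E} {ε : ℝ}
    (hε : 0 ≤ ε) (hk : k ≠ 0 → ∑ i, t i = 1) (hc : ∀ i, t i ≠ 0 → ‖k - c i‖ ≤ ε) :
    ‖k - ∑ i, (t i : ℂ) • c i‖ ≤ ε := by
  have h1 : k = ∑ i, (t i : ℂ) • k := by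
    rw [← Finset.sum_smul, ← Complex.ofReal_sum]
    by_cases h0 : k = 0
    · simp [h0]
    · rw [hk h0]; simp
  have h2 : k - ∑ i, (t i : ℂ) • c i = ∑ i, (t i : ℂ) • (k - c i) := by
    simp only [smul_sub, Finset.sum_sub_distrib]
    rw [← h1]
  rw [h2]
  calc _ ≤ ∑ i, t i * ε := by
        refine norm_sum_le_of_le _ fun i _ => ?_
        rw [norm_smul, Complex.norm_real, Real.norm_of_nonneg (ht0 i)]
        by_cases hi : t i = 0
        · simp [hi]
        · exact mul_le_mul_of_nonneg_left (hc i hi) (ht0 i)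
    _ ≤ ε := by
        rw [← Finset.sum_mul]
        exact mul_le_of_le_one_left hε ht1

namespace FellOps

variable {G : Type u} {Γ : GroupoidOps G} {B : G → Type v}
  [∀ x, NormedAddCommGroup (B x)] [∀ x, NormedSpace ℂ (B x)]
  [TopologicalSpace G] [MeasurableSpace G] [TopologicalSpace (Tot B)]

/-! ### Approximation by products of sections -/

/-- The span of the families `(y, w) ↦ a y * b w` with sections `a`, `b` vanishing off `U` and `W`
respectively. -/
def simpleSpan (ℬ : FellOps Γ B) (U W : Set G) :
    Submodule ℂ (∀ p : G × G, B (Γ.mul p.1 p.2)) :=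
  Submodule.span ℂ {P : ∀ p : G × G, B (Γ.mul p.1 p.2) |
    ∃ a b : CcSection B, (∀ y, y ∉ U → a.toFun y = 0) ∧ (∀ w, w ∉ W → b.toFun w = 0) ∧ P = fun p : G × G => ℬ.mul (a.toFun p.1) (b.toFun p.2)}

namespace IsConvolutionBundle

variable {ℬ : FellOps Γ B} {lam : G → Measure G} (h : ℬ.IsConvolutionBundle lam)

include h

theorem continuousOn_simple {U W : Set G} {P : ∀ p : G × G, B (Γ.mul p.1 p.2)}
    (hP : P ∈ ℬ.simpleSpan U W) :
    ContinuousOn (fun p : G × G => (⟨Γ.mul p.1 p.2, P p⟩ : Tot B)) {p | Γ.s p.1 = Γ.r p.2} := by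
  intro p hp
  unfold simpleSpan at hP
  induction hP using Submodule.span_induction with
  | mem P hP =>
    obtain ⟨a, b, -, -, rfl⟩ := hP
    exact h.continuousOn_mulT.comp (f := fun p : G × G =>
      ((⟨p.1, a.toFun p.1⟩ : Tot B), (⟨p.2, b.toFun p.2⟩ : Tot B)))
      ((a.continuous_toFun.comp continuous_fst).prodMk
        (b.continuous_toFun.comp continuous_snd)).continuousOn (fun _ hp => hp) p hp
  | zero =>
    exact h.bundle.tendsto_zero_of_norm (f := fun p => 0) (h.continuousOn_mul p hp)
        (by simp [tendsto_const_nhds])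
  | add P Q _ _ hP hQ => exact h.bundle.tendsto_add hP hQ
  | smul c P _ hP => exact h.bundle.tendsto_const_smul c hP

theorem simple_eq_zero_fst {U W : Set G} {P : ∀ p : G × G, B (Γ.mul p.1 p.2)}
    (hP : P ∈ ℬ.simpleSpan U W) {p : G × G} (hp : Γ.s p.1 = Γ.r p.2) (hpU : p.1 ∉ U) :
    P p = 0 := by
  unfold simpleSpan at hP
  induction hP using Submodule.span_induction with
  | mem P hP => obtain ⟨a, b, ha, -, rfl⟩ := hP; simp [ha _ hpU, h.zero_mul hp]
  | zero => rfl
  | add P Q _ _ hP hQ => simp [hP, hQ]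
  | smul c P _ hP => simp [hP]

theorem simple_eq_zero_snd {U W : Set G} {P : ∀ p : G × G, B (Γ.mul p.1 p.2)}
    (hP : P ∈ ℬ.simpleSpan U W) {p : G × G} (hp : Γ.s p.1 = Γ.r p.2) (hpW : p.2 ∉ W) :
    P p = 0 := by
  unfold simpleSpan at hP
  induction hP using Submodule.span_induction with
  | mem P hP => obtain ⟨a, b, -, hb, rfl⟩ := hP; simp [hb _ hpW, h.mul_zero hp]
  | zero => rfl
  | add P Q _ _ hP hQ => simp [hP, hQ]
  | smul c P _ hP => simp [hP]

theorem exists_fst_smul_simple {U U' W : Set G} {φ : C(G, ℝ)} (hφ : tsupport φ ⊆ U)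
    {P : ∀ p : G × G, B (Γ.mul p.1 p.2)} (hP : P ∈ ℬ.simpleSpan U' W) :
    ∃ Q ∈ ℬ.simpleSpan U W, ∀ p : G × G, Γ.s p.1 = Γ.r p.2 → Q p = (φ p.1 : ℂ) • P p := by
  unfold simpleSpan at hP
  induction hP using Submodule.span_induction with
  | mem P hP =>
    obtain ⟨a, b, -, hb, rfl⟩ := hP
    refine ⟨_, Submodule.subset_span ⟨h.bundle.mulSection (fun y => (φ y : ℂ))
      (Complex.continuous_ofReal.comp φ.continuous) a, b, fun y hy => ?_, hb, rfl⟩,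
      fun p hp => h.smul_mul _ _ hp _ _ _⟩
    have : φ y = 0 := image_eq_zero_of_notMem_tsupport fun hy' => hy (hφ hy')
    simp [IsUSCBanachBundle.mulSection, this]
  | zero => exact ⟨0, zero_mem _, fun p _ => by simp⟩
  | add P P' _ _ hP hP' =>
    obtain ⟨Q, hQ, hQP⟩ := hP
    obtain ⟨Q', hQ', hQP'⟩ := hP'
    exact ⟨Q + Q', add_mem hQ hQ', fun p hp => by simp [hQP p hp, hQP' p hp]⟩
  | smul c P _ hP =>
    obtain ⟨Q, hQ, hQP⟩ := hP
    exact ⟨c • Q, Submodule.smul_mem _ c hQ, fun p hp => by simp [hQP p hp, smul_comm c]⟩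

theorem exists_snd_smul_simple {U W W' : Set G} {φ : C(G, ℝ)} (hφ : tsupport φ ⊆ W)
    {P : ∀ p : G × G, B (Γ.mul p.1 p.2)} (hP : P ∈ ℬ.simpleSpan U W') :
    ∃ Q ∈ ℬ.simpleSpan U W, ∀ p : G × G, Γ.s p.1 = Γ.r p.2 → Q p = (φ p.2 : ℂ) • P p := by
  unfold simpleSpan at hP
  induction hP using Submodule.span_induction with
  | mem P hP =>
    obtain ⟨a, b, ha, -, rfl⟩ := hP
    refine ⟨_, Submodule.subset_span ⟨a, h.bundle.mulSection (fun y => (φ y : ℂ))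
      (Complex.continuous_ofReal.comp φ.continuous) b, ha, fun y hy => ?_, rfl⟩,
      fun p hp => h.mul_smul _ _ hp _ _ _⟩
    have : φ y = 0 := image_eq_zero_of_notMem_tsupport fun hy' => hy (hφ hy')
    simp [IsUSCBanachBundle.mulSection, this]
  | zero => exact ⟨0, zero_mem _, fun p _ => by simp⟩
  | add P P' _ _ hP hP' =>
    obtain ⟨Q, hQ, hQP⟩ := hP
    obtain ⟨Q', hQ', hQP'⟩ := hP'
    exact ⟨Q + Q', add_mem hQ hQ', fun p hp => by simp [hQP p hp, hQP' p hp]⟩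
  | smul c P _ hP =>
    obtain ⟨Q, hQ, hQP⟩ := hP
    exact ⟨c • Q, Submodule.smul_mem _ c hQ, fun p hp => by simp [hQP p hp, smul_comm c]⟩

variable [T2Space G] [LocallyCompactSpace G] [BorelSpace G]

/-- Saturation and the existence of enough sections: the families in `simpleSpan` have dense values
at every composable pair. -/
theorem exists_simple_near {p : G × G} (hp : Γ.s p.1 = Γ.r p.2) (d : B (Γ.mul p.1 p.2)) {ε : ℝ}
    (hε : 0 < ε) : ∃ P ∈ ℬ.simpleSpan Set.univ Set.univ, ‖d - P p‖ < ε := by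
  have key : ∀ c ∈ Submodule.span ℂ
      {c : B (Γ.mul p.1 p.2) | ∃ (a : B p.1) (b : B p.2), c = ℬ.mul a b},
      ∀ η > 0, ∃ P ∈ ℬ.simpleSpan Set.univ Set.univ, ‖c - P p‖ < η := by
    intro c hc
    induction hc using Submodule.span_induction with
    | mem c hc =>
      obtain ⟨a, b, rfl⟩ := hc
      intro η hη
      have hcont : Tendsto (fun q : B p.1 × B p.2 => ℬ.mul q.1 q.2) (𝓝 (a, b))
          (𝓝 (ℬ.mul a b)) := by
        refine h.bundle.tendsto_fibre_iff.1 ?_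
        refine (h.continuousOn_mulT (⟨p.1, a⟩, ⟨p.2, b⟩) hp).tendsto.comp
          (f := fun q : B p.1 × B p.2 => ((⟨p.1, q.1⟩ : Tot B), (⟨p.2, q.2⟩ : Tot B)))
          (tendsto_nhdsWithin_iff.2 ⟨?_, .of_forall fun _ => hp⟩)
        exact ((h.bundle.continuous_fibre _).comp continuous_fst).prodMk
          ((h.bundle.continuous_fibre _).comp continuous_snd) |>.tendsto (a, b)
      obtain ⟨δ, hδ, hball⟩ := Metric.tendsto_nhds_nhds.1 hcont η hη
      obtain ⟨f, hf⟩ := h.bundle.exists_ccSection_near a hδ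
      obtain ⟨g, hg⟩ := h.bundle.exists_ccSection_near b hδ
      refine ⟨_, Submodule.subset_span ⟨f, g, fun y hy => (hy trivial).elim,
        fun y hy => (hy trivial).elim, rfl⟩, ?_⟩
      have := hball (x := (f.toFun p.1, g.toFun p.2)) (by
        rw [Prod.dist_eq, max_lt_iff, dist_comm, dist_eq_norm, dist_comm, dist_eq_norm]
        exact ⟨hf, hg⟩)
      rwa [dist_comm, dist_eq_norm] at this
    | zero => exact fun η hη => ⟨0, zero_mem _, by simpa using hη⟩
    | add c c' _ _ hc hc' =>
      intro η hη
      obtain ⟨P, hP, hcP⟩ := hc (η / 2) (by positivity)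
      obtain ⟨P', hP', hcP'⟩ := hc' (η / 2) (by positivity)
      refine ⟨P + P', add_mem hP hP', ?_⟩
      rw [Pi.add_apply, add_sub_add_comm]
      exact (norm_add_le _ _).trans_lt (by linarith)
    | smul k c _ hc =>
      intro η hη
      obtain ⟨P, hP, hcP⟩ := hc (η / (‖k‖ + 1)) (by positivity)
      refine ⟨k • P, Submodule.smul_mem _ k hP, ?_⟩
      rw [Pi.smul_apply, ← smul_sub, norm_smul]
      calc ‖k‖ * ‖c - P p‖ ≤ (‖k‖ + 1) * ‖c - P p‖ := by gcongr; linarith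
        _ < (‖k‖ + 1) * (η / (‖k‖ + 1)) := by gcongr
        _ = η := by field_simp
  obtain ⟨c, hc, hdc⟩ := Metric.mem_closure_iff.1 (h.dense_mul p.1 p.2 hp d) (ε / 2)
    (by positivity)
  obtain ⟨P, hP, hcP⟩ := key c hc (ε / 2) (by positivity)
  refine ⟨P, hP, ?_⟩
  rw [dist_eq_norm] at hdc
  calc ‖d - P p‖ ≤ ‖d - c‖ + ‖c - P p‖ := norm_sub_le_norm_sub_add_norm_sub _ _ _
    _ < ε := by linarith

section Approx

variable {k : ∀ p : G × G, B (Γ.mul p.1 p.2)}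
  (hk : ContinuousOn (fun p : G × G => (⟨Γ.mul p.1 p.2, k p⟩ : Tot B)) {p | Γ.s p.1 = Γ.r p.2})

include hk

theorem exists_simple_approx_nhds (p₀ : G × G) {ε : ℝ} (hε : 0 < ε) :
    ∃ V W : Set G, IsOpen V ∧ IsOpen W ∧ p₀.1 ∈ V ∧ p₀.2 ∈ W ∧
      ∃ P ∈ ℬ.simpleSpan Set.univ Set.univ, ∀ p : G × G, Γ.s p.1 = Γ.r p.2 → p.1 ∈ V → p.2 ∈ W →
        ‖k p - P p‖ < ε := by
  have key : ∃ P ∈ ℬ.simpleSpan Set.univ Set.univ,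
      ∀ᶠ p in 𝓝 p₀, Γ.s p.1 = Γ.r p.2 → ‖k p - P p‖ < ε := by
    by_cases hp : Γ.s p₀.1 = Γ.r p₀.2
    · obtain ⟨P, hP, hkP⟩ := h.exists_simple_near hp (k p₀) hε
      refine ⟨P, hP, eventually_nhdsWithin_iff.1 (h.bundle.eventually_norm_lt ?_ hkP)⟩
      exact h.bundle.tendsto_sub (hk p₀ hp) (h.continuousOn_simple hP p₀ hp)
    · refine ⟨0, zero_mem _, ?_⟩
      have hcl : IsClosed {p : G × G | Γ.s p.1 = Γ.r p.2} :=
        isClosed_eq (h.continuous_s.comp continuous_fst) (h.continuous_r.comp continuous_snd)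
      filter_upwards [hcl.isOpen_compl.mem_nhds hp] with p hp hp' using absurd hp' hp
  obtain ⟨P, hP, hev⟩ := key
  obtain ⟨V, hV, W, hW, hVW⟩ := mem_nhds_prod_iff.1 hev
  exact ⟨interior V, interior W, isOpen_interior, isOpen_interior,
    mem_interior_iff_mem_nhds.2 hV, mem_interior_iff_mem_nhds.2 hW, P, hP, fun p hp hpV hpW =>
      hVW (Set.mk_mem_prod (interior_subset hpV) (interior_subset hpW)) hp⟩

theorem exists_simple_approx_fst {KW OW : Set G} (hKW : IsCompact KW) (hOW : IsOpen OW)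
    (hKO : KW ⊆ OW) (hkK : ∀ p : G × G, Γ.s p.1 = Γ.r p.2 → p.2 ∉ KW → k p = 0) (y₀ : G) {ε : ℝ}
    (hε : 0 < ε) :
    ∃ V : Set G, IsOpen V ∧ y₀ ∈ V ∧ ∃ P ∈ ℬ.simpleSpan Set.univ OW,
      ∀ p : G × G, Γ.s p.1 = Γ.r p.2 → p.1 ∈ V → ‖k p - P p‖ ≤ ε := by
  classical
  choose V W hV hW hyV hwW P hP hkP using fun w => h.exists_simple_approx_nhds hk (y₀, w) hε
  obtain ⟨t, -, ht⟩ := hKW.elim_nhds_subcover W fun w _ => (hW w).mem_nhds (hwW w)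
  obtain ⟨ψ, hψW, -, hψ0, hψ1, hψK⟩ := exists_partition_of_compact hKW
    (fun i : t => W i ∩ OW) (fun i => (hW i).inter hOW) (fun w hw => by
      obtain ⟨i, hi, hwi⟩ := Set.mem_iUnion₂.1 (ht hw)
      exact Set.mem_iUnion.2 ⟨⟨i, hi⟩, hwi, hKO hw⟩)
  choose Q hQ hQP using fun i : t => h.exists_snd_smul_simple (U := Set.univ)
    ((hψW i).trans Set.inter_subset_right) (hP i)
  refine ⟨⋂ i : t, V i, isOpen_iInter_of_finite fun i => hV i, Set.mem_iInter.2 fun i => hyV i,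
    ∑ i, Q i, Submodule.sum_mem _ fun i _ => hQ i, fun p hp hpV => ?_⟩
  have h1 : (∑ i, Q i) p = ∑ i : t, (ψ i p.2 : ℂ) • P i p := by
    rw [Finset.sum_apply]
    exact Finset.sum_congr rfl fun i _ => hQP i p hp
  rw [h1]
  refine norm_sub_sum_smul_le (fun i => hψ0 i _) (hψ1 _) hε.le (fun hk0 => hψK _ ?_) fun i hi => ?_
  · by_contra hpK
    exact hk0 (hkK p hp hpK)
  · exact (hkP i p hp (Set.mem_iInter.1 hpV i)
      (hψW i (subset_tsupport _ (Function.mem_support.2 hi))).1).le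

/-- A continuous compactly supported family of vectors over the composable pairs is a uniform limit
of sums of products of sections with controlled supports. -/
theorem exists_simple_approx {KY OY KW OW : Set G} (hKY : IsCompact KY) (hOY : IsOpen OY)
    (hKOY : KY ⊆ OY) (hKW : IsCompact KW) (hOW : IsOpen OW) (hKO : KW ⊆ OW)
    (hkY : ∀ p : G × G, Γ.s p.1 = Γ.r p.2 → p.1 ∉ KY → k p = 0)
    (hkW : ∀ p : G × G, Γ.s p.1 = Γ.r p.2 → p.2 ∉ KW → k p = 0) {ε : ℝ} (hε : 0 < ε) :
    ∃ P ∈ ℬ.simpleSpan OY OW, ∀ p : G × G, Γ.s p.1 = Γ.r p.2 → ‖k p - P p‖ ≤ ε := by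
  classical
  choose V hV hyV P hP hkP using fun y => h.exists_simple_approx_fst hk hKW hOW hKO hkW y hε
  obtain ⟨t, -, ht⟩ := hKY.elim_nhds_subcover V fun w _ => (hV w).mem_nhds (hyV w)
  obtain ⟨φ, hφV, -, hφ0, hφ1, hφK⟩ := exists_partition_of_compact hKY
    (fun i : t => V i ∩ OY) (fun i => (hV i).inter hOY) (fun w hw => by
      obtain ⟨i, hi, hwi⟩ := Set.mem_iUnion₂.1 (ht hw)
      exact Set.mem_iUnion.2 ⟨⟨i, hi⟩, hwi, hKOY hw⟩)
  choose Q hQ hQP using fun i : t => h.exists_fst_smul_simple (U := OY)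
    ((hφV i).trans Set.inter_subset_right) (hP i)
  refine ⟨∑ i, Q i, Submodule.sum_mem _ fun i _ => hQ i, fun p hp => ?_⟩
  have h1 : (∑ i, Q i) p = ∑ i : t, (φ i p.1 : ℂ) • P i p := by
    rw [Finset.sum_apply]
    exact Finset.sum_congr rfl fun i _ => hQP i p hp
  rw [h1]
  refine norm_sub_sum_smul_le (fun i => hφ0 i _) (hφ1 _) hε.le (fun hk0 => hφK _ ?_) fun i hi => ?_
  · by_contra hpK
    exact hk0 (hkY p hp hpK)
  · exact hkP i p hp (hφV i (subset_tsupport _ (Function.mem_support.2 hi))).1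

end Approx

/-! ### Estimates of the `I`-norm -/

theorem exists_haar_bound {K : Set G} (hK : IsCompact K) :
    ∃ M : ℝ, 0 ≤ M ∧ ∀ u ∈ Γ.units, lam u K ≤ ENNReal.ofReal M := by
  obtain ⟨O, -, hKO, -, χ, hχc, -, hχ0, hχ1⟩ := exists_open_bump hK isOpen_univ (Set.subset_univ K)
  obtain ⟨M, hM⟩ := hK.exists_bound_of_continuousOn
    (h.continuous_haar χ.continuous hχc).continuousOn
  refine ⟨max M 0, le_max_right _ _, fun u hu => ?_⟩
  have := h.finite u hu
  by_cases hex : ∃ x ∈ K, Γ.r x = u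
  · obtain ⟨x, hx, rfl⟩ := hex
    have hint : Integrable χ (lam (Γ.r x)) := χ.continuous.integrable_of_hasCompactSupport hχc
    calc lam (Γ.r x) K = ∫⁻ y in K, 1 ∂(lam (Γ.r x)) := by simp
      _ ≤ ∫⁻ y in K, ENNReal.ofReal (χ y) ∂(lam (Γ.r x)) :=
          setLIntegral_mono' hK.measurableSet fun y hy => by simp [hχ1 y (hKO hy)]
      _ ≤ ∫⁻ y, ENNReal.ofReal (χ y) ∂(lam (Γ.r x)) := setLIntegral_le_lintegral _ _
      _ = ENNReal.ofReal (∫ y, χ y ∂(lam (Γ.r x))) :=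
          (ofReal_integral_eq_lintegral_ofReal hint (.of_forall hχ0)).symm
      _ ≤ _ := ENNReal.ofReal_le_ofReal
          ((le_abs_self _).trans ((hM x hx).trans (le_max_left _ _)))
  · have h0 : lam u K = 0 := measure_mono_null (fun x hx hxu => hex ⟨x, hx, hxu⟩)
      (h.null_compl u hu)
    simp [h0]

/-- Sections that are small relative to the measures of a compact set and that vanish off another
one have small `I`-norm. -/
theorem exists_iNorm_bound {K K' : Set G} (hK : IsCompact K) (hK' : IsCompact K') :
    ∃ M : ℝ, 0 ≤ M ∧ ∀ (e : ∀ x, B x) (ε : ℝ), 0 ≤ ε →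
      (∀ x, ‖e x‖ₑ ≤ ENNReal.ofReal ε * lam (Γ.r x) K) → (∀ x, x ∉ K' → e x = 0) →
      ℬ.iNorm lam e ≤ ε * M := by
  obtain ⟨M, hM0, hM⟩ := h.exists_haar_bound hK
  have hL : IsCompact (K' ∪ Γ.inv '' K') := hK'.union (hK'.image h.continuous_inv)
  obtain ⟨M', hM0', hM'⟩ := h.exists_haar_bound hL
  refine ⟨M * M', by positivity, fun e ε hε he heK => ?_⟩
  have key : ∀ φ : G → G, (∀ x, φ x ∈ K' → x ∈ K' ∪ Γ.inv '' K') → ∀ u ∈ Γ.units,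
      ∫⁻ x, ‖e (φ x)‖ₑ ∂(lam u) ≤ ENNReal.ofReal (ε * (M * M')) := by
    intro φ hφ u hu
    calc ∫⁻ x, ‖e (φ x)‖ₑ ∂(lam u)
        ≤ ∫⁻ x, (K' ∪ Γ.inv '' K').indicator (fun _ => ENNReal.ofReal (ε * M)) x ∂(lam u) := by
          refine lintegral_mono fun x => ?_
          by_cases hx : φ x ∈ K'
          · rw [Set.indicator_of_mem (hφ x hx), ENNReal.ofReal_mul hε]
            exact (he (φ x)).trans (mul_le_mul_right (hM _ (h.r_mem_units _)) _)
          · simp [heK _ hx]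
      _ = ENNReal.ofReal (ε * M) * lam u (K' ∪ Γ.inv '' K') := by
          rw [lintegral_indicator hL.measurableSet]; simp
      _ ≤ ENNReal.ofReal (ε * M) * ENNReal.ofReal M' := mul_le_mul_right (hM' u hu) _
      _ = _ := by rw [← ENNReal.ofReal_mul (by positivity), mul_assoc]
  refine ENNReal.toReal_le_of_le_ofReal (by positivity) (max_le ?_ ?_)
  · exact iSup₂_le fun u hu => key id (fun x hx => Or.inl hx) u hu
  · exact iSup₂_le fun u hu => key Γ.inv (fun x hx => Or.inr ⟨_, hx, h.inv_inv x⟩) u hu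

/-- A function in `C_c(T)` whose integrals over the range fibres of the points of `K` do not
vanish. -/
theorem exists_bump_integral_pos {K T : Set G} (hK : IsCompact K) (hT : IsOpen T)
    (hKT : ∀ x, ∃ y ∈ T, Γ.r y = Γ.r x) :
    ∃ Φ : C(G, ℝ), HasCompactSupport Φ ∧ tsupport Φ ⊆ T ∧ (∀ y, 0 ≤ Φ y) ∧
      ∀ x ∈ K, 0 < ∫ y, Φ y ∂(lam (Γ.r x)) := by
  refine hK.induction_on (p := fun K => ∃ Φ : C(G, ℝ), HasCompactSupport Φ ∧ tsupport Φ ⊆ T ∧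
    (∀ y, 0 ≤ Φ y) ∧ ∀ x ∈ K, 0 < ∫ y, Φ y ∂(lam (Γ.r x))) ?_ ?_ ?_ ?_
  · exact ⟨0, HasCompactSupport.zero, by simp [tsupport_zero], fun _ => le_rfl, fun x hx => hx.elim⟩
  · rintro s t hst ⟨Φ, h1, h2, h3, h4⟩
    exact ⟨Φ, h1, h2, h3, fun x hx => h4 x (hst hx)⟩
  · rintro s t ⟨Φ, h1, h2, h3, h4⟩ ⟨Ψ, h1', h2', h3', h4'⟩
    refine ⟨Φ + Ψ, h1.add h1', (tsupport_add Φ Ψ).trans (Set.union_subset h2 h2'),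
      fun y => add_nonneg (h3 y) (h3' y), fun x hx => ?_⟩
    have := h.finite _ (h.r_mem_units x)
    have hadd : ∫ y, (Φ + Ψ) y ∂(lam (Γ.r x)) =
        ∫ y, Φ y ∂(lam (Γ.r x)) + ∫ y, Ψ y ∂(lam (Γ.r x)) :=
      integral_add (Φ.continuous.integrable_of_hasCompactSupport h1)
        (Ψ.continuous.integrable_of_hasCompactSupport h1')
    rw [hadd]
    rcases hx with hx | hx
    · exact add_pos_of_pos_of_nonneg (h4 x hx) (integral_nonneg h3')
    · exact add_pos_of_nonneg_of_pos (integral_nonneg h3) (h4' x hx)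
  · intro x hx
    obtain ⟨y, hy, hyx⟩ := hKT x
    obtain ⟨O, hO, hyO, -, χ, hχc, hχT, hχ0, hχ1⟩ :=
      exists_open_bump (isCompact_singleton (x := y)) hT (by simpa using hy)
    have hpos : 0 < ∫ y, χ y ∂(lam (Γ.r x)) := by
      have := h.finite _ (h.r_mem_units x)
      rw [integral_pos_iff_support_of_nonneg hχ0
        (χ.continuous.integrable_of_hasCompactSupport hχc)]
      refine (h.pos_of_mem _ (h.r_mem_units x) O hO ⟨y, hyO rfl, hyx⟩).trans_le
        (measure_mono fun z hz => ?_)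
      simp [hχ1 z hz]
    refine ⟨_, mem_nhdsWithin_of_mem_nhds ((h.continuous_haar χ.continuous
      hχc).continuousAt.eventually_const_lt hpos), χ, hχc, hχT, hχ0, fun x hx => hx⟩

end IsConvolutionBundle

end FellOps

/-! ### Fullness of the multipliers -/

theorem norm_smul_sub_toFibre {X : Type u} {B : X → Type v} [∀ x, NormedAddCommGroup (B x)]
    [∀ x, NormedSpace ℂ (B x)] {x z : X} (hz : z = x) (c : ℂ) (f : ∀ x, B x) (b : B z) :
    ‖c • f x - toFibre x ⟨z, b⟩‖ = ‖c • f z - b‖ := by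
  subst hz; simp [toFibre_mk]

namespace FellOps.IsConvolutionBundle

variable {G : Type u} {Γ : GroupoidOps G} {B : G → Type v}
  [∀ x, NormedAddCommGroup (B x)] [∀ x, NormedSpace ℂ (B x)]
  [TopologicalSpace G] [MeasurableSpace G] [TopologicalSpace (Tot B)]
  {ℬ : FellOps Γ B} {lam : G → Measure G} (h : ℬ.IsConvolutionBundle lam)
  [T2Space G] [LocallyCompactSpace G] [BorelSpace G] {S : Set G}

include h

theorem integrable_simple {U W K : Set G} (hK : IsCompact K) (hUK : U ⊆ K)
    {P : ∀ p : G × G, B (Γ.mul p.1 p.2)} (hP : P ∈ ℬ.simpleSpan U W) (x : G) :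
    Integrable (fun y => toFibre x (⟨_, P (y, Γ.mul (Γ.inv y) x)⟩ : Tot B)) (lam (Γ.r x)) := by
  refine h.integrable_section (F := fun x y =>
    toFibre x (⟨_, P (y, Γ.mul (Γ.inv y) x)⟩ : Tot B))
    (h.continuousOn_toFibre (h.continuousOn_simple hP)) hK (fun x y hxy hy => ?_) x
  exact h.toFibre_eq_zero (h.simple_eq_zero_fst hP (h.inv_mul_composable hxy.symm)
    fun hU => hy (hUK hU))

/-- Integrating a sum of products `a y * b (y⁻¹ x)` gives a sum of convolutions `a * b`. If the
sections `a` vanish off `s⁻¹(S)`, these lie in `A p A`. -/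
theorem exists_section_of_simple {p : 𝓜(ℂ, ℬ.CStar lam)} (hp : ℬ.IsCutdown lam S p)
    {U W K : Set G} (hK : IsCompact K) (hUK : U ⊆ K) (hUS : ∀ y ∈ U, Γ.s y ∈ S)
    {P : ∀ p : G × G, B (Γ.mul p.1 p.2)} (hP : P ∈ ℬ.simpleSpan U W) :
    ∃ k : CcSection B, (∀ x, k.toFun x =
        ∫ y, toFibre x (⟨_, P (y, Γ.mul (Γ.inv y) x)⟩ : Tot B) ∂(lam (Γ.r x))) ∧
      ℬ.ι lam k ∈ Submodule.span ℂ {c : ℬ.CStar lam | ∃ a b : ℬ.CStar lam,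
        (c : 𝓜(ℂ, ℬ.CStar lam)) = (a : 𝓜(ℂ, ℬ.CStar lam)) * p * (b : 𝓜(ℂ, ℬ.CStar lam))} := by
  have hmem := hP
  unfold simpleSpan at hP
  induction hP using Submodule.span_induction with
  | mem P hP =>
    obtain ⟨a, b, ha, -, rfl⟩ := hP
    obtain ⟨k, hk⟩ := h.exists_conv a b
    refine ⟨k, hk, Submodule.subset_span ⟨ℬ.ι lam a, ℬ.ι lam b, ?_⟩⟩
    obtain ⟨-, ⟨g, hg, hpg⟩⟩ := hp a
    have hga : g = a := by
      refine CcSection.ext fun x => ?_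
      rw [hg x]
      split_ifs with hx
      · rfl
      · exact (ha x fun hU => hx (hUS x hU)).symm
    rw [hpg, hga, DoubleCentralizer.coe_mul_coe, ι_mul hk]
  | zero =>
    refine ⟨h.bundle.toCc 0, fun x => ?_, ?_⟩
    · have : ∀ y, toFibre x (⟨_, (0 : ∀ p : G × G, B (Γ.mul p.1 p.2)) (y, Γ.mul (Γ.inv y) x)⟩ :
          Tot B) = 0 := fun y => h.toFibre_eq_zero rfl
      simp only [this, integral_zero]
      rfl
    · have h0 : ℬ.ι lam (h.bundle.toCc 0) = 0 := h.ιLin.map_zero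
      rw [h0]
      exact zero_mem _
  | add P Q hP hQ ihP ihQ =>
    obtain ⟨k, hk, hkm⟩ := ihP hP
    obtain ⟨l, hl, hlm⟩ := ihQ hQ
    refine ⟨h.bundle.toCc (⟨_, h.bundle.mem_ccSections k⟩ + ⟨_, h.bundle.mem_ccSections l⟩),
      fun x => ?_, ?_⟩
    · simp only [Pi.add_apply, toFibre_mk_add]
      rw [integral_add (h.integrable_simple hK hUK hP x) (h.integrable_simple hK hUK hQ x),
        ← hk, ← hl]
      rfl
    · rw [ι_add (f := k) (g := l) fun _ => rfl]
      exact add_mem hkm hlm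
  | smul c P hP ihP =>
    obtain ⟨k, hk, hkm⟩ := ihP hP
    refine ⟨h.bundle.toCc (c • ⟨_, h.bundle.mem_ccSections k⟩), fun x => ?_, ?_⟩
    · simp only [Pi.smul_apply, toFibre_mk_smul]
      have := h.bundle.complete x
      rw [integral_smul, ← hk]
      rfl
    · rw [ι_smul (f := k) c fun _ => rfl]
      exact Submodule.smul_mem _ c hkm

/-- Every section is an integral `f x = ∫ Φ y • f' x dλ^{r x}(y)` with `Φ` supported in `s⁻¹(S)`. -/
theorem exists_integral_eq {T : Set G} (hT : IsOpen T) (hKT : ∀ x, ∃ y ∈ T, Γ.r y = Γ.r x)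
    (f : CcSection B) :
    ∃ (Φ : C(G, ℝ)) (f' : CcSection B), HasCompactSupport Φ ∧ tsupport Φ ⊆ T ∧
      ∀ x, f.toFun x = ∫ y, (Φ y : ℂ) • f'.toFun x ∂(lam (Γ.r x)) := by
  obtain ⟨K, hK, hfK⟩ := f.compact_support
  obtain ⟨Φ, hΦc, hΦT, hΦ0, hΦpos⟩ := h.exists_bump_integral_pos hK hT hKT
  have hm := h.continuous_haar Φ.continuous hΦc
  obtain ⟨δ, hδ, hδm⟩ := hK.exists_forall_le' hm.continuousOn hΦpos
  have hmax : Continuous fun x => (((max (∫ y, Φ y ∂(lam (Γ.r x))) δ)⁻¹ : ℝ) : ℂ) :=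
    Complex.continuous_ofReal.comp ((hm.max continuous_const).inv₀
      fun x => (hδ.trans_le (le_max_right _ _)).ne')
  refine ⟨Φ, h.bundle.mulSection _ hmax f, hΦc, hΦT, fun x => ?_⟩
  have := h.bundle.complete x
  rw [integral_smul_const, integral_complex_ofReal]
  change _ = _ • (((max (∫ y, Φ y ∂(lam (Γ.r x))) δ)⁻¹ : ℝ) : ℂ) • f.toFun x
  by_cases hx : x ∈ K
  · rw [max_eq_left (hδm x hx), smul_smul, ← Complex.ofReal_mul,
      mul_inv_cancel₀ (hδ.trans_le (hδm x hx)).ne', Complex.ofReal_one, one_smul]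
  · rw [hfK x hx, smul_zero, smul_zero]

/-- The integrand `Φ y • f' (y w)` of `exists_integral_eq`, as a function of `(y, w)`, is a uniform
limit of sums of products `a y * b w`, and integration turns these into elements of `A p A`. -/
theorem ι_mem_closure_of_isCutdown (hS : IsClopen {x | Γ.r x ∈ S})
    (hsurj : ∀ x, ∃ y, Γ.s y ∈ S ∧ Γ.r y = Γ.r x) {p : 𝓜(ℂ, ℬ.CStar lam)}
    (hp : ℬ.IsCutdown lam S p) (f : CcSection B) :
    ℬ.ι lam f ∈ closure (Submodule.span ℂ {c : ℬ.CStar lam | ∃ a b : ℬ.CStar lam,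
      (c : 𝓜(ℂ, ℬ.CStar lam)) = (a : 𝓜(ℂ, ℬ.CStar lam)) * p * (b : 𝓜(ℂ, ℬ.CStar lam))} :
        Set (ℬ.CStar lam)) := by
  have hT : IsOpen {y | Γ.s y ∈ S} := by
    have := hS.isOpen.preimage h.continuous_inv
    simpa [h.r_inv] using this
  obtain ⟨Φ, f', hΦc, hΦT, hf⟩ := h.exists_integral_eq hT hsurj f
  obtain ⟨K, hK, hfK⟩ := f'.compact_support
  -- `Φ y • f' (y w)` vanishes unless `y ∈ tsupport Φ` and `w ∈ KW`
  set KW : Set G := (fun p : G × G => Γ.mul p.1 p.2) ''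
    (((Γ.inv '' tsupport Φ) ×ˢ K) ∩ {p | Γ.s p.1 = Γ.r p.2}) with hKW_def
  have hKW : IsCompact KW := h.isCompact_mul (hΦc.isCompact.image h.continuous_inv) hK
  obtain ⟨OY, hOY, hKOY, hOYT, χ, hχc, -, -, hχ1⟩ := exists_open_bump hΦc.isCompact hT hΦT
  obtain ⟨OW, hOW, hKOW, -, χ', hχc', -, -, hχ1'⟩ :=
    exists_open_bump hKW isOpen_univ (Set.subset_univ KW)
  have hOYK : OY ⊆ tsupport χ := fun y hy =>
    subset_tsupport _ (Function.mem_support.2 (by rw [hχ1 y hy]; exact one_ne_zero))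
  have hOWK : OW ⊆ tsupport χ' := fun y hy =>
    subset_tsupport _ (Function.mem_support.2 (by rw [hχ1' y hy]; exact one_ne_zero))
  have hkcont : ContinuousOn (fun p : G × G =>
      (⟨Γ.mul p.1 p.2, (Φ p.1 : ℂ) • f'.toFun (Γ.mul p.1 p.2)⟩ : Tot B))
      {p | Γ.s p.1 = Γ.r p.2} := by
    intro p hp
    refine h.bundle.tendsto_smul ?_ ?_
    · exact ((Complex.continuous_ofReal.comp
        (Φ.continuous.comp continuous_fst)).tendsto p).mono_left nhdsWithin_le_nhds
    · exact (f'.continuous_toFun.tendsto _).comp (h.continuousOn_mul p hp)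
  have hkY : ∀ p : G × G, Γ.s p.1 = Γ.r p.2 → p.1 ∉ tsupport Φ →
      (Φ p.1 : ℂ) • f'.toFun (Γ.mul p.1 p.2) = 0 := fun p _ hpY => by
    simp [image_eq_zero_of_notMem_tsupport hpY]
  have hkW : ∀ p : G × G, Γ.s p.1 = Γ.r p.2 → p.2 ∉ KW →
      (Φ p.1 : ℂ) • f'.toFun (Γ.mul p.1 p.2) = 0 := fun p hp hpW => by
    by_cases hpY : p.1 ∈ tsupport Φ
    · have : Γ.mul p.1 p.2 ∉ K := fun hpK => hpW ⟨(Γ.inv p.1, Γ.mul p.1 p.2),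
        ⟨⟨⟨_, hpY, rfl⟩, hpK⟩, by simp [h.s_inv, h.r_mul _ _ hp]⟩,
        h.inv_mul_cancel_left _ _ hp⟩
      rw [hfK _ this, smul_zero]
    · exact hkY p hp hpY
  set K'' : Set G := (fun p : G × G => Γ.mul p.1 p.2) ''
    ((tsupport χ ×ˢ tsupport χ') ∩ {p | Γ.s p.1 = Γ.r p.2}) with hK''_def
  have hK'' : IsCompact K'' := h.isCompact_mul hχc.isCompact hχc'.isCompact
  obtain ⟨M, hM0, hM⟩ := h.exists_iNorm_bound hχc.isCompact hK''
  refine Metric.mem_closure_iff.2 fun ε hε => ?_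
  have hε' : 0 < ε / (M + 1) := by positivity
  obtain ⟨P, hP, hkP⟩ := h.exists_simple_approx hkcont hΦc.isCompact hOY hKOY hKW hOW hKOW hkY hkW
    hε'
  obtain ⟨k, hk, hkm⟩ := h.exists_section_of_simple hp hχc.isCompact hOYK
    (fun y hy => hOYT hy) hP
  refine ⟨ℬ.ι lam k, hkm, ?_⟩
  let e : h.bundle.ccSections := ⟨_, h.bundle.mem_ccSections f⟩ - ⟨_, h.bundle.mem_ccSections k⟩
  have he : ℬ.ι lam f - ℬ.ι lam k = ℬ.ι lam (h.bundle.toCc e) :=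
    (h.ιLin.map_sub ⟨_, h.bundle.mem_ccSections f⟩ ⟨_, h.bundle.mem_ccSections k⟩).symm
  -- the integrand of the error
  let D : ∀ x, G → B x := fun x y =>
    (Φ y : ℂ) • f'.toFun x - toFibre x (⟨_, P (y, Γ.mul (Γ.inv y) x)⟩ : Tot B)
  have heD : ∀ x, e.1 x = ∫ y, D x y ∂(lam (Γ.r x)) := fun x => by
    have := h.finite _ (h.r_mem_units x)
    have hint : Integrable (fun y => (Φ y : ℂ) • f'.toFun x) (lam (Γ.r x)) :=
      ((Φ.continuous.integrable_of_hasCompactSupport hΦc).ofReal).smul_const _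
    rw [integral_sub hint (h.integrable_simple hχc.isCompact hOYK hP x), ← hf, ← hk]
    rfl
  have hDnorm : ∀ x y, Γ.r y = Γ.r x → ‖D x y‖ ≤ ε / (M + 1) := fun x y hxy => by
    refine (norm_smul_sub_toFibre (h.mul_inv_cancel_left y x hxy) _ f'.toFun
      (P (y, Γ.mul (Γ.inv y) x))).trans_le ?_
    exact hkP (y, Γ.mul (Γ.inv y) x) (h.inv_mul_composable hxy)
  have hDzero : ∀ x y, Γ.r y = Γ.r x → (y ∉ tsupport χ ∨ x ∉ K'') → D x y = 0 := by
    intro x y hxy hor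
    have hc := h.inv_mul_composable hxy
    have hx := h.mul_inv_cancel_left y x hxy
    have hPD : P (y, Γ.mul (Γ.inv y) x) = 0 ∧
        (Φ y : ℂ) • f'.toFun (Γ.mul y (Γ.mul (Γ.inv y) x)) = 0 := by
      by_cases hy : y ∈ tsupport χ
      · have hw : Γ.mul (Γ.inv y) x ∉ tsupport χ' := fun hw =>
          (hor.resolve_left (not_not.2 hy)) ⟨(y, Γ.mul (Γ.inv y) x), ⟨⟨hy, hw⟩, hc⟩, hx⟩
        exact ⟨h.simple_eq_zero_snd hP hc fun hw' => hw (hOWK hw'),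
          hkW (y, Γ.mul (Γ.inv y) x) hc fun hw' => hw (hOWK (hKOW hw'))⟩
      · exact ⟨h.simple_eq_zero_fst hP hc fun hy' => hy (hOYK hy'),
          hkY (y, Γ.mul (Γ.inv y) x) hc fun hy' => hy (hOYK (hKOY hy'))⟩
    rw [← norm_eq_zero]
    refine (norm_smul_sub_toFibre hx _ f'.toFun (P (y, Γ.mul (Γ.inv y) x))).trans ?_
    rw [hPD.1, hPD.2, sub_zero, norm_zero]
  have hbound : ∀ x, ‖e.1 x‖ₑ ≤ ENNReal.ofReal (ε / (M + 1)) * lam (Γ.r x) (tsupport χ) := by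
    intro x
    rw [heD]
    calc ‖∫ y, D x y ∂(lam (Γ.r x))‖ₑ ≤ ∫⁻ y, ‖D x y‖ₑ ∂(lam (Γ.r x)) :=
          enorm_integral_le_lintegral_enorm _
      _ ≤ ∫⁻ y, (tsupport χ).indicator (fun _ => ENNReal.ofReal (ε / (M + 1))) y
            ∂(lam (Γ.r x)) := by
          refine lintegral_mono_ae ?_
          filter_upwards [h.ae_r_eq (h.r_mem_units x)] with y hy
          by_cases hyχ : y ∈ tsupport χ
          · rw [Set.indicator_of_mem hyχ, ← ofReal_norm]
            exact ENNReal.ofReal_le_ofReal (hDnorm x y hy)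
          · simp [hDzero x y hy (Or.inl hyχ)]
      _ = _ := by
          rw [lintegral_indicator hχc.isCompact.measurableSet]; simp
  have hvanish : ∀ x, x ∉ K'' → e.1 x = 0 := fun x hx => by
    rw [heD]
    refine integral_eq_zero_of_ae ?_
    filter_upwards [h.ae_r_eq (h.r_mem_units x)] with y hy
    exact hDzero x y hy (Or.inr hx)
  rw [dist_eq_norm, he]
  calc ‖ℬ.ι lam (h.bundle.toCc e)‖ ≤ ℬ.iNorm lam e.1 := norm_ι_le _
    _ ≤ ε / (M + 1) * M := hM _ _ hε'.le hbound hvanish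
    _ < ε / (M + 1) * (M + 1) := by gcongr; linarith
    _ = ε := by field_simp

/-- If every range fibre meets `s⁻¹(S)`, then the multiplier given by `S` is full. -/
theorem isFullMultiplier_of_isCutdown (hS : IsClopen {x | Γ.r x ∈ S})
    (hsurj : ∀ x, ∃ y, Γ.s y ∈ S ∧ Γ.r y = Γ.r x) {p : 𝓜(ℂ, ℬ.CStar lam)}
    (hp : ℬ.IsCutdown lam S p) : IsFullMultiplier p := by
  refine dense_iff_closure_eq.2 (Set.eq_univ_of_univ_subset ?_)
  rw [← h.denseRange_ι.closure_range]
  refine closure_minimal ?_ isClosed_closure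
  rintro _ ⟨f, rfl⟩
  exact h.ι_mem_closure_of_isCutdown hS hsurj hp f

end FellOps.IsConvolutionBundle

/-! ### The topology of the linking groupoid -/

namespace Link

variable {G Z H : Type u} [TopologicalSpace G] [TopologicalSpace Z] [TopologicalSpace H]

theorem isOpen_iff {U : Set (Link G Z H)} : IsOpen U ↔ IsOpen (ofG ⁻¹' U) ∧ IsOpen (ofZ ⁻¹' U) ∧
    IsOpen (zop ⁻¹' U) ∧ IsOpen (ofH ⁻¹' U) := by
  have h0 : IsOpen U ↔ ((IsOpen (ofG ⁻¹' U) ∧ IsOpen (ofZ ⁻¹' U)) ∧ IsOpen (zop ⁻¹' U)) ∧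
    IsOpen (ofH ⁻¹' U) := Iff.rfl
  rw [h0, and_assoc, and_assoc]

theorem continuous_iff {Y : Type*} [TopologicalSpace Y] {f : Link G Z H → Y} : Continuous f ↔
    Continuous (f ∘ ofG) ∧ Continuous (f ∘ ofZ) ∧ Continuous (f ∘ zop) ∧ Continuous (f ∘ ofH) := by
  simp only [continuous_def, isOpen_iff, Set.preimage_comp, forall_and]

theorem isOpenEmbedding_ofG : IsOpenEmbedding (ofG : G → Link G Z H) := by
  refine .of_continuous_injective_isOpenMap (continuous_iff.1 continuous_id).1
    (fun _ _ h => by simpa using h) fun V hV => ?_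
  simp [isOpen_iff, Set.preimage, hV]

theorem isOpenEmbedding_ofZ : IsOpenEmbedding (ofZ : Z → Link G Z H) := by
  refine .of_continuous_injective_isOpenMap (continuous_iff.1 continuous_id).2.1
    (fun _ _ h => by simpa using h) fun V hV => ?_
  simp [isOpen_iff, Set.preimage, hV]

theorem isOpenEmbedding_zop : IsOpenEmbedding (zop : Z → Link G Z H) := by
  refine .of_continuous_injective_isOpenMap (continuous_iff.1 continuous_id).2.2.1
    (fun _ _ h => by simpa using h) fun V hV => ?_
  simp [isOpen_iff, Set.preimage, hV]

theorem isOpenEmbedding_ofH : IsOpenEmbedding (ofH : H → Link G Z H) := by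
  refine .of_continuous_injective_isOpenMap (continuous_iff.1 continuous_id).2.2.2
    (fun _ _ h => by simpa using h) fun V hV => ?_
  simp [isOpen_iff, Set.preimage, hV]

instance [T2Space G] [T2Space Z] [T2Space H] : T2Space (Link G Z H) := by
  let e : Link G Z H → (G ⊕ Z) ⊕ (Z ⊕ H)
    | .ofG g => .inl (.inl g)
    | .ofZ z => .inl (.inr z)
    | .zop z => .inr (.inl z)
    | .ofH h => .inr (.inr h)
  have he : Continuous e := continuous_iff.2
    ⟨continuous_inl.comp continuous_inl, continuous_inl.comp continuous_inr,
      continuous_inr.comp continuous_inl, continuous_inr.comp continuous_inr⟩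
  refine T2Space.of_injective_continuous (f := e) (fun x y hxy => ?_) he
  cases x <;> cases y <;> simp_all [e]

theorem exists_compact_of_isOpenEmbedding {A X : Type*} [TopologicalSpace A] [TopologicalSpace X]
    [LocallyCompactSpace A] {i : A → X} (hi : IsOpenEmbedding i) (a : A) {n : Set X}
    (hn : n ∈ 𝓝 (i a)) : ∃ s ∈ 𝓝 (i a), s ⊆ n ∧ IsCompact s := by
  obtain ⟨s, hs, hsn, hsc⟩ := local_compact_nhds (hi.continuous.continuousAt.preimage_mem_nhds hn)
  exact ⟨i '' s, hi.isOpenMap.image_mem_nhds hs, Set.image_subset_iff.2 hsn,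
    hsc.image hi.continuous⟩

instance [LocallyCompactSpace G] [LocallyCompactSpace Z] [LocallyCompactSpace H] :
    LocallyCompactSpace (Link G Z H) where
  local_compact_nhds
    | .ofG g, _, hn => exists_compact_of_isOpenEmbedding isOpenEmbedding_ofG g hn
    | .ofZ z, _, hn => exists_compact_of_isOpenEmbedding isOpenEmbedding_ofZ z hn
    | .zop z, _, hn => exists_compact_of_isOpenEmbedding isOpenEmbedding_zop z hn
    | .ofH h, _, hn => exists_compact_of_isOpenEmbedding isOpenEmbedding_ofH h hn

end Link

theorem Topology.IsOpenEmbedding.continuousWithinAt_prodMap {A A' X X' Y : Type*}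
    [TopologicalSpace A] [TopologicalSpace A'] [TopologicalSpace X] [TopologicalSpace X']
    [TopologicalSpace Y] {i : A → X} {j : A' → X'} (hi : IsOpenEmbedding i)
    (hj : IsOpenEmbedding j) {f : X × X' → Y} {D : Set (X × X')} {a : A} {b : A'} :
    ContinuousWithinAt f D (i a, j b) ↔
      ContinuousWithinAt (fun p : A × A' => f (i p.1, j p.2)) {p | (i p.1, j p.2) ∈ D} (a, b) := by
  have := (hi.prodMap hj).map_nhdsWithin_preimage_eq D (a, b)
  unfold ContinuousWithinAt
  rw [show (i a, j b) = Prod.map i j (a, b) from rfl, ← this, tendsto_map'_iff]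
  rfl

/-! ### Groupoids and equivalences -/

namespace GroupoidOps.IsTopologicalGroupoid

variable {G : Type u} [TopologicalSpace G] {Γ : GroupoidOps G} (hΓ : Γ.IsTopologicalGroupoid)

include hΓ

theorem inv_mul_cancel_left {x y : G} (hxy : Γ.s x = Γ.r y) :
    Γ.mul (Γ.inv x) (Γ.mul x y) = y := by
  rw [← hΓ.mul_assoc _ _ _ (hΓ.s_inv x) hxy, hΓ.inv_mul, hxy, hΓ.r_mul_self]

theorem inv_inv (x : G) : Γ.inv (Γ.inv x) = x := by
  have := hΓ.inv_mul_cancel_left (hΓ.s_inv x)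
  rwa [hΓ.inv_mul, ← hΓ.r_inv x, ← hΓ.s_inv (Γ.inv x), hΓ.mul_s_self] at this

theorem mul_inv_cancel_left {x y : G} (hxy : Γ.r x = Γ.r y) :
    Γ.mul x (Γ.mul (Γ.inv x) y) = y := by
  have := hΓ.inv_mul_cancel_left (x := Γ.inv x) (y := y) (by rw [hΓ.s_inv, hxy])
  rwa [hΓ.inv_inv] at this

/-- If `x⁻¹ y` is a unit, then `x = y`. -/
theorem eq_of_inv_mul_mem_units {x y : G} (hxy : Γ.r x = Γ.r y)
    (hu : Γ.mul (Γ.inv x) y ∈ Γ.units) : x = y := by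
  have h1 : Γ.r (Γ.mul (Γ.inv x) y) = Γ.mul (Γ.inv x) y := hu
  rw [hΓ.r_mul _ _ (by rw [hΓ.s_inv, hxy]), hΓ.r_inv] at h1
  rw [← hΓ.mul_inv_cancel_left hxy, ← h1, hΓ.mul_s_self]

theorem r_eq_of_mem {x : G} (hx : x ∈ Γ.units) : Γ.r x = x := hx

theorem s_eq_of_mem {x : G} (hx : x ∈ Γ.units) : Γ.s x = x := by
  have h1 : Γ.r x = x := hx
  rw [← h1, hΓ.s_r]

theorem continuous_r : Continuous Γ.r := by
  have h1 : Continuous fun x => Γ.mul x (Γ.inv x) := by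
    refine hΓ.continuousOn_mul.comp_continuous (continuous_id.prodMk hΓ.continuous_inv)
      fun x => (hΓ.r_inv x).symm
  exact h1.congr hΓ.mul_inv

end GroupoidOps.IsTopologicalGroupoid

namespace EquivalenceOps.IsEquivalence

variable {G H Z : Type u} [TopologicalSpace G] [TopologicalSpace H] [TopologicalSpace Z]
  {X : EquivalenceOps G H Z} {ΓG : GroupoidOps G} {ΓH : GroupoidOps H}
  (hX : X.IsEquivalence ΓG ΓH) (hΓG : ΓG.IsTopologicalGroupoid) (hΓH : ΓH.IsTopologicalGroupoid)

include hX

theorem brG_spec {z w : Z} (hzw : X.s z = X.s w) :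
    ΓG.s (X.brG ΓG z w) = X.r w ∧ X.lact (X.brG ΓG z w) w = z := by
  have hex := hX.orbit_s z w hzw
  unfold EquivalenceOps.brG
  rw [dif_pos hex]
  exact hex.choose_spec

theorem brH_spec {z w : Z} (hzw : X.r z = X.r w) :
    X.s z = ΓH.r (X.brH ΓH z w) ∧ X.ract z (X.brH ΓH z w) = w := by
  have hex := hX.orbit_r z w hzw
  unfold EquivalenceOps.brH
  rw [dif_pos hex]
  exact hex.choose_spec

theorem r_brG {z w : Z} (hzw : X.s z = X.s w) : ΓG.r (X.brG ΓG z w) = X.r z := by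
  obtain ⟨h1, h2⟩ := hX.brG_spec hzw
  rw [← hX.r_lact _ _ h1, h2]

theorem s_brH {z w : Z} (hzw : X.r z = X.r w) : ΓH.s (X.brH ΓH z w) = X.s w := by
  obtain ⟨h1, h2⟩ := hX.brH_spec hzw
  rw [← hX.s_ract _ _ h1, h2]

include hΓG in
theorem inv_lact_lact {g : G} {z : Z} (hg : ΓG.s g = X.r z) :
    X.lact (ΓG.inv g) (X.lact g z) = z := by
  rw [← hX.mul_lact _ _ _ (hΓG.s_inv g) hg, hΓG.inv_mul, hg, hX.unit_lact]

include hΓG in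
theorem lact_inv_lact {g : G} {z : Z} (hg : ΓG.r g = X.r z) :
    X.lact g (X.lact (ΓG.inv g) z) = z := by
  rw [← hX.mul_lact _ _ _ (hΓG.r_inv g).symm (by rw [hΓG.s_inv, hg]), hΓG.mul_inv, hg,
    hX.unit_lact]

include hΓH in
theorem ract_ract_inv {h : H} {z : Z} (hh : X.s z = ΓH.r h) :
    X.ract (X.ract z h) (ΓH.inv h) = z := by
  rw [← hX.mul_ract _ _ _ hh (hΓH.r_inv h).symm, hΓH.mul_inv, ← hh, hX.unit_ract]

include hΓG in
theorem lact_injective {g g' : G} {z : Z} (hg : ΓG.s g = X.r z) (hg' : ΓG.s g' = X.r z)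
    (heq : X.lact g z = X.lact g' z) : g = g' := by
  have hr : ΓG.r g = ΓG.r g' := by rw [← hX.r_lact g z hg, heq, hX.r_lact g' z hg']
  have hc : ΓG.s (ΓG.inv g) = ΓG.r g' := by rw [hΓG.s_inv, hr]
  refine hΓG.eq_of_inv_mul_mem_units hr (hX.free_lact _ z ?_ ?_)
  · rw [hΓG.s_mul _ _ hc, hg']
  · rw [hX.mul_lact _ _ _ hc hg', ← heq, hX.inv_lact_lact hΓG hg]

include hΓH in
theorem ract_injective {h h' : H} {z : Z} (hh : X.s z = ΓH.r h) (hh' : X.s z = ΓH.r h')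
    (heq : X.ract z h = X.ract z h') : h = h' := by
  have hs : ΓH.s h = ΓH.s h' := by rw [← hX.s_ract z h hh, heq, hX.s_ract z h' hh']
  have hc : ΓH.s h' = ΓH.r (ΓH.inv h) := by rw [hΓH.r_inv, hs]
  -- `h' h⁻¹` fixes `z`, hence it is a unit, and so `h' = h`
  have hu : ΓH.mul h' (ΓH.inv h) ∈ ΓH.units := by
    refine hX.free_ract z _ (by rw [hΓH.r_mul _ _ hc, hh']) ?_
    rw [hX.mul_ract _ _ _ hh' hc, ← heq, hX.ract_ract_inv hΓH hh]
  have h1 : ΓH.r (ΓH.mul h' (ΓH.inv h)) = ΓH.mul h' (ΓH.inv h) := hu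
  rw [hΓH.r_mul _ _ hc] at h1
  have h2 : ΓH.mul (ΓH.mul h' (ΓH.inv h)) h = h' := by
    rw [hΓH.mul_assoc _ _ _ hc (hΓH.s_inv h |>.trans rfl), hΓH.inv_mul, hs, hΓH.mul_s_self]
  rw [← h2, ← h1, ← hh', hh, hΓH.r_mul_self]

include hΓG in
theorem brG_lact {g : G} {z : Z} (hg : ΓG.s g = X.r z) : X.brG ΓG (X.lact g z) z = g := by
  obtain ⟨h1, h2⟩ := hX.brG_spec (hX.s_lact g z hg)
  exact hX.lact_injective hΓG h1 hg h2

include hΓH in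
theorem brH_ract {h : H} {z : Z} (hh : X.s z = ΓH.r h) : X.brH ΓH z (X.ract z h) = h := by
  obtain ⟨h1, h2⟩ := hX.brH_spec (hX.r_ract z h hh).symm
  exact hX.ract_injective hΓH h1 hh h2

include hΓG in
theorem continuousOn_brG :
    ContinuousOn (fun p : Z × Z => X.brG ΓG p.1 p.2) {p | X.s p.1 = X.s p.2} := by
  have hcl : IsClosedEmbedding (fun p : {p : G × Z // ΓG.s p.1 = X.r p.2} =>
      (X.lact p.1.1 p.1.2, p.1.2)) := by
    refine .of_continuous_injective_isClosedMap hX.proper_lact.continuous ?_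
      hX.proper_lact.isClosedMap
    rintro ⟨⟨g, z⟩, hg⟩ ⟨⟨g', z'⟩, hg'⟩ heq
    simp only [Prod.mk.injEq] at heq hg hg'
    obtain ⟨h1, rfl⟩ := heq
    rw [Subtype.mk.injEq, hX.lact_injective hΓG hg hg' h1]
  let κ : {p : Z × Z | X.s p.1 = X.s p.2} → {p : G × Z // ΓG.s p.1 = X.r p.2} := fun p =>
    ⟨(X.brG ΓG p.1.1 p.1.2, p.1.2), (hX.brG_spec p.2).1⟩
  have hκ : Continuous κ := by
    rw [hcl.isInducing.continuous_iff]
    refine continuous_subtype_val.congr fun p => ?_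
    simp [κ, (hX.brG_spec (ΓG := ΓG) p.2).2]
  rw [continuousOn_iff_continuous_domRestrict]
  exact continuous_fst.comp (continuous_subtype_val.comp hκ)

include hΓH in
theorem continuousOn_brH :
    ContinuousOn (fun p : Z × Z => X.brH ΓH p.1 p.2) {p | X.r p.1 = X.r p.2} := by
  have hcl : IsClosedEmbedding (fun p : {p : Z × H // X.s p.1 = ΓH.r p.2} =>
      (X.ract p.1.1 p.1.2, p.1.1)) := by
    refine .of_continuous_injective_isClosedMap hX.proper_ract.continuous ?_
      hX.proper_ract.isClosedMap
    rintro ⟨⟨z, h⟩, hh⟩ ⟨⟨z', h'⟩, hh'⟩ heq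
    simp only [Prod.mk.injEq] at heq hh hh'
    obtain ⟨h1, rfl⟩ := heq
    rw [Subtype.mk.injEq, hX.ract_injective hΓH hh hh' h1]
  let κ : {p : Z × Z | X.r p.1 = X.r p.2} → {p : Z × H // X.s p.1 = ΓH.r p.2} := fun p =>
    ⟨(p.1.1, X.brH ΓH p.1.1 p.1.2), (hX.brH_spec p.2).1⟩
  have hκ : Continuous κ := by
    rw [hcl.isInducing.continuous_iff]
    refine (continuous_swap.comp continuous_subtype_val).congr fun p => ?_
    simp [κ, (hX.brH_spec (ΓH := ΓH) p.2).2, Prod.swap]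
  rw [continuousOn_iff_continuous_domRestrict]
  exact continuous_snd.comp (continuous_subtype_val.comp hκ)

/-! ### The linking groupoid -/

section LinkGroupoid

include hΓG hΓH

theorem link_r_r (x : Link G Z H) :
    (X.link ΓG ΓH).r ((X.link ΓG ΓH).r x) = (X.link ΓG ΓH).r x := by
  cases x with
  | ofG g => exact congrArg Link.ofG (hΓG.r_r g)
  | ofZ z => exact congrArg Link.ofG (hX.r_mem z)
  | zop z => exact congrArg Link.ofH (hX.s_mem z)
  | ofH h => exact congrArg Link.ofH (hΓH.r_r h)

theorem link_r_inv (x : Link G Z H) : (X.link ΓG ΓH).r ((X.link ΓG ΓH).inv x) =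
    (X.link ΓG ΓH).s x := by
  cases x with
  | ofG g => exact congrArg Link.ofG (hΓG.r_inv g)
  | ofZ z => rfl
  | zop z => rfl
  | ofH h => exact congrArg Link.ofH (hΓH.r_inv h)

theorem link_s_inv (x : Link G Z H) : (X.link ΓG ΓH).s ((X.link ΓG ΓH).inv x) =
    (X.link ΓG ΓH).r x := by
  cases x with
  | ofG g => exact congrArg Link.ofG (hΓG.s_inv g)
  | ofZ z => rfl
  | zop z => rfl
  | ofH h => exact congrArg Link.ofH (hΓH.s_inv h)

theorem link_inv_inv (x : Link G Z H) :
    (X.link ΓG ΓH).inv ((X.link ΓG ΓH).inv x) = x := by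
  cases x with
  | ofG g => exact congrArg Link.ofG (hΓG.inv_inv g)
  | ofZ z => rfl
  | zop z => rfl
  | ofH h => exact congrArg Link.ofH (hΓH.inv_inv h)

theorem link_r_mul (x y : Link G Z H) (hxy : (X.link ΓG ΓH).s x = (X.link ΓG ΓH).r y) :
    (X.link ΓG ΓH).r ((X.link ΓG ΓH).mul x y) = (X.link ΓG ΓH).r x := by
  cases x <;> cases y <;> simp only [EquivalenceOps.link, reduceCtorEq, Link.ofG.injEq,
    Link.ofH.injEq] at hxy ⊢
  · exact hΓG.r_mul _ _ hxy
  · exact hX.r_lact _ _ hxy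
  · exact hX.r_brG hxy
  · exact hX.r_ract _ _ hxy
  · exact hX.s_lact _ _ (by rw [hΓG.s_inv, hxy])
  · exact (hX.brH_spec hxy).1.symm
  · rw [hX.s_ract _ _ (by rw [hΓH.r_inv, hxy]), hΓH.s_inv]
  · exact hΓH.r_mul _ _ hxy

theorem link_inv_mul_cancel_left (x y : Link G Z H)
    (hxy : (X.link ΓG ΓH).s x = (X.link ΓG ΓH).r y) :
    (X.link ΓG ΓH).mul ((X.link ΓG ΓH).inv x) ((X.link ΓG ΓH).mul x y) = y := by
  cases x <;> cases y <;> simp only [EquivalenceOps.link, reduceCtorEq, Link.ofG.injEq,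
    Link.ofH.injEq, Link.ofZ.injEq, Link.zop.injEq] at hxy ⊢
  · exact hΓG.inv_mul_cancel_left hxy
  · exact hX.inv_lact_lact hΓG hxy
  · rename_i z w
    obtain ⟨h1, h2⟩ := hX.brG_spec (ΓG := ΓG) hxy
    conv_lhs => rw [← h2]
    rw [h2]
    conv_lhs => enter [3]; rw [← h2]
    exact hX.inv_lact_lact hΓG h1
  · exact hX.brH_ract hΓH hxy
  · rename_i z g
    have hg : ΓG.s (ΓG.inv g) = X.r z := by rw [hΓG.s_inv, hxy]
    have h1 := hX.brG_lact (ΓG := ΓG) hΓG (z := X.lact (ΓG.inv g) z) (g := g)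
      (by rw [hX.r_lact _ _ hg, hΓG.r_inv])
    rwa [hX.lact_inv_lact hΓG hxy.symm] at h1
  · exact (hX.brH_spec hxy).2
  · rename_i h z
    exact hX.ract_ract_inv hΓH (by rw [hΓH.r_inv, hxy])
  · exact hΓH.inv_mul_cancel_left hxy

theorem continuous_link_r : Continuous (X.link ΓG ΓH).r :=
  Link.continuous_iff.2 ⟨Link.isOpenEmbedding_ofG.continuous.comp hΓG.continuous_r,
    Link.isOpenEmbedding_ofG.continuous.comp hX.continuous_r,
    Link.isOpenEmbedding_ofH.continuous.comp hX.continuous_s,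
    Link.isOpenEmbedding_ofH.continuous.comp hΓH.continuous_r⟩

theorem continuous_link_inv : Continuous (X.link ΓG ΓH).inv :=
  Link.continuous_iff.2 ⟨Link.isOpenEmbedding_ofG.continuous.comp hΓG.continuous_inv,
    Link.isOpenEmbedding_zop.continuous, Link.isOpenEmbedding_ofZ.continuous,
    Link.isOpenEmbedding_ofH.continuous.comp hΓH.continuous_inv⟩

theorem continuousOn_link_mul :
    ContinuousOn (fun p : Link G Z H × Link G Z H => (X.link ΓG ΓH).mul p.1 p.2)
      {p | (X.link ΓG ΓH).s p.1 = (X.link ΓG ΓH).r p.2} := by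
  rintro ⟨x, y⟩ hxy
  cases x <;> cases y <;> simp only [Set.mem_ofPred_eq, EquivalenceOps.link, reduceCtorEq,
    Link.ofG.injEq, Link.ofH.injEq] at hxy
  · rw [Link.isOpenEmbedding_ofG.continuousWithinAt_prodMap Link.isOpenEmbedding_ofG]
    simp only [EquivalenceOps.link, Set.mem_ofPred_eq, Link.ofG.injEq]
    exact (Link.isOpenEmbedding_ofG.continuous.tendsto _).comp (hΓG.continuousOn_mul _ hxy)
  · rw [Link.isOpenEmbedding_ofG.continuousWithinAt_prodMap Link.isOpenEmbedding_ofZ]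
    simp only [EquivalenceOps.link, Set.mem_ofPred_eq, Link.ofG.injEq]
    exact (Link.isOpenEmbedding_ofZ.continuous.tendsto _).comp (hX.continuousOn_lact _ hxy)
  · rw [Link.isOpenEmbedding_ofZ.continuousWithinAt_prodMap Link.isOpenEmbedding_zop]
    simp only [EquivalenceOps.link, Set.mem_ofPred_eq, Link.ofH.injEq]
    exact (Link.isOpenEmbedding_ofG.continuous.tendsto _).comp (hX.continuousOn_brG hΓG _ hxy)
  · rw [Link.isOpenEmbedding_ofZ.continuousWithinAt_prodMap Link.isOpenEmbedding_ofH]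
    simp only [EquivalenceOps.link, Set.mem_ofPred_eq, Link.ofH.injEq]
    exact (Link.isOpenEmbedding_ofZ.continuous.tendsto _).comp (hX.continuousOn_ract _ hxy)
  · rw [Link.isOpenEmbedding_zop.continuousWithinAt_prodMap Link.isOpenEmbedding_ofG]
    simp only [EquivalenceOps.link, Set.mem_ofPred_eq, Link.ofG.injEq]
    refine (Link.isOpenEmbedding_zop.continuous.tendsto _).comp ?_
    refine (hX.continuousOn_lact.comp (f := fun p : Z × G => (ΓG.inv p.2, p.1))
      ((hΓG.continuous_inv.comp continuous_snd).prodMk continuous_fst).continuousOn ?_) _ hxy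
    intro p hp
    simpa [hΓG.s_inv] using hp.symm
  · rw [Link.isOpenEmbedding_zop.continuousWithinAt_prodMap Link.isOpenEmbedding_ofZ]
    simp only [EquivalenceOps.link, Set.mem_ofPred_eq, Link.ofG.injEq]
    exact (Link.isOpenEmbedding_ofH.continuous.tendsto _).comp (hX.continuousOn_brH hΓH _ hxy)
  · rw [Link.isOpenEmbedding_ofH.continuousWithinAt_prodMap Link.isOpenEmbedding_zop]
    simp only [EquivalenceOps.link, Set.mem_ofPred_eq, Link.ofH.injEq]
    refine (Link.isOpenEmbedding_zop.continuous.tendsto _).comp ?_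
    refine (hX.continuousOn_ract.comp (f := fun p : H × Z => (p.2, ΓH.inv p.1))
      (continuous_snd.prodMk (hΓH.continuous_inv.comp continuous_fst)).continuousOn ?_) _ hxy
    intro p hp
    simpa [hΓH.r_inv] using hp.symm
  · rw [Link.isOpenEmbedding_ofH.continuousWithinAt_prodMap Link.isOpenEmbedding_ofH]
    simp only [EquivalenceOps.link, Set.mem_ofPred_eq, Link.ofH.injEq]
    exact (Link.isOpenEmbedding_ofH.continuous.tendsto _).comp (hΓH.continuousOn_mul _ hxy)

end LinkGroupoid

end EquivalenceOps.IsEquivalence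

/-! ### Measures on the orbits of a proper action -/

/-- The part of the structure of a proper right action of a groupoid `Y` on `Z` on which the orbit
measures `F ↦ ∫ F (z · y) dλ^{ρ z}(y)` depend: `ρ : Z → Y⁰` is the moment map, `act z y` is
meaningful if `ρ z = r y`, and the fibres of `τ` are the orbits. A left action is regarded as the
right action `(z, y) ↦ y⁻¹ · z`. -/
structure IsOrbitAction {Y Z T : Type*} [TopologicalSpace Y] [TopologicalSpace Z]
    (Γ : GroupoidOps Y) (ρ : Z → Y) (act : Z → Y → Z) (τ : Z → T) : Prop where
  ρ_mem : ∀ z, ρ z ∈ Γ.units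
  continuous_ρ : Continuous ρ
  continuousOn_act : ContinuousOn (fun p : Z × Y => act p.1 p.2) {p | ρ p.1 = Γ.r p.2}
  ρ_act : ∀ z y, ρ z = Γ.r y → ρ (act z y) = Γ.s y
  act_mul : ∀ z y y', ρ z = Γ.r y → Γ.s y = Γ.r y' → act z (Γ.mul y y') = act (act z y) y'
  τ_act : ∀ z y, ρ z = Γ.r y → τ (act z y) = τ z
  orbit : ∀ z w, τ z = τ w → ∃ y, ρ z = Γ.r y ∧ act z y = w
  proper : ∀ N K : Set Z, IsCompact N → IsCompact K → ∃ C : Set Y, IsCompact C ∧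
    ∀ z ∈ N, ∀ y, ρ z = Γ.r y → act z y ∈ K → y ∈ C

/-- The measure `F ↦ ∫ F (j (z · y)) dλ^{ρ z}(y)`. -/
def orbitMeasure {Y Z L : Type*} [MeasurableSpace Y] [MeasurableSpace L] (lam : Y → Measure Y)
    (ρ : Z → Y) (act : Z → Y → Z) (j : Z → L) (z : Z) : Measure L :=
  (lam (ρ z)).map fun y => j (act z y)

namespace IsOrbitAction

variable {Y Z T : Type u} [TopologicalSpace Y] [T2Space Y] [LocallyCompactSpace Y]
  [MeasurableSpace Y] [BorelSpace Y] [TopologicalSpace Z]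
  {Γ : GroupoidOps Y} {ρ : Z → Y} {act : Z → Y → Z} {τ : Z → T} {lam : Y → Measure Y}
  {L : Type u} [TopologicalSpace L] [MeasurableSpace L] [BorelSpace L] {j : Z → L}
  (ha : IsOrbitAction Γ ρ act τ) (hΓ : Γ.IsTopologicalGroupoid) (hlam : Γ.IsHaarSystem lam)

include ha hΓ

theorem isClosed_fibre (z : Z) : IsClosed {y | ρ z = Γ.r y} :=
  isClosed_eq continuous_const hΓ.continuous_r

theorem continuousOn_act_fibre (z : Z) : ContinuousOn (act z) {y | ρ z = Γ.r y} :=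
  ha.continuousOn_act.comp (Continuous.prodMk_right z).continuousOn fun _ hy => hy

include hlam

omit [T2Space Y] [LocallyCompactSpace Y] [BorelSpace Y] hΓ in
theorem ae_mem_fibre (z : Z) : ∀ᵐ y ∂(lam (ρ z)), ρ z = Γ.r y := by
  have := hlam.null_compl _ (ha.ρ_mem z)
  simpa [ae_iff, eq_comm] using this

theorem aemeasurable_act (hj : Continuous j) (z : Z) :
    AEMeasurable (fun y => j (act z y)) (lam (ρ z)) := by
  have h1 : AEMeasurable (fun y => j (act z y)) ((lam (ρ z)).restrict {y | ρ z = Γ.r y}) :=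
    (hj.comp_continuousOn (ha.continuousOn_act_fibre hΓ z)).aemeasurable
      (ha.isClosed_fibre hΓ z).measurableSet
  have h2 : (lam (ρ z)).restrict {y | ρ z = Γ.r y} = lam (ρ z) :=
    Measure.restrict_eq_self_of_ae_mem (ha.ae_mem_fibre hlam z)
  rwa [h2] at h1

theorem isFiniteMeasureOnCompacts_orbitMeasure [T2Space L] (hj : IsClosedEmbedding j) (z : Z) :
    IsFiniteMeasureOnCompacts (orbitMeasure lam ρ act j z) where
  lt_top_of_isCompact K hK := by
    obtain ⟨C, hC, hCK⟩ := ha.proper {z} (j ⁻¹' K) isCompact_singleton (hj.isCompact_preimage hK)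
    have := hlam.regular _ (ha.ρ_mem z)
    rw [orbitMeasure, Measure.map_apply_of_aemeasurable
      (ha.aemeasurable_act hΓ hlam hj.continuous z) hK.measurableSet]
    refine (measure_mono_ae ?_).trans_lt hC.measure_lt_top
    filter_upwards [ha.ae_mem_fibre hlam z] with y hy hyK
    exact hCK z rfl y hy hyK

theorem orbitMeasure_eq_zero (hj : Continuous j) (z : Z) {A : Set L} (hA : MeasurableSet A)
    (hzA : ∀ y, ρ z = Γ.r y → j (act z y) ∉ A) : orbitMeasure lam ρ act j z A = 0 := by
  rw [orbitMeasure, Measure.map_apply_of_aemeasurable (ha.aemeasurable_act hΓ hlam hj z) hA]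
  refine measure_eq_zero_iff_ae_notMem.2 ?_
  filter_upwards [ha.ae_mem_fibre hlam z] with y hy using hzA y hy

theorem orbitMeasure_pos (hj : Continuous j) (z w : Z) (hzw : τ z = τ w) {U : Set L}
    (hU : IsOpen U) (hwU : j w ∈ U) : 0 < orbitMeasure lam ρ act j z U := by
  obtain ⟨k, hk, rfl⟩ := ha.orbit z w hzw
  rw [orbitMeasure, Measure.map_apply_of_aemeasurable (ha.aemeasurable_act hΓ hlam hj z)
    hU.measurableSet]
  obtain ⟨V, hV, hVU⟩ := (continuousOn_iff'.1
    (hj.comp_continuousOn (ha.continuousOn_act_fibre hΓ z))) U hU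
  have hmem : ∀ y, ρ z = Γ.r y → (y ∈ V ↔ j (act z y) ∈ U) := fun y hy => by
    have := Set.ext_iff.1 hVU y
    simp only [Set.mem_inter_iff, Set.mem_preimage, Set.mem_ofPred_eq, hy, and_true] at this
    exact this.symm
  refine (hlam.pos_of_mem _ (ha.ρ_mem z) V hV ⟨k, (hmem k hk).2 hwU, hk.symm⟩).trans_le
    (measure_mono_ae ?_)
  filter_upwards [ha.ae_mem_fibre hlam z] with y hy hyV using (hmem y hy).1 hyV

/-- Left invariance of the Haar system: the orbit measure depends only on the orbit. -/
theorem integral_act_eq [NormalSpace Y] {z w : Z} (hzw : τ z = τ w) {F : Z → ℝ}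
    (hF : Continuous F) (hFc : HasCompactSupport F) :
    ∫ y, F (act z y) ∂(lam (ρ z)) = ∫ y, F (act w y) ∂(lam (ρ w)) := by
  obtain ⟨k, hk, rfl⟩ := ha.orbit z w hzw
  obtain ⟨C, hC, hCK⟩ := ha.proper {z} (tsupport F) isCompact_singleton hFc
  obtain ⟨O, -, hCO, -, χ, hχc, -, -, hχ1⟩ := exists_open_bump hC isOpen_univ (Set.subset_univ C)
  -- extend `y ↦ F (z · y)` from the fibre to a compactly supported function on `Y`
  obtain ⟨g, hg⟩ := ContinuousMap.exists_restrict_eq (ha.isClosed_fibre hΓ z)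
    ⟨_, (hF.comp_continuousOn (ha.continuousOn_act_fibre hΓ z)).domRestrict⟩
  have hgy : ∀ y, ρ z = Γ.r y → χ y * g y = F (act z y) := fun y hy => by
    have h1 : g y = F (act z y) := congrArg (fun f => f ⟨y, hy⟩) hg
    rw [h1]
    by_cases h0 : act z y ∈ tsupport F
    · rw [hχ1 y (hCO (hCK z rfl y hy h0)), one_mul]
    · rw [image_eq_zero_of_notMem_tsupport h0, mul_zero]
  have hinv := hlam.left_invariant (fun y => χ y * g y) (χ.continuous.mul g.continuous)
    hχc.mul_right k
  rw [← hk, ← ha.ρ_act z k hk] at hinv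
  calc ∫ y, F (act z y) ∂(lam (ρ z)) = ∫ y, χ y * g y ∂(lam (ρ z)) := by
        refine integral_congr_ae ?_
        filter_upwards [ha.ae_mem_fibre hlam z] with y hy using (hgy y hy).symm
    _ = ∫ y, χ (Γ.mul k y) * g (Γ.mul k y) ∂(lam (ρ (act z k))) := hinv.symm
    _ = _ := by
        refine integral_congr_ae ?_
        filter_upwards [ha.ae_mem_fibre hlam (act z k)] with y hy
        rw [ha.ρ_act z k hk] at hy
        rw [hgy _ (by rw [hΓ.r_mul _ _ hy, hk]), ha.act_mul z k y hk hy]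

theorem continuous_integral_act [LocallyCompactSpace Z] [T2Space Z] {F : Z → ℝ}
    (hF : Continuous F) (hFc : HasCompactSupport F) :
    Continuous fun z => ∫ y, F (act z y) ∂(lam (ρ z)) := by
  refine continuous_iff_continuousAt.2 fun z₀ => ?_
  obtain ⟨N, hN, hNz⟩ := exists_compact_mem_nhds z₀
  obtain ⟨C, hC, hCK⟩ := ha.proper N (tsupport F) hN hFc
  refine continuousAt_integral_scalar (lam := fun z => lam (ρ z)) (D := {p | ρ p.1 = Γ.r p.2})
    (F := fun z y => F (act z y))
    (isClosed_eq (ha.continuous_ρ.comp continuous_fst) (hΓ.continuous_r.comp continuous_snd))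
    (fun z => ?_) (fun z => ha.ae_mem_fibre hlam z) (fun φ hφ hφc => ?_)
    (hF.comp_continuousOn ha.continuousOn_act) hC ?_
  · have := hlam.regular _ (ha.ρ_mem z)
    infer_instance
  · exact (hlam.continuousOn φ hφ hφc).comp_continuous ha.continuous_ρ ha.ρ_mem
  · filter_upwards [hNz] with z hz y hy hyC
    exact image_eq_zero_of_notMem_tsupport fun h0 => hyC (hCK z hz y hy h0)

theorem integral_orbitMeasure (hj : Continuous j) (z : Z) {F : L → ℝ} (hF : Continuous F) :
    ∫ x, F x ∂(orbitMeasure lam ρ act j z) = ∫ y, F (j (act z y)) ∂(lam (ρ z)) :=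
  integral_map (ha.aemeasurable_act hΓ hlam hj z) hF.stronglyMeasurable.aestronglyMeasurable

end IsOrbitAction

namespace EquivalenceOps.IsEquivalence

variable {G H Z : Type u} [TopologicalSpace G] [TopologicalSpace H] [TopologicalSpace Z]
  {X : EquivalenceOps G H Z} {ΓG : GroupoidOps G} {ΓH : GroupoidOps H}
  (hX : X.IsEquivalence ΓG ΓH) (hΓG : ΓG.IsTopologicalGroupoid) (hΓH : ΓH.IsTopologicalGroupoid)

include hX

theorem isOrbitAction_ract : IsOrbitAction ΓH X.s X.ract X.r where
  ρ_mem := hX.s_mem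
  continuous_ρ := hX.continuous_s
  continuousOn_act := hX.continuousOn_ract
  ρ_act := hX.s_ract
  act_mul := hX.mul_ract
  τ_act := hX.r_ract
  orbit := hX.orbit_r
  proper N K hN hK := by
    refine ⟨_, (hX.proper_ract.isCompact_preimage (hK.prod hN)).image
      (continuous_snd.comp continuous_subtype_val), fun z hz y hy hyK => ?_⟩
    exact ⟨⟨(z, y), hy⟩, ⟨hyK, hz⟩, rfl⟩

include hΓG in
theorem isOrbitAction_lact :
    IsOrbitAction ΓG X.r (fun z g => X.lact (ΓG.inv g) z) X.s where
  ρ_mem := hX.r_mem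
  continuous_ρ := hX.continuous_r
  continuousOn_act := by
    refine hX.continuousOn_lact.comp (f := fun p : Z × G => (ΓG.inv p.2, p.1))
      ((hΓG.continuous_inv.comp continuous_snd).prodMk continuous_fst).continuousOn fun p hp => ?_
    simpa [hΓG.s_inv] using hp.symm
  ρ_act z g hg := by rw [hX.r_lact _ _ (by rw [hΓG.s_inv, hg]), hΓG.r_inv]
  act_mul z g g' hg hgg' := by
    have hr : ΓG.r (ΓG.mul g g') = X.r z := by rw [hΓG.r_mul _ _ hgg', hg]
    have hs : X.r (X.lact (ΓG.inv (ΓG.mul g g')) z) = ΓG.s g' := by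
      rw [hX.r_lact _ _ (by rw [hΓG.s_inv, hr]), hΓG.r_inv, hΓG.s_mul _ _ hgg']
    -- both sides are the `w` with `g g' w = z`
    have h1 := hX.lact_inv_lact hΓG hr
    rw [hX.mul_lact _ _ _ hgg' hs.symm] at h1
    have h2 : X.lact (ΓG.inv g) z = X.lact g' (X.lact (ΓG.inv (ΓG.mul g g')) z) := by
      conv_lhs => rw [← h1]
      rw [hX.inv_lact_lact hΓG]
      rw [hX.r_lact _ _ hs.symm, hgg']
    change _ = X.lact (ΓG.inv g') (X.lact (ΓG.inv g) z)
    rw [h2, hX.inv_lact_lact hΓG hs.symm]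
  τ_act z g hg := hX.s_lact _ _ (by rw [hΓG.s_inv, hg])
  orbit z w hzw := by
    obtain ⟨g, hg, hgw⟩ := hX.orbit_s z w hzw
    refine ⟨g, by rw [← hgw, hX.r_lact _ _ hg], ?_⟩
    rw [← hgw]
    exact hX.inv_lact_lact hΓG hg
  proper N K hN hK := by
    refine ⟨_, ((hX.proper_lact.isCompact_preimage (hK.prod hN)).image
      (continuous_fst.comp continuous_subtype_val)).image hΓG.continuous_inv,
      fun z hz g hg hgK => ⟨ΓG.inv g, ?_, hΓG.inv_inv g⟩⟩
    exact ⟨⟨(ΓG.inv g, z), (hΓG.s_inv g).trans hg.symm⟩, ⟨hgK, hz⟩, rfl⟩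

end EquivalenceOps.IsEquivalence

/-! ### The Haar system of the linking groupoid -/

namespace Link

variable {G Z H : Type u} [TopologicalSpace G] [TopologicalSpace Z] [TopologicalSpace H]

theorem isClosedEmbedding_ofG : IsClosedEmbedding (ofG : G → Link G Z H) := by
  refine ⟨isOpenEmbedding_ofG.isEmbedding, ⟨?_⟩⟩
  rw [isOpen_iff]
  simp [Set.preimage]

theorem isClosedEmbedding_ofZ : IsClosedEmbedding (ofZ : Z → Link G Z H) := by
  refine ⟨isOpenEmbedding_ofZ.isEmbedding, ⟨?_⟩⟩
  rw [isOpen_iff]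
  simp [Set.preimage]

theorem isClosedEmbedding_zop : IsClosedEmbedding (zop : Z → Link G Z H) := by
  refine ⟨isOpenEmbedding_zop.isEmbedding, ⟨?_⟩⟩
  rw [isOpen_iff]
  simp [Set.preimage]

theorem isClosedEmbedding_ofH : IsClosedEmbedding (ofH : H → Link G Z H) := by
  refine ⟨isOpenEmbedding_ofH.isEmbedding, ⟨?_⟩⟩
  rw [isOpen_iff]
  simp [Set.preimage]

end Link

theorem isFiniteMeasureOnCompacts_map {Y L : Type*} [TopologicalSpace Y] [MeasurableSpace Y]
    [BorelSpace Y] [TopologicalSpace L] [T2Space L] [MeasurableSpace L] [BorelSpace L] {j : Y → L}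
    (hj : IsClosedEmbedding j) (μ : Measure Y) [IsFiniteMeasureOnCompacts μ] :
    IsFiniteMeasureOnCompacts (μ.map j) where
  lt_top_of_isCompact K hK := by
    rw [Measure.map_apply hj.continuous.measurable hK.measurableSet]
    exact (hj.isCompact_preimage hK).measure_lt_top

theorem isFiniteMeasureOnCompacts_add {L : Type*} [TopologicalSpace L] [MeasurableSpace L]
    (μ ν : Measure L) [hμ : IsFiniteMeasureOnCompacts μ] [hν : IsFiniteMeasureOnCompacts ν] :
    IsFiniteMeasureOnCompacts (μ + ν) where
  lt_top_of_isCompact K hK := by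
    rw [Measure.add_apply]
    exact ENNReal.add_lt_top.2 ⟨hK.measure_lt_top, hK.measure_lt_top⟩

namespace EquivalenceOps.IsEquivalence

variable {G H Z : Type u} [TopologicalSpace G] [T2Space G] [LocallyCompactSpace G]
  [SecondCountableTopology G] [MeasurableSpace G] [BorelSpace G]
  [TopologicalSpace H] [T2Space H] [LocallyCompactSpace H]
  [SecondCountableTopology H] [MeasurableSpace H] [BorelSpace H]
  [TopologicalSpace Z] [T2Space Z] [LocallyCompactSpace Z]
  {X : EquivalenceOps G H Z} {ΓG : GroupoidOps G} {ΓH : GroupoidOps H}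
  (hX : X.IsEquivalence ΓG ΓH) (hΓG : ΓG.IsTopologicalGroupoid) (hΓH : ΓH.IsTopologicalGroupoid)
  {lamG : G → Measure G} {lamH : H → Measure H}
  (hlamG : ΓG.IsHaarSystem lamG) (hlamH : ΓH.IsHaarSystem lamH)

include hX

omit [T2Space G] [LocallyCompactSpace G] [SecondCountableTopology G] [BorelSpace G]
  [T2Space H] [LocallyCompactSpace H] [SecondCountableTopology H] [BorelSpace H]
  [T2Space Z] [LocallyCompactSpace Z] in
theorem exists_linkHaar_ofG {w : G} (hw : w ∈ ΓG.units) : ∃ z, X.r z = w ∧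
    X.linkHaar ΓG lamG lamH (.ofG w) =
      (lamG w).map Link.ofG + orbitMeasure lamH X.s X.ract Link.ofZ z := by
  have hex := hX.surj_r w hw
  refine ⟨hex.choose, hex.choose_spec, ?_⟩
  simp only [EquivalenceOps.linkHaar]
  rw [dif_pos hex]
  rfl

omit [T2Space G] [LocallyCompactSpace G] [SecondCountableTopology G] [BorelSpace G]
  [T2Space H] [LocallyCompactSpace H] [SecondCountableTopology H] [BorelSpace H]
  [T2Space Z] [LocallyCompactSpace Z] in
theorem exists_linkHaar_ofH {w : H} (hw : w ∈ ΓH.units) : ∃ z, X.s z = w ∧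
    X.linkHaar ΓG lamG lamH (.ofH w) =
      orbitMeasure lamG X.r (fun z g => X.lact (ΓG.inv g) z) Link.zop z +
        (lamH w).map Link.ofH := by
  have hex := hX.surj_s w hw
  refine ⟨hex.choose, hex.choose_spec, ?_⟩
  simp only [EquivalenceOps.linkHaar]
  rw [dif_pos hex]
  rfl

omit hX [T2Space G] [LocallyCompactSpace G] [SecondCountableTopology G] [MeasurableSpace G]
  [BorelSpace G] [T2Space H] [LocallyCompactSpace H] [SecondCountableTopology H]
  [MeasurableSpace H] [BorelSpace H] [T2Space Z] [LocallyCompactSpace Z] in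
theorem link_units_cases {u : Link G Z H} (hu : u ∈ (X.link ΓG ΓH).units) :
    (∃ w ∈ ΓG.units, u = .ofG w) ∨ ∃ w ∈ ΓH.units, u = .ofH w := by
  have hu' : (X.link ΓG ΓH).r u = u := hu
  cases u with
  | ofG g => exact .inl ⟨g, Link.ofG.inj hu', rfl⟩
  | ofZ z => simp [EquivalenceOps.link] at hu'
  | zop z => simp [EquivalenceOps.link] at hu'
  | ofH h => exact .inr ⟨h, Link.ofH.inj hu', rfl⟩

include hΓG hΓH hlamG hlamH

theorem isFiniteMeasureOnCompacts_linkHaar {u : Link G Z H} (hu : u ∈ (X.link ΓG ΓH).units) :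
    IsFiniteMeasureOnCompacts (X.linkHaar ΓG lamG lamH u) := by
  rcases link_units_cases hu with ⟨w, hw, rfl⟩ | ⟨w, hw, rfl⟩
  · obtain ⟨z, -, hz⟩ := hX.exists_linkHaar_ofG (lamG := lamG) (lamH := lamH) hw
    rw [hz]
    have := hlamG.regular w hw
    have := isFiniteMeasureOnCompacts_map
      (Link.isClosedEmbedding_ofG (G := G) (Z := Z) (H := H)) (lamG w)
    have := hX.isOrbitAction_ract.isFiniteMeasureOnCompacts_orbitMeasure hΓH hlamH
      (Link.isClosedEmbedding_ofZ (G := G) (Z := Z) (H := H)) z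
    exact isFiniteMeasureOnCompacts_add _ _
  · obtain ⟨z, -, hz⟩ := hX.exists_linkHaar_ofH (ΓG := ΓG) (lamG := lamG) (lamH := lamH) hw
    rw [hz]
    have := hlamH.regular w hw
    have := isFiniteMeasureOnCompacts_map
      (Link.isClosedEmbedding_ofH (G := G) (Z := Z) (H := H)) (lamH w)
    have := (hX.isOrbitAction_lact hΓG).isFiniteMeasureOnCompacts_orbitMeasure hΓG hlamG
      (Link.isClosedEmbedding_zop (G := G) (Z := Z) (H := H)) z
    exact isFiniteMeasureOnCompacts_add _ _

theorem linkHaar_null_compl {u : Link G Z H} (hu : u ∈ (X.link ΓG ΓH).units) :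
    X.linkHaar ΓG lamG lamH u {x | (X.link ΓG ΓH).r x ≠ u} = 0 := by
  have hmeas : MeasurableSet {x | (X.link ΓG ΓH).r x ≠ u} :=
    (isClosed_eq (hX.continuous_link_r hΓG hΓH) continuous_const).isOpen_compl.measurableSet
  rcases link_units_cases hu with ⟨w, hw, rfl⟩ | ⟨w, hw, rfl⟩
  · obtain ⟨z, hzw, hz⟩ := hX.exists_linkHaar_ofG (lamG := lamG) (lamH := lamH) hw
    rw [hz, Measure.add_apply, Measure.map_apply
      Link.isOpenEmbedding_ofG.continuous.measurable hmeas, add_eq_zero]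
    constructor
    · simpa [EquivalenceOps.link] using hlamG.null_compl w hw
    · refine hX.isOrbitAction_ract.orbitMeasure_eq_zero hΓH hlamH
        Link.isOpenEmbedding_ofZ.continuous z hmeas fun y hy => ?_
      simp [EquivalenceOps.link, hX.r_ract z y hy, hzw]
  · obtain ⟨z, hzw, hz⟩ := hX.exists_linkHaar_ofH (ΓG := ΓG) (lamG := lamG) (lamH := lamH) hw
    rw [hz, Measure.add_apply, Measure.map_apply
      Link.isOpenEmbedding_ofH.continuous.measurable hmeas, add_eq_zero]
    constructor
    · refine (hX.isOrbitAction_lact hΓG).orbitMeasure_eq_zero hΓG hlamG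
        Link.isOpenEmbedding_zop.continuous z hmeas fun y hy => ?_
      simp [EquivalenceOps.link, (hX.isOrbitAction_lact hΓG).τ_act z y hy, hzw]
    · simpa [EquivalenceOps.link] using hlamH.null_compl w hw

theorem linkHaar_pos {u : Link G Z H} (hu : u ∈ (X.link ΓG ΓH).units) {U : Set (Link G Z H)}
    (hU : IsOpen U) (hex : ∃ x ∈ U, (X.link ΓG ΓH).r x = u) :
    0 < X.linkHaar ΓG lamG lamH u U := by
  obtain ⟨x, hx, hxu⟩ := hex
  rcases link_units_cases hu with ⟨w, hw, rfl⟩ | ⟨w, hw, rfl⟩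
  · obtain ⟨z, hzw, hz⟩ := hX.exists_linkHaar_ofG (lamG := lamG) (lamH := lamH) hw
    rw [hz, Measure.add_apply]
    cases x with
    | ofG g =>
      refine lt_of_lt_of_le ?_ le_self_add
      rw [Measure.map_apply Link.isOpenEmbedding_ofG.continuous.measurable hU.measurableSet]
      exact hlamG.pos_of_mem w hw _ (hU.preimage Link.isOpenEmbedding_ofG.continuous)
        ⟨g, hx, by simpa [EquivalenceOps.link] using hxu⟩
    | ofZ z' =>
      refine lt_of_lt_of_le ?_ le_add_self
      exact hX.isOrbitAction_ract.orbitMeasure_pos hΓH hlamH Link.isOpenEmbedding_ofZ.continuous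
        z z' (hzw.trans (by simpa [EquivalenceOps.link] using hxu.symm)) hU hx
    | zop z' => simp [EquivalenceOps.link] at hxu
    | ofH h => simp [EquivalenceOps.link] at hxu
  · obtain ⟨z, hzw, hz⟩ := hX.exists_linkHaar_ofH (ΓG := ΓG) (lamG := lamG) (lamH := lamH) hw
    rw [hz, Measure.add_apply]
    cases x with
    | ofG g => simp [EquivalenceOps.link] at hxu
    | ofZ z' => simp [EquivalenceOps.link] at hxu
    | zop z' =>
      refine lt_of_lt_of_le ?_ le_self_add
      exact (hX.isOrbitAction_lact hΓG).orbitMeasure_pos hΓG hlamG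
        Link.isOpenEmbedding_zop.continuous
        z z' (hzw.trans (by simpa [EquivalenceOps.link] using hxu.symm)) hU hx
    | ofH h =>
      refine lt_of_lt_of_le ?_ le_add_self
      rw [Measure.map_apply Link.isOpenEmbedding_ofH.continuous.measurable hU.measurableSet]
      exact hlamH.pos_of_mem w hw _ (hU.preimage Link.isOpenEmbedding_ofH.continuous)
        ⟨h, hx, by simpa [EquivalenceOps.link] using hxu⟩

theorem continuousOn_linkHaar_ofG {F : Link G Z H → ℝ} (hF : Continuous F)
    (hFc : HasCompactSupport F) :
    ContinuousOn (fun w => ∫ x, F x ∂(X.linkHaar ΓG lamG lamH (.ofG w))) ΓG.units := by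
  have hjG := Link.isClosedEmbedding_ofG (G := G) (Z := Z) (H := H)
  have hjZ := Link.isClosedEmbedding_ofZ (G := G) (Z := Z) (H := H)
  have hΦ := hX.isOrbitAction_ract.continuous_integral_act hΓH hlamH (hF.comp hjZ.continuous)
    (hFc.comp_isClosedEmbedding hjZ)
  have hG := hlamG.continuousOn _ (hF.comp hjG.continuous) (hFc.comp_isClosedEmbedding hjG)
  have hq : IsQuotientMap (fun z => (⟨X.r z, hX.r_mem z⟩ : ΓG.units)) :=
    hX.isOpenMap_r.isQuotientMap (hX.continuous_r.subtype_mk _) fun ⟨w, hw⟩ => by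
      obtain ⟨z, hz⟩ := hX.surj_r w hw
      exact ⟨z, Subtype.ext hz⟩
  have heq : ∀ z, ∫ x, F x ∂(X.linkHaar ΓG lamG lamH (.ofG (X.r z))) =
      ∫ x, F (.ofG x) ∂(lamG (X.r z)) + ∫ y, F (.ofZ (X.ract z y)) ∂(lamH (X.s z)) := fun z => by
    obtain ⟨z', hz', hzz⟩ := hX.exists_linkHaar_ofG (lamG := lamG) (lamH := lamH) (hX.r_mem z)
    have := hlamG.regular _ (hX.r_mem z)
    have := isFiniteMeasureOnCompacts_map
      (Link.isClosedEmbedding_ofG (G := G) (Z := Z) (H := H))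
      (lamG (X.r z))
    have := hX.isOrbitAction_ract.isFiniteMeasureOnCompacts_orbitMeasure hΓH hlamH
      (Link.isClosedEmbedding_ofZ (G := G) (Z := Z) (H := H)) z'
    rw [hzz, integral_add_measure (hF.integrable_of_hasCompactSupport hFc)
      (hF.integrable_of_hasCompactSupport hFc), integral_map hjG.continuous.measurable.aemeasurable
      hF.stronglyMeasurable.aestronglyMeasurable,
      hX.isOrbitAction_ract.integral_orbitMeasure hΓH hlamH hjZ.continuous z' hF]
    exact congrArg _ (hX.isOrbitAction_ract.integral_act_eq hΓH hlamH hz'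
      (hF.comp hjZ.continuous) (hFc.comp_isClosedEmbedding hjZ))
  rw [continuousOn_iff_continuous_domRestrict, hq.continuous_iff]
  refine Continuous.congr ?_ fun z => (heq z).symm
  exact (hG.comp_continuous hX.continuous_r hX.r_mem).add hΦ

theorem continuousOn_linkHaar_ofH {F : Link G Z H → ℝ} (hF : Continuous F)
    (hFc : HasCompactSupport F) :
    ContinuousOn (fun w => ∫ x, F x ∂(X.linkHaar ΓG lamG lamH (.ofH w))) ΓH.units := by
  have hjH := Link.isClosedEmbedding_ofH (G := G) (Z := Z) (H := H)
  have hjZ := Link.isClosedEmbedding_zop (G := G) (Z := Z) (H := H)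
  have ha := hX.isOrbitAction_lact hΓG
  have hΦ := ha.continuous_integral_act hΓG hlamG (hF.comp hjZ.continuous)
    (hFc.comp_isClosedEmbedding hjZ)
  have hH := hlamH.continuousOn _ (hF.comp hjH.continuous) (hFc.comp_isClosedEmbedding hjH)
  have hq : IsQuotientMap (fun z => (⟨X.s z, hX.s_mem z⟩ : ΓH.units)) :=
    hX.isOpenMap_s.isQuotientMap (hX.continuous_s.subtype_mk _) fun ⟨w, hw⟩ => by
      obtain ⟨z, hz⟩ := hX.surj_s w hw
      exact ⟨z, Subtype.ext hz⟩
  have heq : ∀ z, ∫ x, F x ∂(X.linkHaar ΓG lamG lamH (.ofH (X.s z))) =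
      ∫ y, F (.zop (X.lact (ΓG.inv y) z)) ∂(lamG (X.r z)) +
        ∫ x, F (.ofH x) ∂(lamH (X.s z)) := fun z => by
    obtain ⟨z', hz', hzz⟩ :=
      hX.exists_linkHaar_ofH (ΓG := ΓG) (lamG := lamG) (lamH := lamH) (hX.s_mem z)
    have := hlamH.regular _ (hX.s_mem z)
    have := isFiniteMeasureOnCompacts_map
      (Link.isClosedEmbedding_ofH (G := G) (Z := Z) (H := H))
      (lamH (X.s z))
    have := ha.isFiniteMeasureOnCompacts_orbitMeasure hΓG hlamG
      (Link.isClosedEmbedding_zop (G := G) (Z := Z) (H := H)) z'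
    rw [hzz, integral_add_measure (hF.integrable_of_hasCompactSupport hFc)
      (hF.integrable_of_hasCompactSupport hFc),
      ha.integral_orbitMeasure hΓG hlamG hjZ.continuous z' hF,
      integral_map hjH.continuous.measurable.aemeasurable
      hF.stronglyMeasurable.aestronglyMeasurable]
    exact congrArg (· + _) (ha.integral_act_eq hΓG hlamG hz' (hF.comp hjZ.continuous)
      (hFc.comp_isClosedEmbedding hjZ))
  rw [continuousOn_iff_continuous_domRestrict, hq.continuous_iff]
  refine Continuous.congr ?_ fun z => (heq z).symm
  exact hΦ.add (hH.comp_continuous hX.continuous_s hX.s_mem)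

theorem continuousOn_linkHaar {F : Link G Z H → ℝ} (hF : Continuous F)
    (hFc : HasCompactSupport F) :
    ContinuousOn (fun u => ∫ x, F x ∂(X.linkHaar ΓG lamG lamH u)) (X.link ΓG ΓH).units := by
  intro u hu
  have key : ∀ {A : Type u} [TopologicalSpace A] {i : A → Link G Z H} {a : A} {D : Set A},
      IsOpenEmbedding i → i ⁻¹' (X.link ΓG ΓH).units ⊆ D →
      ContinuousWithinAt (fun w => ∫ x, F x ∂(X.linkHaar ΓG lamG lamH (i w))) D a →
      ContinuousWithinAt (fun u => ∫ x, F x ∂(X.linkHaar ΓG lamG lamH u))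
        (X.link ΓG ΓH).units (i a) := by
    intro A _ i a D hi hD hc
    unfold ContinuousWithinAt
    rw [← hi.map_nhdsWithin_preimage_eq, tendsto_map'_iff]
    exact hc.mono hD
  rcases link_units_cases hu with ⟨w, hw, rfl⟩ | ⟨w, hw, rfl⟩
  · refine key Link.isOpenEmbedding_ofG (fun g hg => ?_)
      (hX.continuousOn_linkHaar_ofG hΓG hΓH hlamG hlamH hF hFc w hw)
    simpa [GroupoidOps.units, EquivalenceOps.link] using hg
  · refine key Link.isOpenEmbedding_ofH (fun g hg => ?_)
      (hX.continuousOn_linkHaar_ofH hΓG hΓH hlamG hlamH hF hFc w hw)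
    simpa [GroupoidOps.units, EquivalenceOps.link] using hg

end EquivalenceOps.IsEquivalence

/-! ### The topology of the linking bundle -/

/-- The map `e ↦ φ e` from a bundle over `A` identifies it, up to (possibly conjugate) linear
isometries of the fibres, with the restriction of the bundle `M` over `X` to the open subset `j A`.
-/
structure IsBundleChart {A X : Type u} [TopologicalSpace A] [TopologicalSpace X]
    {F : A → Type v} {M : X → Type v} [∀ a, NormedAddCommGroup (F a)] [∀ a, NormedSpace ℂ (F a)]
    [∀ x, NormedAddCommGroup (M x)] [∀ x, NormedSpace ℂ (M x)] [TopologicalSpace (Tot F)]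
    [TopologicalSpace (Tot M)] (j : A → X) (φ : ∀ a, F a → M (j a)) : Prop where
  isOpenEmbedding_base : IsOpenEmbedding j
  isOpenEmbedding_tot : IsOpenEmbedding fun e : Tot F => (⟨j e.base, φ e.base e.vec⟩ : Tot M)
  surjective : ∀ a, Function.Surjective (φ a)
  map_add : ∀ a e f, φ a (e + f) = φ a e + φ a f
  norm_map : ∀ a e, ‖φ a e‖ = ‖e‖
  smul_map : ∀ c : ℂ, ∃ c' : ℂ, ∀ a e, c • φ a e = φ a (c' • e)

namespace IsBundleChart

variable {A X : Type u} [TopologicalSpace A] [TopologicalSpace X]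
    {F : A → Type v} {M : X → Type v} [∀ a, NormedAddCommGroup (F a)] [∀ a, NormedSpace ℂ (F a)]
    [∀ x, NormedAddCommGroup (M x)] [∀ x, NormedSpace ℂ (M x)] [TopologicalSpace (Tot F)]
    [TopologicalSpace (Tot M)] {j : A → X} {φ : ∀ a, F a → M (j a)}
    (hφ : IsBundleChart j φ) (hF : IsUSCBanachBundle F)

include hφ

theorem map_zero (a : A) : φ a 0 = 0 := by
  rw [← norm_eq_zero, hφ.norm_map, norm_zero]

theorem isometry (a : A) : Isometry (φ a) :=
  AddMonoidHomClass.isometry_of_norm (AddMonoidHom.mk' (φ a) (hφ.map_add a)) (hφ.norm_map a)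

theorem toFibre_map {a : A} {e : Tot F} (he : e.base = a) :
    toFibre (j a) (⟨j e.base, φ e.base e.vec⟩ : Tot M) = φ a (toFibre a e) := by
  subst he
  rw [toFibre_mk]
  cases e
  rw [toFibre_mk]

theorem nhds_eq (a : A) (e : F a) :
    𝓝 (⟨j a, φ a e⟩ : Tot M) =
      map (fun e : Tot F => (⟨j e.base, φ e.base e.vec⟩ : Tot M)) (𝓝 ⟨a, e⟩) :=
  (hφ.isOpenEmbedding_tot.map_nhds_eq ⟨a, e⟩).symm

include hF in
theorem tendsto_zero (a : A) :
    comap Tot.base (𝓝 (j a)) ⊓ comap (fun b : Tot M => ‖b.vec‖) (𝓝 0) ≤ 𝓝 (⟨j a, 0⟩ : Tot M) := by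
  rw [← hφ.map_zero, hφ.nhds_eq, ← hφ.isOpenEmbedding_base.map_nhds_eq]
  refine le_trans ?_ (map_mono (hF.tendsto_zero a))
  set J := fun e : Tot F => (⟨j e.base, φ e.base e.vec⟩ : Tot M)
  have hr : Set.range J ∈ comap Tot.base (map j (𝓝 a)) ⊓ comap (fun b : Tot M => ‖b.vec‖) (𝓝 0) :=
    mem_inf_of_left ⟨Set.range j, range_mem_map, by
      rintro ⟨_, m⟩ ⟨a, rfl⟩
      obtain ⟨e, rfl⟩ := hφ.surjective a m
      exact ⟨⟨a, e⟩, rfl⟩⟩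
  rw [← map_comap_of_mem hr]
  refine map_mono (le_of_eq ?_)
  rw [comap_inf, comap_comap, comap_comap]
  congr 1
  · rw [show Tot.base ∘ J = j ∘ Tot.base from rfl, ← comap_comap,
      comap_map hφ.isOpenEmbedding_base.injective]
  · congr 1
    exact funext fun e => hφ.norm_map _ _

end IsBundleChart

/-- Being an upper semicontinuous Banach bundle is local on the base. -/
theorem isUSCBanachBundle_of_charts {X : Type u} [TopologicalSpace X] {M : X → Type v}
    [∀ x, NormedAddCommGroup (M x)] [∀ x, NormedSpace ℂ (M x)] [TopologicalSpace (Tot M)]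
    (hM : ∀ x : X, ∃ (A : Type u) (_ : TopologicalSpace A) (F : A → Type v)
      (_ : ∀ a, NormedAddCommGroup (F a)) (_ : ∀ a, NormedSpace ℂ (F a))
      (_ : TopologicalSpace (Tot F)) (j : A → X) (φ : ∀ a, F a → M (j a)) (a : A),
      IsUSCBanachBundle F ∧ IsBundleChart j φ ∧ j a = x) : IsUSCBanachBundle M where
  complete x := by
    obtain ⟨A, _, F, _, _, _, j, φ, a, hF, hφ, rfl⟩ := hM x
    have := hF.complete a
    exact (hφ.isometry a).isUniformInducing.completeSpace_congr (hφ.surjective a) |>.1 this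
  continuous_base := continuous_iff_continuousAt.2 fun ⟨x, m⟩ => by
    obtain ⟨A, _, F, _, _, _, j, φ, a, hF, hφ, rfl⟩ := hM x
    obtain ⟨e, rfl⟩ := hφ.surjective a m
    rw [ContinuousAt, hφ.nhds_eq, tendsto_map'_iff]
    exact (hφ.isOpenEmbedding_base.continuous.tendsto a).comp (hF.continuous_base.tendsto ⟨a, e⟩)
  isOpenMap_base := isOpenMap_iff_nhds_le.2 fun ⟨x, m⟩ => by
    obtain ⟨A, _, F, _, _, _, j, φ, a, hF, hφ, rfl⟩ := hM x
    obtain ⟨e, rfl⟩ := hφ.surjective a m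
    rw [hφ.nhds_eq, map_map]
    have h1 := map_mono (m := j) (hF.isOpenMap_base.nhds_le ⟨a, e⟩)
    rw [map_map, hφ.isOpenEmbedding_base.map_nhds_eq] at h1
    exact h1
  usc_norm := fun ⟨x, m⟩ r hr => by
    obtain ⟨A, _, F, _, _, _, j, φ, a, hF, hφ, rfl⟩ := hM x
    obtain ⟨e, rfl⟩ := hφ.surjective a m
    rw [hφ.nhds_eq, eventually_map]
    simp only [hφ.norm_map] at hr ⊢
    exact hF.usc_norm ⟨a, e⟩ r hr
  continuousOn_add := by
    rintro ⟨⟨x, m⟩, ⟨x', m'⟩⟩ (rfl : x = x')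
    obtain ⟨A, _, F, _, _, _, j, φ, a, hF, hφ, rfl⟩ := hM x
    obtain ⟨e, rfl⟩ := hφ.surjective a m
    obtain ⟨f, rfl⟩ := hφ.surjective a m'
    refine (hφ.isOpenEmbedding_tot.continuousWithinAt_prodMap (a := ⟨a, e⟩) (b := ⟨a, f⟩)
      hφ.isOpenEmbedding_tot).2 ?_
    have h1 := (hφ.isOpenEmbedding_tot.continuous.tendsto _).comp
      (hF.continuousOn_add (⟨a, e⟩, ⟨a, f⟩) rfl)
    have hD : {p : Tot F × Tot F | j p.1.base = j p.2.base} = {p | p.1.base = p.2.base} := by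
      ext p; exact hφ.isOpenEmbedding_base.injective.eq_iff
    change ContinuousWithinAt _ {p : Tot F × Tot F | j p.1.base = j p.2.base} _
    rw [hD]
    refine ContinuousWithinAt.congr h1 ?_ ?_
    · intro p hp
      simp only [Function.comp_apply, hφ.map_add, hφ.toFibre_map (Eq.symm hp)]
    · simp only [Function.comp_apply, hφ.map_add, toFibre_mk]
  continuous_smul c := continuous_iff_continuousAt.2 fun ⟨x, m⟩ => by
    obtain ⟨A, _, F, _, _, _, j, φ, a, hF, hφ, rfl⟩ := hM x
    obtain ⟨e, rfl⟩ := hφ.surjective a m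
    obtain ⟨c', hc⟩ := hφ.smul_map c
    rw [ContinuousAt, hφ.nhds_eq, tendsto_map'_iff]
    simp only [Function.comp_def, hc]
    exact (hφ.isOpenEmbedding_tot.continuous.tendsto _).comp
      ((hF.continuous_smul c').tendsto ⟨a, e⟩)
  tendsto_zero x := by
    obtain ⟨A, _, F, _, _, _, j, φ, a, hF, hφ, rfl⟩ := hM x
    exact hφ.tendsto_zero hF a

namespace LinkFibre

variable {G H Z : Type u} {B : G → Type v} {E : Z → Type v} {C : H → Type v}
  [TopologicalSpace (Tot B)] [TopologicalSpace (Tot E)] [TopologicalSpace (Tot C)]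

theorem isOpen_iff {U : Set (Tot (LinkFibre B E C))} : IsOpen U ↔ IsOpen (inB ⁻¹' U) ∧
    IsOpen (inE ⁻¹' U) ∧ IsOpen (inEop ⁻¹' U) ∧ IsOpen (inC ⁻¹' U) := by
  have h0 : IsOpen U ↔ ((IsOpen (inB ⁻¹' U) ∧ IsOpen (inE ⁻¹' U)) ∧ IsOpen (inEop ⁻¹' U)) ∧
    IsOpen (inC ⁻¹' U) := Iff.rfl
  rw [h0, and_assoc, and_assoc]

theorem continuous_iff {Y : Type*} [TopologicalSpace Y] {f : Tot (LinkFibre B E C) → Y} :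
    Continuous f ↔ Continuous (f ∘ inB) ∧ Continuous (f ∘ inE) ∧ Continuous (f ∘ inEop) ∧
      Continuous (f ∘ inC) := by
  simp only [continuous_def, isOpen_iff, Set.preimage_comp, forall_and]

theorem inB_injective : Function.Injective (inB : Tot B → Tot (LinkFibre B E C)) := by
  rintro ⟨g, b⟩ ⟨g', b'⟩ h
  cases h
  rfl

theorem inE_injective : Function.Injective (inE : Tot E → Tot (LinkFibre B E C)) := by
  rintro ⟨g, b⟩ ⟨g', b'⟩ h
  cases h
  rfl

theorem inEop_injective : Function.Injective (inEop : Tot E → Tot (LinkFibre B E C)) := by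
  rintro ⟨g, b⟩ ⟨g', b'⟩ h
  cases h
  rfl

theorem inC_injective : Function.Injective (inC : Tot C → Tot (LinkFibre B E C)) := by
  rintro ⟨g, b⟩ ⟨g', b'⟩ h
  cases h
  rfl

theorem isOpenEmbedding_inB : IsOpenEmbedding (inB : Tot B → Tot (LinkFibre B E C)) := by
  refine .of_continuous_injective_isOpenMap (continuous_iff.1 continuous_id).1
    inB_injective fun V hV => ?_
  rw [isOpen_iff, inB_injective.preimage_image]
  refine ⟨hV, ?_, ?_, ?_⟩ <;>
  · convert isOpen_empty
    refine Set.eq_empty_of_forall_notMem ?_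
    rintro e ⟨x, -, hx⟩
    cases congrArg Tot.base hx

theorem isOpenEmbedding_inE : IsOpenEmbedding (inE : Tot E → Tot (LinkFibre B E C)) := by
  refine .of_continuous_injective_isOpenMap (continuous_iff.1 continuous_id).2.1
    inE_injective fun V hV => ?_
  rw [isOpen_iff, inE_injective.preimage_image]
  refine ⟨?_, hV, ?_, ?_⟩ <;>
  · convert isOpen_empty
    refine Set.eq_empty_of_forall_notMem ?_
    rintro e ⟨x, -, hx⟩
    cases congrArg Tot.base hx

theorem isOpenEmbedding_inEop : IsOpenEmbedding (inEop : Tot E → Tot (LinkFibre B E C)) := by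
  refine .of_continuous_injective_isOpenMap (continuous_iff.1 continuous_id).2.2.1
    inEop_injective fun V hV => ?_
  rw [isOpen_iff, inEop_injective.preimage_image]
  refine ⟨?_, ?_, hV, ?_⟩ <;>
  · convert isOpen_empty
    refine Set.eq_empty_of_forall_notMem ?_
    rintro e ⟨x, -, hx⟩
    cases congrArg Tot.base hx

theorem isOpenEmbedding_inC : IsOpenEmbedding (inC : Tot C → Tot (LinkFibre B E C)) := by
  refine .of_continuous_injective_isOpenMap (continuous_iff.1 continuous_id).2.2.2
    inC_injective fun V hV => ?_
  rw [isOpen_iff, inC_injective.preimage_image]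
  refine ⟨?_, ?_, ?_, hV⟩ <;>
  · convert isOpen_empty
    refine Set.eq_empty_of_forall_notMem ?_
    rintro e ⟨x, -, hx⟩
    cases congrArg Tot.base hx

variable [TopologicalSpace G] [TopologicalSpace Z] [TopologicalSpace H]
  [∀ x, NormedAddCommGroup (B x)] [∀ x, NormedSpace ℂ (B x)]
  [∀ x, NormedAddCommGroup (C x)] [∀ x, NormedSpace ℂ (C x)]
  [∀ x, NormedAddCommGroup (E x)] [∀ x, NormedSpace ℂ (E x)]

theorem isUSCBanachBundle (hB : IsUSCBanachBundle B) (hE : IsUSCBanachBundle E)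
    (hC : IsUSCBanachBundle C) : IsUSCBanachBundle (LinkFibre B E C) := by
  refine isUSCBanachBundle_of_charts fun x => ?_
  cases x with
  | ofG g =>
    exact ⟨G, _, B, _, _, _, Link.ofG, fun _ b => b, g, hB, ⟨Link.isOpenEmbedding_ofG,
      isOpenEmbedding_inB, fun _ => Function.surjective_id, fun _ _ _ => rfl, fun _ _ => rfl,
      fun c => ⟨c, fun _ _ => rfl⟩⟩, rfl⟩
  | ofZ z =>
    exact ⟨Z, _, E, _, _, _, Link.ofZ, fun _ b => b, z, hE, ⟨Link.isOpenEmbedding_ofZ,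
      isOpenEmbedding_inE, fun _ => Function.surjective_id, fun _ _ _ => rfl, fun _ _ => rfl,
      fun c => ⟨c, fun _ _ => rfl⟩⟩, rfl⟩
  | zop z =>
    exact ⟨Z, _, E, _, _, _, Link.zop, fun _ b => Conj.bar b, z, hE, ⟨Link.isOpenEmbedding_zop,
      isOpenEmbedding_inEop, fun _ => Function.surjective_id, fun _ _ _ => rfl, fun _ _ => rfl,
      fun c => ⟨starRingEnd ℂ c, fun _ _ => rfl⟩⟩, rfl⟩
  | ofH h =>
    exact ⟨H, _, C, _, _, _, Link.ofH, fun _ b => b, h, hC, ⟨Link.isOpenEmbedding_ofH,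
      isOpenEmbedding_inC, fun _ => Function.surjective_id, fun _ _ _ => rfl, fun _ _ => rfl,
      fun c => ⟨c, fun _ _ => rfl⟩⟩, rfl⟩

end LinkFibre

/-! ### The operations of the linking bundle -/

namespace BundleEquivalenceOps.IsBundleEquivalence

variable {G H Z : Type u} [TopologicalSpace G] [TopologicalSpace H] [TopologicalSpace Z]
  {X : EquivalenceOps G H Z} {ΓG : GroupoidOps G} {ΓH : GroupoidOps H}
  {B : G → Type v} [∀ x, NormedAddCommGroup (B x)] [∀ x, NormedSpace ℂ (B x)]
  [TopologicalSpace (Tot B)] {ℬ : FellOps ΓG B}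
  {C : H → Type v} [∀ x, NormedAddCommGroup (C x)] [∀ x, NormedSpace ℂ (C x)]
  [TopologicalSpace (Tot C)] {𝒞 : FellOps ΓH C}
  {E : Z → Type v} [∀ x, NormedAddCommGroup (E x)] [∀ x, NormedSpace ℂ (E x)]
  [TopologicalSpace (Tot E)] {ℰ : BundleEquivalenceOps X ΓG ΓH B C E}
  (hℰ : ℰ.IsBundleEquivalence ℬ 𝒞) (hΓG : ΓG.IsTopologicalGroupoid)
  (hΓH : ΓH.IsTopologicalGroupoid) (hℬ : ℬ.IsFellBundle) (h𝒞 : 𝒞.IsFellBundle)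

include hℰ hℬ h𝒞

theorem continuous_link_starT : Continuous (ℰ.link ℬ 𝒞).starT :=
  LinkFibre.continuous_iff.2
    ⟨LinkFibre.isOpenEmbedding_inB.continuous.comp hℬ.continuous_star,
      LinkFibre.isOpenEmbedding_inEop.continuous, LinkFibre.isOpenEmbedding_inE.continuous,
      LinkFibre.isOpenEmbedding_inC.continuous.comp h𝒞.continuous_star⟩

theorem link_star_smul (x : Link G Z H) (c : ℂ) (a : LinkFibre B E C x) :
    (ℰ.link ℬ 𝒞).star (c • a) = starRingEnd ℂ c • (ℰ.link ℬ 𝒞).star a := by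
  cases x with
  | ofG g => exact hℬ.star_smul g c a
  | ofZ z =>
    change c • a = starRingEnd ℂ (starRingEnd ℂ c) • a
    rw [Complex.conj_conj]
  | zop z => rfl
  | ofH h => exact h𝒞.star_smul h c a

include hΓG hΓH

theorem link_smul_mul (x y : Link G Z H) (hxy : (X.link ΓG ΓH).s x = (X.link ΓG ΓH).r y) (c : ℂ)
    (a : LinkFibre B E C x) (b : LinkFibre B E C y) :
    (ℰ.link ℬ 𝒞).mul (c • a) b = c • (ℰ.link ℬ 𝒞).mul a b := by
  cases x <;> cases y <;> try (exfalso; revert hxy; simp [EquivalenceOps.link]; done)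
  · exact hℬ.smul_mul _ _ (Link.ofG.inj hxy) c a b
  · exact hℰ.smul_lact _ _ (Link.ofG.inj hxy) c a b
  · exact hℰ.smul_lip _ _ (Link.ofH.inj hxy) c a b
  · exact hℰ.smul_ract _ _ (Link.ofH.inj hxy) c a b
  · exact hℰ.lact_smul _ _ ((hΓG.s_inv _).trans (Link.ofG.inj hxy).symm) (starRingEnd ℂ c) _ _
  · refine (hℰ.smul_rip _ _ (Link.ofG.inj hxy) (starRingEnd ℂ c) a b).trans ?_
    rw [Complex.conj_conj]
    rfl
  · refine (congrArg (ℰ.ract _) (h𝒞.star_smul _ c a)).trans ?_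
    exact hℰ.ract_smul _ _ ((Link.ofH.inj hxy).symm.trans (hΓH.r_inv _).symm) (starRingEnd ℂ c) _ _
  · exact h𝒞.smul_mul _ _ (Link.ofH.inj hxy) c a b

theorem link_mul_smul (x y : Link G Z H) (hxy : (X.link ΓG ΓH).s x = (X.link ΓG ΓH).r y) (c : ℂ)
    (a : LinkFibre B E C x) (b : LinkFibre B E C y) :
    (ℰ.link ℬ 𝒞).mul a (c • b) = c • (ℰ.link ℬ 𝒞).mul a b := by
  cases x <;> cases y <;> try (exfalso; revert hxy; simp [EquivalenceOps.link]; done)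
  · exact hℬ.mul_smul _ _ (Link.ofG.inj hxy) c a b
  · exact hℰ.lact_smul _ _ (Link.ofG.inj hxy) c a b
  · refine (hℰ.lip_smul _ _ (Link.ofH.inj hxy) (starRingEnd ℂ c) a b).trans ?_
    rw [Complex.conj_conj]
    rfl
  · exact hℰ.ract_smul _ _ (Link.ofH.inj hxy) c a b
  · refine (congrArg (fun d => ℰ.lact d _) (hℬ.star_smul _ c b)).trans ?_
    exact hℰ.smul_lact _ _ ((hΓG.s_inv _).trans (Link.ofG.inj hxy).symm) (starRingEnd ℂ c) _ _
  · exact hℰ.rip_smul _ _ (Link.ofG.inj hxy) c a b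
  · exact hℰ.smul_ract _ _ ((Link.ofH.inj hxy).symm.trans (hΓH.r_inv _).symm) (starRingEnd ℂ c) _ _
  · exact h𝒞.mul_smul _ _ (Link.ofH.inj hxy) c a b

theorem link_add_mul (x y : Link G Z H) (hxy : (X.link ΓG ΓH).s x = (X.link ΓG ΓH).r y)
    (a a' : LinkFibre B E C x) (b : LinkFibre B E C y) :
    (ℰ.link ℬ 𝒞).mul (a + a') b = (ℰ.link ℬ 𝒞).mul a b + (ℰ.link ℬ 𝒞).mul a' b := by
  cases x <;> cases y <;> try (exfalso; revert hxy; simp [EquivalenceOps.link]; done)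
  · exact hℬ.add_mul _ _ (Link.ofG.inj hxy) a a' b
  · exact hℰ.add_lact _ _ (Link.ofG.inj hxy) a a' b
  · exact hℰ.add_lip _ _ (Link.ofH.inj hxy) a a' b
  · exact hℰ.add_ract _ _ (Link.ofH.inj hxy) a a' b
  · exact hℰ.lact_add _ _ ((hΓG.s_inv _).trans (Link.ofG.inj hxy).symm) _ _ _
  · exact hℰ.add_rip _ _ (Link.ofG.inj hxy) a a' b
  · refine (congrArg (ℰ.ract _) (h𝒞.star_add _ a a')).trans ?_
    exact hℰ.ract_add _ _ ((Link.ofH.inj hxy).symm.trans (hΓH.r_inv _).symm) _ _ _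
  · exact h𝒞.add_mul _ _ (Link.ofH.inj hxy) a a' b

theorem continuousOn_link_mulT :
    ContinuousOn (fun p : Tot (LinkFibre B E C) × Tot (LinkFibre B E C) =>
      (ℰ.link ℬ 𝒞).mulT p.1 p.2)
      {p | (X.link ΓG ΓH).s p.1.base = (X.link ΓG ΓH).r p.2.base} := by
  have hB := LinkFibre.isOpenEmbedding_inB (B := B) (E := E) (C := C)
  have hE := LinkFibre.isOpenEmbedding_inE (B := B) (E := E) (C := C)
  have hE' := LinkFibre.isOpenEmbedding_inEop (B := B) (E := E) (C := C)
  have hC := LinkFibre.isOpenEmbedding_inC (B := B) (E := E) (C := C)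
  rintro ⟨⟨x, a⟩, ⟨y, b⟩⟩ hxy
  cases x <;> cases y <;> try (exfalso; revert hxy; simp [EquivalenceOps.link]; done)
  · exact (hB.continuousWithinAt_prodMap hB (a := ⟨_, a⟩) (b := ⟨_, b⟩)).2
      (((hB.continuous.tendsto _).comp (hℬ.continuousOn_mul (⟨_, a⟩, ⟨_, b⟩)
        (Link.ofG.inj hxy))).mono_left (nhdsWithin_mono _ fun p hp => Link.ofG.inj hp))
  · exact (hB.continuousWithinAt_prodMap hE (a := ⟨_, a⟩) (b := ⟨_, b⟩)).2
      (((hE.continuous.tendsto _).comp (hℰ.continuousOn_lact (⟨_, a⟩, ⟨_, b⟩)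
        (Link.ofG.inj hxy))).mono_left (nhdsWithin_mono _ fun p hp => Link.ofG.inj hp))
  · exact (hE.continuousWithinAt_prodMap hE' (a := ⟨_, a⟩) (b := ⟨_, b⟩)).2
      (((hB.continuous.tendsto _).comp (hℰ.continuousOn_lip (⟨_, a⟩, ⟨_, b⟩)
        (Link.ofH.inj hxy))).mono_left (nhdsWithin_mono _ fun p hp => Link.ofH.inj hp))
  · exact (hE.continuousWithinAt_prodMap hC (a := ⟨_, a⟩) (b := ⟨_, b⟩)).2
      (((hE.continuous.tendsto _).comp (hℰ.continuousOn_ract (⟨_, a⟩, ⟨_, b⟩)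
        (Link.ofH.inj hxy))).mono_left (nhdsWithin_mono _ fun p hp => Link.ofH.inj hp))
  · have h1 : ContinuousOn (fun p : Tot E × Tot B => ℰ.lactT (ℬ.starT p.2) p.1)
        {p | X.r p.1.base = ΓG.r p.2.base} :=
      hℰ.continuousOn_lact.comp (f := fun p : Tot E × Tot B => (ℬ.starT p.2, p.1))
        ((hℬ.continuous_star.comp continuous_snd).prodMk continuous_fst).continuousOn
        fun p hp => (hΓG.s_inv _).trans (Eq.symm hp)
    exact (hE'.continuousWithinAt_prodMap hB (a := ⟨_, a⟩) (b := ⟨_, b⟩)).2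
      (((hE'.continuous.tendsto _).comp (h1 (⟨_, a⟩, ⟨_, b⟩)
        (Link.ofG.inj hxy))).mono_left (nhdsWithin_mono _ fun p hp => Link.ofG.inj hp))
  · exact (hE'.continuousWithinAt_prodMap hE (a := ⟨_, a⟩) (b := ⟨_, b⟩)).2
      (((hC.continuous.tendsto _).comp (hℰ.continuousOn_rip (⟨_, a⟩, ⟨_, b⟩)
        (Link.ofG.inj hxy))).mono_left (nhdsWithin_mono _ fun p hp => Link.ofG.inj hp))
  · have h1 : ContinuousOn (fun p : Tot C × Tot E => ℰ.ractT p.2 (𝒞.starT p.1))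
        {p | ΓH.s p.1.base = X.s p.2.base} :=
      hℰ.continuousOn_ract.comp (f := fun p : Tot C × Tot E => (p.2, 𝒞.starT p.1))
        (continuous_snd.prodMk (h𝒞.continuous_star.comp continuous_fst)).continuousOn
        fun p hp => (Eq.symm hp).trans (hΓH.r_inv _).symm
    exact (hC.continuousWithinAt_prodMap hE' (a := ⟨_, a⟩) (b := ⟨_, b⟩)).2
      (((hE'.continuous.tendsto _).comp (h1 (⟨_, a⟩, ⟨_, b⟩)
        (Link.ofH.inj hxy))).mono_left (nhdsWithin_mono _ fun p hp => Link.ofH.inj hp))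
  · exact (hC.continuousWithinAt_prodMap hC (a := ⟨_, a⟩) (b := ⟨_, b⟩)).2
      (((hC.continuous.tendsto _).comp (h𝒞.continuousOn_mul (⟨_, a⟩, ⟨_, b⟩)
        (Link.ofH.inj hxy))).mono_left (nhdsWithin_mono _ fun p hp => Link.ofH.inj hp))

end BundleEquivalenceOps.IsBundleEquivalence

/-! ### The fibres over units and their approximate units -/

/-- A left Hilbert module `V` over a C⋆-algebra `A` is nondegenerate: for an approximate unit `d`
of `A` one has `‖v - d v‖² = ‖(c - d c) - (c - d c) d‖ → 0`, where `c = ⟨v, v⟩`. -/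
theorem exists_norm_sub_act_lt {A V : Type*} [NonUnitalCStarAlgebra A] [NormedAddCommGroup V]
    {act : A → V → V} {ip : V → V → A}
    (add_ip : ∀ v w x, ip (v + w) x = ip v x + ip w x)
    (ip_add : ∀ v w x, ip v (w + x) = ip v w + ip v x)
    (ip_act_left : ∀ d v w, ip (act d v) w = d * ip v w)
    (ip_act_right : ∀ d v w, ip v (act d w) = ip v w * star d)
    (norm_ip : ∀ v, ‖ip v v‖ = ‖v‖ ^ 2) (v : V) {ε : ℝ} (hε : 0 < ε) :
    ∃ d, ‖v - act d v‖ < ε := by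
  let _ := CStarAlgebra.spectralOrder A
  let _ := CStarAlgebra.spectralOrderedRing A
  have sub_ip : ∀ v w x, ip (v - w) x = ip v x - ip w x := fun v w x => by
    rw [eq_sub_iff_add_eq, ← add_ip, sub_add_cancel]
  have ip_sub : ∀ v w x, ip v (w - x) = ip v w - ip v x := fun v w x => by
    rw [eq_sub_iff_add_eq, ← ip_add, sub_add_cancel]
  set c := ip v v
  have hl := CStarAlgebra.increasingApproximateUnit A
  have h1 : ∀ᶠ d in CStarAlgebra.approximateUnit A, ‖d * c - c‖ < ε ^ 2 / 2 := by
    have := (tendsto_iff_norm_sub_tendsto_zero.1 (hl.tendsto_mul_right c))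
    exact this.eventually_lt_const (by positivity)
  have := hl.neBot
  obtain ⟨d, hdc, hd1, hds⟩ := (h1.and (hl.eventually_norm.and hl.eventually_star_eq)).exists
  refine ⟨d, lt_of_pow_lt_pow_left₀ 2 hε.le ?_⟩
  have h2 : ip (v - act d v) (v - act d v) = (c - d * c) - (c - d * c) * d := by
    simp only [sub_ip, ip_sub, ip_act_left, ip_act_right, hds, sub_mul, mul_assoc, c]
    abel
  have h3 : ‖c - d * c‖ < ε ^ 2 / 2 := by rwa [norm_sub_rev]
  calc ‖v - act d v‖ ^ 2 = ‖(c - d * c) - (c - d * c) * d‖ := by rw [← norm_ip, h2]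
    _ ≤ ‖c - d * c‖ + ‖c - d * c‖ * ‖d‖ :=
      (norm_sub_le _ _).trans (by gcongr; exact norm_mul_le _ _)
    _ ≤ ‖c - d * c‖ + ‖c - d * c‖ * 1 := by gcongr
    _ < ε ^ 2 := by linarith

namespace GroupoidOps.IsTopologicalGroupoid

variable {G : Type u} [TopologicalSpace G] {Γ : GroupoidOps G} (hΓ : Γ.IsTopologicalGroupoid)

include hΓ

theorem mul_self_of_mem {u : G} (hu : u ∈ Γ.units) : Γ.mul u u = u := by
  conv_lhs => enter [2]; rw [← hΓ.r_eq_of_mem hu]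
  exact hΓ.r_mul_self u

theorem inv_of_mem {u : G} (hu : u ∈ Γ.units) : Γ.inv u = u := by
  have h1 := hΓ.r_mul_self (Γ.inv u)
  rw [hΓ.r_inv, hΓ.s_eq_of_mem hu, hΓ.mul_inv, hΓ.r_eq_of_mem hu] at h1
  exact h1.symm

end GroupoidOps.IsTopologicalGroupoid

namespace FellOps.IsFellBundle

variable {G : Type u} [TopologicalSpace G] {Γ : GroupoidOps G} {B : G → Type v}
  [∀ x, NormedAddCommGroup (B x)] [∀ x, NormedSpace ℂ (B x)] [TopologicalSpace (Tot B)]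
  {ℬ : FellOps Γ B} (hℬ : ℬ.IsFellBundle) (hΓ : Γ.IsTopologicalGroupoid)

/-- The C⋆-algebra which is the fibre of a Fell bundle over a unit. -/
abbrev fibreAlgebra {u : G} (hu : u ∈ Γ.units) : NonUnitalCStarAlgebra (B u) :=
  have hr : Γ.r u = u := hΓ.r_eq_of_mem hu
  have hs : Γ.s u = u := hΓ.s_eq_of_mem hu
  have hsr : Γ.s u = Γ.r u := hs.trans hr.symm
  have hm : Γ.mul u u = u := hΓ.mul_self_of_mem hu
  have hi : Γ.inv u = u := hΓ.inv_of_mem hu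
  have mk_mul (a b : B u) : (⟨u, toFibre u (ℬ.mulT ⟨u, a⟩ ⟨u, b⟩)⟩ : Tot B) =
    ℬ.mulT ⟨u, a⟩ ⟨u, b⟩ := mk_toFibre hm
  have mk_star (a : B u) : (⟨u, toFibre u (ℬ.starT ⟨u, a⟩)⟩ : Tot B) = ℬ.starT ⟨u, a⟩ :=
    mk_toFibre hi
  { (inferInstance : NormedAddCommGroup (B u)), (inferInstance : NormedSpace ℂ (B u)),
    hℬ.complete u with
    mul a b := toFibre u (ℬ.mulT ⟨u, a⟩ ⟨u, b⟩)
    star a := toFibre u (ℬ.starT ⟨u, a⟩)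
    left_distrib a b c := by
      change toFibre u (⟨_, ℬ.mul a (b + c)⟩ : Tot B) = _
      rw [hℬ.mul_add _ _ hsr, toFibre_mk_add]
      rfl
    right_distrib a b c := by
      change toFibre u (⟨_, ℬ.mul (a + b) c⟩ : Tot B) = _
      rw [hℬ.add_mul _ _ hsr, toFibre_mk_add]
      rfl
    zero_mul a := by
      change toFibre u (⟨_, ℬ.mul 0 a⟩ : Tot B) = 0
      rw [← zero_smul ℂ (0 : B u), hℬ.smul_mul _ _ hsr, toFibre_mk_smul, zero_smul, zero_smul]
    mul_zero a := by
      change toFibre u (⟨_, ℬ.mul a 0⟩ : Tot B) = 0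
      rw [← zero_smul ℂ (0 : B u), hℬ.mul_smul _ _ hsr, toFibre_mk_smul, zero_smul, zero_smul]
    mul_assoc a b c := by
      change toFibre u (ℬ.mulT ⟨u, toFibre u _⟩ _) = toFibre u (ℬ.mulT _ ⟨u, toFibre u _⟩)
      rw [mk_mul, mk_mul, hℬ.mul_assoc _ _ _ hsr hsr]
    norm_mul_le a b := by
      change ‖toFibre u (ℬ.mulT ⟨u, a⟩ ⟨u, b⟩)‖ ≤ ‖a‖ * ‖b‖
      rw [norm_toFibre (by exact hm)]
      exact hℬ.norm_mul_le u hu a b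
    star_involutive a := by
      change toFibre u (ℬ.starT ⟨u, toFibre u _⟩) = a
      rw [mk_star, hℬ.star_star, toFibre_mk]
    star_mul a b := by
      change toFibre u (ℬ.starT ⟨u, toFibre u _⟩) =
        toFibre u (ℬ.mulT ⟨u, toFibre u _⟩ ⟨u, toFibre u _⟩)
      rw [mk_mul, mk_star, mk_star, hℬ.star_mul _ _ hsr]
    star_add a b := by
      change toFibre u (⟨_, ℬ.star (a + b)⟩ : Tot B) = _
      rw [hℬ.star_add, toFibre_mk_add]
      rfl
    norm_mul_self_le a := by
      change ‖a‖ * ‖a‖ ≤ ‖toFibre u (ℬ.mulT ⟨u, toFibre u _⟩ _)‖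
      rw [mk_star, norm_toFibre (by change Γ.mul (Γ.inv u) u = u; rw [hi, hm])]
      exact (pow_two ‖a‖).symm.trans (hℬ.norm_star_mul u a).symm |>.le
    smul_assoc k a b := by
      change toFibre u (⟨_, ℬ.mul (k • a) b⟩ : Tot B) = k • toFibre u (⟨_, ℬ.mul a b⟩ : Tot B)
      rw [hℬ.smul_mul _ _ hsr, toFibre_mk_smul]
    smul_comm k a b := by
      change k • toFibre u (⟨_, ℬ.mul a b⟩ : Tot B) = toFibre u (⟨_, ℬ.mul a (k • b)⟩ : Tot B)
      rw [hℬ.mul_smul _ _ hsr, toFibre_mk_smul]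
    star_smul k a := by
      change toFibre u (⟨_, ℬ.star (k • a)⟩ : Tot B) = _
      rw [hℬ.star_smul, toFibre_mk_smul]
      rfl }

include hℬ hΓ

/-- `B_{r x} B_x` is dense in `B_x`: apply `exists_norm_sub_act_lt` with `⟨a, b⟩ = a b*`. -/
theorem exists_norm_sub_mul_lt {x : G} (a : B x) {ε : ℝ} (hε : 0 < ε) :
    ∃ d : B (Γ.r x), ‖a - toFibre x (ℬ.mulT ⟨_, d⟩ ⟨x, a⟩)‖ < ε := by
  have hu : Γ.r x ∈ Γ.units := hΓ.r_r x
  have hrm : ∀ b : Tot B, b.base = Γ.r x → (⟨_, toFibre (Γ.r x) b⟩ : Tot B) = b :=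
    fun b hb => mk_toFibre hb
  have hxm : ∀ b : Tot B, b.base = x → (⟨_, toFibre x b⟩ : Tot B) = b := fun b hb => mk_toFibre hb
  have hxi : Γ.s x = Γ.r (Γ.inv x) := (hΓ.r_inv x).symm
  let _ := hℬ.fibreAlgebra hΓ hu
  refine exists_norm_sub_act_lt (act := fun d a : _ => toFibre x (ℬ.mulT ⟨_, d⟩ ⟨x, a⟩))
    (ip := fun a b => toFibre (Γ.r x) (ℬ.mulT ⟨x, a⟩ (ℬ.starT ⟨x, b⟩)))
    (fun a b c => ?_) (fun a b c => ?_) (fun d a b => ?_) (fun d a b => ?_) (fun a => ?_) a hε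
  · change toFibre _ (⟨_, ℬ.mul (a + b) (ℬ.star c)⟩ : Tot B) = _
    rw [hℬ.add_mul _ _ hxi, toFibre_mk_add]
    rfl
  · change toFibre _ (⟨_, ℬ.mul a (ℬ.star (b + c))⟩ : Tot B) = _
    rw [hℬ.star_add, hℬ.mul_add _ _ hxi, toFibre_mk_add]
    rfl
  · change _ = toFibre (Γ.r x) (ℬ.mulT ⟨_, d⟩ ⟨_, toFibre (Γ.r x) _⟩)
    rw [hrm _ (hΓ.mul_inv x), hxm _ (hΓ.r_mul_self x), hℬ.mul_assoc _ _ _ (hΓ.s_r x) hxi]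
  · change _ = toFibre (Γ.r x) (ℬ.mulT ⟨_, toFibre (Γ.r x) _⟩ ⟨_, toFibre (Γ.r x) _⟩)
    rw [hrm _ (hΓ.mul_inv x), hxm _ (hΓ.r_mul_self x), hrm _ (hΓ.inv_of_mem hu),
      hℬ.star_mul _ _ (hΓ.s_r x), hℬ.mul_assoc _ _ _ hxi]
    exact (hΓ.s_inv x).trans (((hΓ.r_inv _).trans (hΓ.s_r x)).symm)
  · rw [norm_toFibre (by exact hΓ.mul_inv x)]
    exact hℬ.norm_mul_star x a

end FellOps.IsFellBundle


namespace EquivalenceOps.IsEquivalence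

variable {G H Z : Type u} [TopologicalSpace G] [TopologicalSpace H] [TopologicalSpace Z]
  {X : EquivalenceOps G H Z} {ΓG : GroupoidOps G} {ΓH : GroupoidOps H}
  (hX : X.IsEquivalence ΓG ΓH) (hΓG : ΓG.IsTopologicalGroupoid) (hΓH : ΓH.IsTopologicalGroupoid)

include hX

include hΓG in
theorem s_r (z : Z) : ΓG.s (X.r z) = X.r z := hΓG.s_eq_of_mem (hX.r_mem z)

include hΓG in
theorem brG_self (z : Z) : X.brG ΓG z z = X.r z := by
  have := hX.brG_lact hΓG (hX.s_r hΓG z)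
  rwa [hX.unit_lact] at this

theorem r_s (z : Z) : ΓH.r (X.s z) = X.s z := hX.s_mem z

include hΓH in
theorem brH_self (z : Z) : X.brH ΓH z z = X.s z := by
  have := hX.brH_ract hΓH (hX.r_s z).symm
  rwa [hX.unit_ract] at this

end EquivalenceOps.IsEquivalence

namespace BundleEquivalenceOps.IsBundleEquivalence

variable {G H Z : Type u} [TopologicalSpace G] [TopologicalSpace H] [TopologicalSpace Z]
  {X : EquivalenceOps G H Z} {ΓG : GroupoidOps G} {ΓH : GroupoidOps H}
  {B : G → Type v} [∀ x, NormedAddCommGroup (B x)] [∀ x, NormedSpace ℂ (B x)]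
  [TopologicalSpace (Tot B)] {ℬ : FellOps ΓG B}
  {C : H → Type v} [∀ x, NormedAddCommGroup (C x)] [∀ x, NormedSpace ℂ (C x)]
  [TopologicalSpace (Tot C)] {𝒞 : FellOps ΓH C}
  {E : Z → Type v} [∀ x, NormedAddCommGroup (E x)] [∀ x, NormedSpace ℂ (E x)]
  [TopologicalSpace (Tot E)] {ℰ : BundleEquivalenceOps X ΓG ΓH B C E}
  (hℰ : ℰ.IsBundleEquivalence ℬ 𝒞) (hX : X.IsEquivalence ΓG ΓH)
  (hΓG : ΓG.IsTopologicalGroupoid) (hΓH : ΓH.IsTopologicalGroupoid)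
  (hℬ : ℬ.IsFellBundle) (h𝒞 : 𝒞.IsFellBundle)

include hℰ hX

include hℬ in
/-- The adjoint of `b ⟨e, f⟩ = ⟨b e, f⟩`. -/
theorem lipT_lactT (b : Tot B) (e f : Tot E) (hbf : ΓG.s b.base = X.r f.base)
    (hef : X.s e.base = X.s f.base) :
    ℰ.lipT e (ℰ.lactT b f) = ℬ.mulT (ℰ.lipT e f) (ℬ.starT b) := by
  rw [← hℰ.star_lip _ _ (by exact (hX.s_lact _ _ hbf).trans hef.symm),
    ← hℰ.mul_lip _ _ _ hbf hef.symm, hℬ.star_mul, hℰ.star_lip _ _ hef.symm]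
  exact hbf.trans (hX.r_brG hef.symm).symm

include h𝒞 in
/-- The adjoint of `⟨e, f⟩ c = ⟨e, f c⟩`. -/
theorem ripT_ractT (e f : Tot E) (c : Tot C) (hec : X.s e.base = ΓH.r c.base)
    (hef : X.r e.base = X.r f.base) :
    ℰ.ripT (ℰ.ractT e c) f = 𝒞.mulT (𝒞.starT c) (ℰ.ripT e f) := by
  rw [← hℰ.star_rip _ _ (by exact hef.symm.trans (hX.r_ract _ _ hec).symm),
    ← hℰ.rip_mul _ _ _ hef.symm hec, h𝒞.star_mul, hℰ.star_rip _ _ hef.symm]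
  exact (hX.s_brH hef.symm).trans hec

include hΓG hℬ in
theorem exists_norm_sub_lact_lt {z : Z} (e : E z) {ε : ℝ} (hε : 0 < ε) :
    ∃ d : B (X.r z), ‖e - toFibre z (ℰ.lactT ⟨_, d⟩ ⟨z, e⟩)‖ < ε := by
  have hu := hX.r_mem z
  have hsr := hX.s_r hΓG z
  have hrm : ∀ b : Tot B, b.base = X.r z → (⟨_, toFibre (X.r z) b⟩ : Tot B) = b :=
    fun b hb => mk_toFibre hb
  have hzm : ∀ f : Tot E, f.base = z → (⟨_, toFibre z f⟩ : Tot E) = f := fun b hb => mk_toFibre hb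
  let _ := hℬ.fibreAlgebra hΓG hu
  refine exists_norm_sub_act_lt (act := fun d e : _ => toFibre z (ℰ.lactT ⟨_, d⟩ ⟨z, e⟩))
    (ip := fun e f => toFibre (X.r z) (ℰ.lipT ⟨z, e⟩ ⟨z, f⟩))
    (fun a b c => ?_) (fun a b c => ?_) (fun d a b => ?_) (fun d a b => ?_) (fun a => ?_) e hε
  · change toFibre _ (⟨_, ℰ.lip (a + b) c⟩ : Tot B) = _
    rw [hℰ.add_lip _ _ rfl, toFibre_mk_add]
    rfl
  · change toFibre _ (⟨_, ℰ.lip a (b + c)⟩ : Tot B) = _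
    rw [hℰ.lip_add _ _ rfl, toFibre_mk_add]
    rfl
  · change _ = toFibre (X.r z) (ℬ.mulT ⟨_, d⟩ ⟨_, toFibre (X.r z) _⟩)
    rw [hrm _ (hX.brG_self hΓG z), hzm _ (hX.unit_lact z), hℰ.mul_lip ⟨_, d⟩ ⟨z, a⟩ ⟨z, b⟩ hsr rfl]
  · change _ = toFibre (X.r z) (ℬ.mulT ⟨_, toFibre (X.r z) _⟩ ⟨_, toFibre (X.r z) _⟩)
    rw [hrm _ (hX.brG_self hΓG z), hzm _ (hX.unit_lact z), hrm _ (hΓG.inv_of_mem hu),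
      hℰ.lipT_lactT hX hℬ ⟨_, d⟩ ⟨z, a⟩ ⟨z, b⟩ hsr rfl]
  · rw [norm_toFibre (by exact hX.brG_self hΓG z)]
    exact hℰ.norm_lip_self z a

include hΓH h𝒞 in
theorem exists_norm_sub_ract_lt {z : Z} (e : E z) {ε : ℝ} (hε : 0 < ε) :
    ∃ d : C (X.s z), ‖e - toFibre z (ℰ.ractT ⟨z, e⟩ (𝒞.starT ⟨_, d⟩))‖ < ε := by
  have hu := hX.s_mem z
  have hsr : ΓH.s (X.s z) = X.s z := hΓH.s_eq_of_mem hu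
  have hi : ΓH.inv (X.s z) = X.s z := hΓH.inv_of_mem hu
  have hzi : X.s z = ΓH.r (ΓH.inv (X.s z)) := by rw [hΓH.r_inv, hsr]
  have hrm : ∀ b : Tot C, b.base = X.s z → (⟨_, toFibre (X.s z) b⟩ : Tot C) = b :=
    fun b hb => mk_toFibre hb
  have hzm : ∀ f : Tot E, f.base = z → (⟨_, toFibre z f⟩ : Tot E) = f := fun b hb => mk_toFibre hb
  have hza : X.ract z (ΓH.inv (X.s z)) = z := by rw [hi, hX.unit_ract]
  let _ := h𝒞.fibreAlgebra hΓH hu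
  refine exists_norm_sub_act_lt
    (act := fun d e : _ => toFibre z (ℰ.ractT ⟨z, e⟩ (𝒞.starT ⟨_, d⟩)))
    (ip := fun e f => toFibre (X.s z) (ℰ.ripT ⟨z, e⟩ ⟨z, f⟩))
    (fun a b c => ?_) (fun a b c => ?_) (fun d a b => ?_) (fun d a b => ?_) (fun a => ?_) e hε
  · change toFibre _ (⟨_, ℰ.rip (a + b) c⟩ : Tot C) = _
    rw [hℰ.add_rip _ _ rfl, toFibre_mk_add]
    rfl
  · change toFibre _ (⟨_, ℰ.rip a (b + c)⟩ : Tot C) = _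
    rw [hℰ.rip_add _ _ rfl, toFibre_mk_add]
    rfl
  · change _ = toFibre (X.s z) (𝒞.mulT ⟨_, d⟩ ⟨_, toFibre (X.s z) _⟩)
    rw [hrm _ (hX.brH_self hΓH z), hzm _ hza,
      hℰ.ripT_ractT hX h𝒞 ⟨z, a⟩ ⟨z, b⟩ _ hzi rfl, h𝒞.star_star]
  · change _ = toFibre (X.s z) (𝒞.mulT ⟨_, toFibre (X.s z) _⟩ ⟨_, toFibre (X.s z) _⟩)
    rw [hrm _ (hX.brH_self hΓH z), hzm _ hza, hrm _ hi,
      hℰ.rip_mul ⟨z, a⟩ ⟨z, b⟩ _ rfl hzi]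
  · rw [norm_toFibre (by exact hX.brH_self hΓH z)]
    exact hℰ.norm_rip_self z a

end BundleEquivalenceOps.IsBundleEquivalence

/-! ### Saturation of the linking bundle -/

/-- If `B_y B_y*` spans a dense subspace of `B_{r y}`, and `B_{r y} B_{y w}` is dense in `B_{y w}`,
then `B_y B_w ⊇ B_y (B_y* B_{y w})` spans a dense subspace of `B_{y w}`. -/
theorem FellOps.dense_span_mul {G : Type u} [TopologicalSpace G] {Γ : GroupoidOps G}
    {B : G → Type v} [∀ x, NormedAddCommGroup (B x)] [∀ x, NormedSpace ℂ (B x)] [TopologicalSpace (Tot B)]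
    {ℬ : FellOps Γ B} (hB : IsUSCBanachBundle B)
    (hcont : ContinuousOn (fun p : Tot B × Tot B => ℬ.mulT p.1 p.2)
      {p | Γ.s p.1.base = Γ.r p.2.base})
    (add_mul : ∀ x y, Γ.s x = Γ.r y → ∀ (a a' : B x) (b : B y),
      ℬ.mul (a + a') b = ℬ.mul a b + ℬ.mul a' b)
    (smul_mul : ∀ x y, Γ.s x = Γ.r y → ∀ (c : ℂ) (a : B x) (b : B y),
      ℬ.mul (c • a) b = c • ℬ.mul a b)
    {y w : G} (hr : Γ.r (Γ.mul y w) = Γ.r y) (hs : Γ.s (Γ.r y) = Γ.r y)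
    (hmi : Γ.mul y (Γ.inv y) = Γ.r y) (hrm : Γ.mul (Γ.r y) (Γ.mul y w) = Γ.mul y w)
    (hinv : Γ.mul (Γ.inv y) (Γ.mul y w) = w)
    (happrox : ∀ (c : B (Γ.mul y w)) (ε : ℝ), 0 < ε → ∃ d : Tot B, d.base = Γ.r (Γ.mul y w) ∧
      ‖c - toFibre (Γ.mul y w) (ℬ.mulT d ⟨_, c⟩)‖ < ε)
    (hfull : Dense (Submodule.span ℂ
      {d : B (Γ.r y) | ∃ a b : B y, d = toFibre (Γ.r y) ⟨_, ℬ.mul a (ℬ.star b)⟩} :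
        Set (B (Γ.r y))))
    (hassoc : ∀ (a b : B y) (c : B (Γ.mul y w)),
      ℬ.mulT (ℬ.mulT ⟨y, a⟩ (ℬ.starT ⟨y, b⟩)) ⟨_, c⟩ =
        ℬ.mulT ⟨y, a⟩ (ℬ.mulT (ℬ.starT ⟨y, b⟩) ⟨_, c⟩)) :
    Dense (Submodule.span ℂ {c : B (Γ.mul y w) | ∃ (a : B y) (b : B w), c = ℬ.mul a b} :
      Set (B (Γ.mul y w))) := by
  set V := (Submodule.span ℂ {c : B (Γ.mul y w) | ∃ (a : B y) (b : B w), c = ℬ.mul a b})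
  have hsz : Γ.s (Γ.r y) = Γ.r (Γ.mul y w) := hs.trans hr.symm
  -- `B_{r y} c` is contained in the closure of the span of `B_y B_w`
  have h1 : ∀ (c : B (Γ.mul y w)) (d : B (Γ.r y)),
      toFibre (Γ.mul y w) (ℬ.mulT ⟨_, d⟩ ⟨_, c⟩) ∈ V.topologicalClosure := by
    intro c
    let T : B (Γ.r y) →ₗ[ℂ] B (Γ.mul y w) :=
      { toFun := fun d => toFibre (Γ.mul y w) (ℬ.mulT ⟨_, d⟩ ⟨_, c⟩)
        map_add' := fun d d' => by
          change toFibre _ (⟨_, ℬ.mul (d + d') c⟩ : Tot B) = _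
          rw [add_mul _ _ hsz, toFibre_mk_add]
          rfl
        map_smul' := fun k d => by
          change toFibre _ (⟨_, ℬ.mul (k • d) c⟩ : Tot B) = _
          rw [smul_mul _ _ hsz, toFibre_mk_smul]
          rfl }
    have hT : Continuous T := by
      refine continuous_iff_continuousAt.2 fun d => hB.tendsto_fibre_iff.1 ?_
      have h2 : Continuous fun d : B (Γ.r y) => ℬ.mulT ⟨_, d⟩ ⟨_, c⟩ :=
        hcont.comp_continuous ((hB.continuous_fibre _).prodMk continuous_const) fun d => hsz
      have h3 : ∀ d, (⟨_, T d⟩ : Tot B) = ℬ.mulT ⟨_, d⟩ ⟨_, c⟩ := fun d => mk_toFibre hrm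
      simp only [h3]
      exact h2.tendsto d
    have hV : (Set.univ : Set (B (Γ.r y))) ⊆ T ⁻¹' V.topologicalClosure := by
      rw [← hfull.closure_eq]
      refine closure_minimal ?_ (V.isClosed_topologicalClosure.preimage hT)
      change _ ≤ V.topologicalClosure.comap T
      rw [Submodule.span_le]
      rintro _ ⟨a, b, rfl⟩
      refine V.le_topologicalClosure (Submodule.subset_span
        ⟨a, toFibre w (ℬ.mulT (ℬ.starT ⟨y, b⟩) ⟨_, c⟩), ?_⟩)
      refine (toFibre_eq_iff (by exact hrm)).2 ?_
      have h4 : (⟨_, toFibre (Γ.r y) ⟨_, ℬ.mul a (ℬ.star b)⟩⟩ : Tot B) =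
        ℬ.mulT ⟨y, a⟩ (ℬ.starT ⟨y, b⟩) := mk_toFibre hmi
      rw [h4, hassoc]
      exact congrArg (ℬ.mulT ⟨y, a⟩) (mk_toFibre hinv).symm
    exact fun d => hV (Set.mem_univ d)
  intro c
  have h2 : c ∈ closure (V.topologicalClosure : Set (B (Γ.mul y w))) := by
    refine Metric.mem_closure_iff.2 fun ε hε => ?_
    obtain ⟨⟨x, d⟩, hx, hd⟩ := happrox c ε hε
    obtain rfl : x = Γ.r y := hx.trans hr
    exact ⟨_, h1 c d, by rwa [dist_eq_norm]⟩
  rwa [V.isClosed_topologicalClosure.closure_eq] at h2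

namespace LinkFibre

variable {G H Z : Type u} {B : G → Type v} {E : Z → Type v} {C : H → Type v}
  [∀ x, NormedAddCommGroup (B x)] [∀ x, NormedAddCommGroup (E x)] [∀ x, NormedAddCommGroup (C x)]

theorem toFibre_inB {g : G} {b : Tot B} (hb : b.base = g) :
    toFibre (.ofG g) (inB b : Tot (LinkFibre B E C)) = toFibre g b := by
  subst hb
  cases b
  rw [toFibre_mk]
  exact toFibre_mk _ _

theorem toFibre_inE {z : Z} {e : Tot E} (he : e.base = z) :
    toFibre (.ofZ z) (inE e : Tot (LinkFibre B E C)) = toFibre z e := by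
  subst he
  cases e
  rw [toFibre_mk]
  exact toFibre_mk _ _

theorem toFibre_inEop {z : Z} {e : Tot E} (he : e.base = z) :
    toFibre (.zop z) (inEop e : Tot (LinkFibre B E C)) = Conj.bar (toFibre z e) := by
  subst he
  cases e
  rw [toFibre_mk]
  exact toFibre_mk _ _

theorem toFibre_inC {h : H} {c : Tot C} (hc : c.base = h) :
    toFibre (.ofH h) (inC c : Tot (LinkFibre B E C)) = toFibre h c := by
  subst hc
  cases c
  rw [toFibre_mk]
  exact toFibre_mk _ _

end LinkFibre

namespace EquivalenceOps.IsEquivalence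

variable {G H Z : Type u} [TopologicalSpace G] [TopologicalSpace H] [TopologicalSpace Z]
  {X : EquivalenceOps G H Z} {ΓG : GroupoidOps G} {ΓH : GroupoidOps H}
  (hX : X.IsEquivalence ΓG ΓH) (hΓG : ΓG.IsTopologicalGroupoid) (hΓH : ΓH.IsTopologicalGroupoid)

include hX hΓG hΓH

theorem link_s_r (x : Link G Z H) :
    (X.link ΓG ΓH).s ((X.link ΓG ΓH).r x) = (X.link ΓG ΓH).r x := by
  cases x with
  | ofG g => exact congrArg Link.ofG (hΓG.s_r g)
  | ofZ z => exact congrArg Link.ofG (hX.s_r hΓG z)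
  | zop z => exact congrArg Link.ofH (hΓH.s_eq_of_mem (hX.s_mem z))
  | ofH h => exact congrArg Link.ofH (hΓH.s_r h)

theorem link_mul_inv (x : Link G Z H) :
    (X.link ΓG ΓH).mul x ((X.link ΓG ΓH).inv x) = (X.link ΓG ΓH).r x := by
  cases x with
  | ofG g => exact congrArg Link.ofG (hΓG.mul_inv g)
  | ofZ z => exact congrArg Link.ofG (hX.brG_self hΓG z)
  | zop z => exact congrArg Link.ofH (hX.brH_self hΓH z)
  | ofH h => exact congrArg Link.ofH (hΓH.mul_inv h)

theorem ract_inv_s (z : Z) : X.ract z (ΓH.inv (X.s z)) = z := by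
  rw [hΓH.inv_of_mem (hX.s_mem z), hX.unit_ract]

theorem link_r_mul_self (x : Link G Z H) :
    (X.link ΓG ΓH).mul ((X.link ΓG ΓH).r x) x = x := by
  cases x with
  | ofG g => exact congrArg Link.ofG (hΓG.r_mul_self g)
  | ofZ z => exact congrArg Link.ofZ (hX.unit_lact z)
  | zop z => exact congrArg Link.zop (hX.ract_inv_s hΓG hΓH z)
  | ofH h => exact congrArg Link.ofH (hΓH.r_mul_self h)

end EquivalenceOps.IsEquivalence

namespace BundleEquivalenceOps.IsBundleEquivalence

variable {G H Z : Type u} [TopologicalSpace G] [TopologicalSpace H] [TopologicalSpace Z]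
  {X : EquivalenceOps G H Z} {ΓG : GroupoidOps G} {ΓH : GroupoidOps H}
  {B : G → Type v} [∀ x, NormedAddCommGroup (B x)] [∀ x, NormedSpace ℂ (B x)]
  [TopologicalSpace (Tot B)] {ℬ : FellOps ΓG B}
  {C : H → Type v} [∀ x, NormedAddCommGroup (C x)] [∀ x, NormedSpace ℂ (C x)]
  [TopologicalSpace (Tot C)] {𝒞 : FellOps ΓH C}
  {E : Z → Type v} [∀ x, NormedAddCommGroup (E x)] [∀ x, NormedSpace ℂ (E x)]
  [TopologicalSpace (Tot E)] {ℰ : BundleEquivalenceOps X ΓG ΓH B C E}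
  (hℰ : ℰ.IsBundleEquivalence ℬ 𝒞) (hX : X.IsEquivalence ΓG ΓH)
  (hΓG : ΓG.IsTopologicalGroupoid) (hΓH : ΓH.IsTopologicalGroupoid)
  (hℬ : ℬ.IsFellBundle) (h𝒞 : 𝒞.IsFellBundle)

include hℰ hX hΓG hΓH hℬ h𝒞

/-- The fibre of the linking bundle over `r x` acts nondegenerately on the fibre over `x`. -/
theorem exists_norm_sub_link_mul_lt {x : Link G Z H} (c : LinkFibre B E C x) {ε : ℝ} (hε : 0 < ε) :
    ∃ d : Tot (LinkFibre B E C), d.base = (X.link ΓG ΓH).r x ∧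
      ‖c - toFibre x ((ℰ.link ℬ 𝒞).mulT d ⟨x, c⟩)‖ < ε := by
  cases x with
  | ofG g =>
    obtain ⟨d, hd⟩ := hℬ.exists_norm_sub_mul_lt hΓG (x := g) c hε
    refine ⟨LinkFibre.inB ⟨_, d⟩, rfl, ?_⟩
    rwa [← LinkFibre.toFibre_inB (E := E) (C := C) (by exact hΓG.r_mul_self g)] at hd
  | ofZ z =>
    obtain ⟨d, hd⟩ := hℰ.exists_norm_sub_lact_lt hX hΓG hℬ (z := z) c hε
    refine ⟨LinkFibre.inB ⟨_, d⟩, rfl, ?_⟩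
    rwa [← LinkFibre.toFibre_inE (B := B) (C := C) (by exact hX.unit_lact z)] at hd
  | zop z =>
    obtain ⟨d, hd⟩ := hℰ.exists_norm_sub_ract_lt hX hΓH h𝒞 (z := z) (Conj.unbar c) hε
    refine ⟨LinkFibre.inC ⟨_, d⟩, rfl, ?_⟩
    exact (congrArg (fun e => ‖c - e‖) (LinkFibre.toFibre_inEop (B := B) (C := C)
      (by exact hX.ract_inv_s hΓG hΓH z))).trans_lt hd
  | ofH h =>
    obtain ⟨d, hd⟩ := h𝒞.exists_norm_sub_mul_lt hΓH (x := h) c hε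
    refine ⟨LinkFibre.inC ⟨_, d⟩, rfl, ?_⟩
    rwa [← LinkFibre.toFibre_inC (B := B) (E := E) (by exact hΓH.r_mul_self h)] at hd

/-- Fullness of the inner product `a b*` on each fibre of the linking bundle. -/
theorem dense_span_link_mul_star (x : Link G Z H) : Dense (Submodule.span ℂ
    {d : LinkFibre B E C ((X.link ΓG ΓH).r x) | ∃ a b : LinkFibre B E C x,
      d = toFibre ((X.link ΓG ΓH).r x) ⟨_, (ℰ.link ℬ 𝒞).mul a ((ℰ.link ℬ 𝒞).star b)⟩} :
      Set (LinkFibre B E C ((X.link ΓG ΓH).r x))) := by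
  cases x with
  | ofG g =>
    refine Dense.mono (Submodule.span_mono ?_) (hℬ.full_left g)
    rintro _ ⟨a, b, rfl⟩
    exact ⟨a, b, (LinkFibre.toFibre_inB (E := E) (C := C) (by exact hΓG.mul_inv g)).symm⟩
  | ofZ z =>
    refine Dense.mono (Submodule.span_mono ?_) (hℰ.full_lip z)
    rintro _ ⟨a, b, rfl⟩
    exact ⟨a, b, (LinkFibre.toFibre_inB (E := E) (C := C) (by exact hX.brG_self hΓG z)).symm⟩
  | zop z =>
    refine Dense.mono (Submodule.span_mono ?_) (hℰ.full_rip z)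
    rintro _ ⟨a, b, rfl⟩
    exact ⟨a, b, (LinkFibre.toFibre_inC (B := B) (E := E) (by exact hX.brH_self hΓH z)).symm⟩
  | ofH h =>
    refine Dense.mono (Submodule.span_mono ?_) (h𝒞.full_left h)
    rintro _ ⟨a, b, rfl⟩
    exact ⟨a, b, (LinkFibre.toFibre_inC (B := B) (E := E) (by exact hΓH.mul_inv h)).symm⟩

/-- The product of the linking bundle is associative on the triples `(a, b*, c)`. -/
theorem link_mulT_star_assoc (a b c : Tot (LinkFibre B E C)) (hab : a.base = b.base)
    (hac : (X.link ΓG ΓH).r a.base = (X.link ΓG ΓH).r c.base) :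
    (ℰ.link ℬ 𝒞).mulT ((ℰ.link ℬ 𝒞).mulT a ((ℰ.link ℬ 𝒞).starT b)) c =
      (ℰ.link ℬ 𝒞).mulT a ((ℰ.link ℬ 𝒞).mulT ((ℰ.link ℬ 𝒞).starT b) c) := by
  obtain ⟨x, a⟩ := a
  obtain ⟨_, b⟩ := b
  obtain ⟨y, c⟩ := c
  obtain rfl := hab
  cases x <;> cases y <;> try (exfalso; revert hac; simp [EquivalenceOps.link]; done)
  · exact congrArg LinkFibre.inB (hℬ.mul_assoc ⟨_, a⟩ (ℬ.starT ⟨_, b⟩) ⟨_, c⟩ (hΓG.r_inv _).symm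
      ((hΓG.s_inv _).trans (Link.ofG.inj hac)))
  · exact congrArg LinkFibre.inE (hℰ.mul_lact ⟨_, a⟩ (ℬ.starT ⟨_, b⟩) ⟨_, c⟩ (hΓG.r_inv _).symm
      ((hΓG.s_inv _).trans (Link.ofG.inj hac)))
  · have h1 := hℰ.lipT_lactT hX hℬ (ℬ.starT ⟨_, c⟩) ⟨_, a⟩ ⟨_, b⟩
      ((hΓG.s_inv _).trans (Link.ofG.inj hac).symm) rfl
    rw [hℬ.star_star] at h1
    exact congrArg LinkFibre.inB h1.symm
  · exact congrArg LinkFibre.inE (hℰ.lip_lact ⟨_, a⟩ ⟨_, b⟩ ⟨_, c⟩ rfl (Link.ofG.inj hac))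
  · have h1 := hℰ.lip_lact ⟨_, c⟩ ⟨_, b⟩ ⟨_, a⟩ (Link.ofH.inj hac).symm rfl
    rw [← hℰ.star_lip ⟨_, b⟩ ⟨_, c⟩ (Link.ofH.inj hac), ← hℰ.star_rip ⟨_, a⟩ ⟨_, b⟩ rfl] at h1
    exact congrArg LinkFibre.inEop h1.symm
  · exact congrArg LinkFibre.inC (hℰ.rip_mul ⟨_, a⟩ ⟨_, b⟩ ⟨_, c⟩ rfl (Link.ofH.inj hac))
  · have h1 := hℰ.ract_mul ⟨_, c⟩ (𝒞.starT (𝒞.starT ⟨_, b⟩)) (𝒞.starT ⟨_, a⟩)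
      ((Link.ofH.inj hac).symm.trans (((hΓH.r_inv _).trans (hΓH.s_inv _)).symm))
      ((hΓH.s_inv _).trans rfl)
    rw [← h𝒞.star_mul ⟨_, a⟩ (𝒞.starT ⟨_, b⟩) (hΓH.r_inv _).symm] at h1
    exact congrArg LinkFibre.inEop h1
  · exact congrArg LinkFibre.inC (h𝒞.mul_assoc ⟨_, a⟩ (𝒞.starT ⟨_, b⟩) ⟨_, c⟩ (hΓH.r_inv _).symm
      ((hΓH.s_inv _).trans (Link.ofH.inj hac)))

theorem dense_span_link_mul (x y : Link G Z H) (hxy : (X.link ΓG ΓH).s x = (X.link ΓG ΓH).r y) :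
    Dense (Submodule.span ℂ {c : LinkFibre B E C ((X.link ΓG ΓH).mul x y) |
      ∃ (a : LinkFibre B E C x) (b : LinkFibre B E C y), c = (ℰ.link ℬ 𝒞).mul a b} :
        Set (LinkFibre B E C ((X.link ΓG ΓH).mul x y))) :=
  FellOps.dense_span_mul
    (LinkFibre.isUSCBanachBundle hℬ.toIsUSCBanachBundle hℰ.toIsUSCBanachBundle
      h𝒞.toIsUSCBanachBundle)
    (hℰ.continuousOn_link_mulT hΓG hΓH hℬ h𝒞) (hℰ.link_add_mul hΓG hΓH hℬ h𝒞)
    (hℰ.link_smul_mul hΓG hΓH hℬ h𝒞) (hX.link_r_mul hΓG hΓH x y hxy) (hX.link_s_r hΓG hΓH x)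
    (hX.link_mul_inv hΓG hΓH x) (by
      have := hX.link_r_mul_self hΓG hΓH ((X.link ΓG ΓH).mul x y)
      rwa [hX.link_r_mul hΓG hΓH x y hxy] at this)
    (hX.link_inv_mul_cancel_left hΓG hΓH x y hxy)
    (fun c _ hε => hℰ.exists_norm_sub_link_mul_lt hX hΓG hΓH hℬ h𝒞 c hε)
    (hℰ.dense_span_link_mul_star hX hΓG hΓH hℬ h𝒞 x)
    (fun a b c => hℰ.link_mulT_star_assoc hX hΓG hΓH hℬ h𝒞 ⟨x, a⟩ ⟨x, b⟩ ⟨_, c⟩ rfl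
      (hX.link_r_mul hΓG hΓH x y hxy).symm)

end BundleEquivalenceOps.IsBundleEquivalence

/-! ### The linking algebra -/

namespace BundleEquivalenceOps.IsBundleEquivalence

variable {G H Z : Type u}
  [TopologicalSpace G] [LocallyCompactSpace G] [T2Space G] [SecondCountableTopology G]
  [MeasurableSpace G] [BorelSpace G]
  [TopologicalSpace H] [LocallyCompactSpace H] [T2Space H] [SecondCountableTopology H]
  [MeasurableSpace H] [BorelSpace H]
  [TopologicalSpace Z] [LocallyCompactSpace Z] [T2Space Z]
  {X : EquivalenceOps G H Z} {ΓG : GroupoidOps G} {ΓH : GroupoidOps H}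
  {lamG : G → Measure G} {lamH : H → Measure H}
  {B : G → Type v} [∀ x, NormedAddCommGroup (B x)] [∀ x, NormedSpace ℂ (B x)]
  [TopologicalSpace (Tot B)] {ℬ : FellOps ΓG B}
  {C : H → Type v} [∀ x, NormedAddCommGroup (C x)] [∀ x, NormedSpace ℂ (C x)]
  [TopologicalSpace (Tot C)] {𝒞 : FellOps ΓH C}
  {E : Z → Type v} [∀ x, NormedAddCommGroup (E x)] [∀ x, NormedSpace ℂ (E x)]
  [TopologicalSpace (Tot E)] {ℰ : BundleEquivalenceOps X ΓG ΓH B C E}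

theorem isConvolutionBundle_link
    (hℰ : ℰ.IsBundleEquivalence ℬ 𝒞) (hX : X.IsEquivalence ΓG ΓH)
    (hΓG : ΓG.IsTopologicalGroupoid) (hΓH : ΓH.IsTopologicalGroupoid)
    (hlamG : ΓG.IsHaarSystem lamG) (hlamH : ΓH.IsHaarSystem lamH)
    (hℬ : ℬ.IsFellBundle) (h𝒞 : 𝒞.IsFellBundle) :
    (ℰ.link ℬ 𝒞).IsConvolutionBundle (X.linkHaar ΓG lamG lamH) where
  bundle := LinkFibre.isUSCBanachBundle hℬ.toIsUSCBanachBundle hℰ.toIsUSCBanachBundle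
    h𝒞.toIsUSCBanachBundle
  r_r := hX.link_r_r hΓG hΓH
  r_mul := hX.link_r_mul hΓG hΓH
  r_inv := hX.link_r_inv hΓG hΓH
  s_inv := hX.link_s_inv hΓG hΓH
  inv_inv := hX.link_inv_inv hΓG hΓH
  inv_mul_cancel_left := hX.link_inv_mul_cancel_left hΓG hΓH
  continuous_r := hX.continuous_link_r hΓG hΓH
  continuous_inv := hX.continuous_link_inv hΓG hΓH
  continuousOn_mul := hX.continuousOn_link_mul hΓG hΓH
  continuousOn_mulT := hℰ.continuousOn_link_mulT hΓG hΓH hℬ h𝒞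
  continuous_starT := hℰ.continuous_link_starT hℬ h𝒞
  smul_mul := hℰ.link_smul_mul hΓG hΓH hℬ h𝒞
  mul_smul := hℰ.link_mul_smul hΓG hΓH hℬ h𝒞
  star_smul := hℰ.link_star_smul hℬ h𝒞
  dense_mul := hℰ.dense_span_link_mul hX hΓG hΓH hℬ h𝒞
  finite _ hu := hX.isFiniteMeasureOnCompacts_linkHaar hΓG hΓH hlamG hlamH hu
  null_compl _ hu := hX.linkHaar_null_compl hΓG hΓH hlamG hlamH hu
  pos_of_mem _ hu _ hU hex := hX.linkHaar_pos hΓG hΓH hlamG hlamH hu hU hex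
  continuousOn_haar _ hF hFc := hX.continuousOn_linkHaar hΓG hΓH hlamG hlamH hF hFc

end BundleEquivalenceOps.IsBundleEquivalence

namespace EquivalenceOps.IsEquivalence

variable {G H Z : Type u} [TopologicalSpace G] [TopologicalSpace H] [TopologicalSpace Z]
  {X : EquivalenceOps G H Z} {ΓG : GroupoidOps G} {ΓH : GroupoidOps H}
  (hX : X.IsEquivalence ΓG ΓH) (hΓG : ΓG.IsTopologicalGroupoid) (hΓH : ΓH.IsTopologicalGroupoid)

include hX hΓG hΓH

theorem isClopen_link_r_mem_ofG :
    IsClopen {x | (X.link ΓG ΓH).r x ∈ Link.ofG '' ΓG.units} := by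
  have h1 : {x | (X.link ΓG ΓH).r x ∈ Link.ofG '' ΓG.units} =
      (X.link ΓG ΓH).r ⁻¹' Set.range Link.ofG := by
    ext x
    refine ⟨fun ⟨w, _, hw⟩ => ⟨w, hw⟩, fun ⟨w, hw⟩ => ⟨w, ?_, hw⟩⟩
    exact Link.ofG.inj ((congrArg (X.link ΓG ΓH).r hw).trans
      ((hX.link_r_r hΓG hΓH x).trans hw.symm))
  rw [h1]
  have h2 : IsClopen (Set.range (Link.ofG : G → Link G Z H)) :=
    ⟨Link.isClosedEmbedding_ofG.isClosed_range, Link.isOpenEmbedding_ofG.isOpen_range⟩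
  exact h2.preimage (hX.continuous_link_r hΓG hΓH)

theorem isClopen_link_r_mem_ofH :
    IsClopen {x | (X.link ΓG ΓH).r x ∈ Link.ofH '' ΓH.units} := by
  have h1 : {x | (X.link ΓG ΓH).r x ∈ Link.ofH '' ΓH.units} =
      (X.link ΓG ΓH).r ⁻¹' Set.range Link.ofH := by
    ext x
    refine ⟨fun ⟨w, _, hw⟩ => ⟨w, hw⟩, fun ⟨w, hw⟩ => ⟨w, ?_, hw⟩⟩
    exact Link.ofH.inj ((congrArg (X.link ΓG ΓH).r hw).trans
      ((hX.link_r_r hΓG hΓH x).trans hw.symm))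
  rw [h1]
  have h2 : IsClopen (Set.range (Link.ofH : H → Link G Z H)) :=
    ⟨Link.isClosedEmbedding_ofH.isClosed_range, Link.isOpenEmbedding_ofH.isOpen_range⟩
  exact h2.preimage (hX.continuous_link_r hΓG hΓH)

theorem exists_link_s_mem_ofG (x : Link G Z H) :
    ∃ y, (X.link ΓG ΓH).s y ∈ Link.ofG '' ΓG.units ∧
      (X.link ΓG ΓH).r y = (X.link ΓG ΓH).r x := by
  rcases link_units_cases (hX.link_r_r hΓG hΓH x) with ⟨w, hw, hx⟩ | ⟨w, hw, hx⟩
  · exact ⟨.ofG w, ⟨w, hw, congrArg Link.ofG (hΓG.s_eq_of_mem hw).symm⟩,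
      (congrArg Link.ofG hw).trans hx.symm⟩
  · obtain ⟨z, rfl⟩ := hX.surj_s w hw
    exact ⟨.zop z, ⟨_, hX.r_mem z, rfl⟩, hx.symm⟩

theorem exists_link_s_mem_ofH (x : Link G Z H) :
    ∃ y, (X.link ΓG ΓH).s y ∈ Link.ofH '' ΓH.units ∧
      (X.link ΓG ΓH).r y = (X.link ΓG ΓH).r x := by
  rcases link_units_cases (hX.link_r_r hΓG hΓH x) with ⟨w, hw, hx⟩ | ⟨w, hw, hx⟩
  · obtain ⟨z, rfl⟩ := hX.surj_r w hw
    exact ⟨.ofZ z, ⟨_, hX.s_mem z, rfl⟩, hx.symm⟩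
  · exact ⟨.ofH w, ⟨w, hw, congrArg Link.ofH (hΓH.s_eq_of_mem hw).symm⟩,
      (congrArg Link.ofH hw).trans hx.symm⟩

end EquivalenceOps.IsEquivalence

end

theorem lemma3p3 {G H Z : Type u}
    [TopologicalSpace G] [LocallyCompactSpace G] [T2Space G] [SecondCountableTopology G]
    [MeasurableSpace G] [BorelSpace G]
    [TopologicalSpace H] [LocallyCompactSpace H] [T2Space H] [SecondCountableTopology H]
    [MeasurableSpace H] [BorelSpace H]
    [TopologicalSpace Z] [LocallyCompactSpace Z] [T2Space Z]
    (ΓG : GroupoidOps G) (hΓG : ΓG.IsTopologicalGroupoid)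
    (ΓH : GroupoidOps H) (hΓH : ΓH.IsTopologicalGroupoid)
    (lamG : G → Measure G) (hlamG : ΓG.IsHaarSystem lamG)
    (lamH : H → Measure H) (hlamH : ΓH.IsHaarSystem lamH)
    (X : EquivalenceOps G H Z) (hX : X.IsEquivalence ΓG ΓH)
    {B : G → Type v} [∀ x, NormedAddCommGroup (B x)] [∀ x, NormedSpace ℂ (B x)]
    [TopologicalSpace (Tot B)] (ℬ : FellOps ΓG B) (hℬ : ℬ.IsFellBundle)
    {C : H → Type v} [∀ x, NormedAddCommGroup (C x)] [∀ x, NormedSpace ℂ (C x)]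
    [TopologicalSpace (Tot C)] (𝒞 : FellOps ΓH C) (h𝒞 : 𝒞.IsFellBundle)
    {E : Z → Type v} [∀ x, NormedAddCommGroup (E x)] [∀ x, NormedSpace ℂ (E x)]
    [TopologicalSpace (Tot E)] (ℰ : BundleEquivalenceOps X ΓG ΓH B C E)
    (hℰ : ℰ.IsBundleEquivalence ℬ 𝒞) :
    (∃! PG : 𝓜(ℂ, (ℰ.link ℬ 𝒞).CStar (X.linkHaar ΓG lamG lamH)),
      (ℰ.link ℬ 𝒞).IsCutdown (X.linkHaar ΓG lamG lamH) (Link.ofG '' ΓG.units) PG) ∧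
    (∃! PH : 𝓜(ℂ, (ℰ.link ℬ 𝒞).CStar (X.linkHaar ΓG lamG lamH)),
      (ℰ.link ℬ 𝒞).IsCutdown (X.linkHaar ΓG lamG lamH) (Link.ofH '' ΓH.units) PH) ∧
    (∀ PG : 𝓜(ℂ, (ℰ.link ℬ 𝒞).CStar (X.linkHaar ΓG lamG lamH)),
      (ℰ.link ℬ 𝒞).IsCutdown (X.linkHaar ΓG lamG lamH) (Link.ofG '' ΓG.units) PG →
        IsStarProjection PG ∧ IsFullMultiplier PG) ∧
    (∀ PH : 𝓜(ℂ, (ℰ.link ℬ 𝒞).CStar (X.linkHaar ΓG lamG lamH)),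
      (ℰ.link ℬ 𝒞).IsCutdown (X.linkHaar ΓG lamG lamH) (Link.ofH '' ΓH.units) PH →
        IsStarProjection PH ∧ IsFullMultiplier PH) := by
  have h := hℰ.isConvolutionBundle_link hX hΓG hΓH hlamG hlamH hℬ h𝒞
  have hG := hX.isClopen_link_r_mem_ofG hΓG hΓH
  have hH := hX.isClopen_link_r_mem_ofH hΓG hΓH
  exact ⟨h.existsUnique_isCutdown hG, h.existsUnique_isCutdown hH,
    fun _ hp => ⟨h.isStarProjection_of_isCutdown hG hp,
      h.isFullMultiplier_of_isCutdown hG (hX.exists_link_s_mem_ofG hΓG hΓH) hp⟩,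
    fun _ hp => ⟨h.isStarProjection_of_isCutdown hH hp,
      h.isFullMultiplier_of_isCutdown hH (hX.exists_link_s_mem_ofH hΓG hΓH) hp⟩⟩
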